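/- For $x\in\mathbb{C}$ let $(x)_n=x(x+1)\cdots(x+n-1)$, and let $H_n^{(s)}=\sum_{j=1}^n j^{-s}$, $H_n=H_n^{(1)}$. For $a,b,c\in\mathbb{C}$ put $$\begin{aligned}P(n)={}&8 n^2\big(240 a^2-120 a (2 b+2 c+1)+54 b^2+60 b (2 c+1)+54 c^2+60 c+13\big)\\&+(4 a-2 b-1)(4 a-2 c-1)\big(16 a^2-8 a (3 b+3 c+1)+8 b^2+b (20 c+6)+8 c^2+6 c+1\big)\\&+8 n\big(-144 a^3+8 a^2 (27 b+27 c+14)-2 a (48 b^2+4 b (27 c+14)+48 c^2+56 c+13)\\&\qquad+12 b^3+24 b^2 (2 c+1)+b (48 c^2+56 c+13)+12 c^3+24 c^2+13 c+2\big)\\&+32 n^3 (-42 a+21 b+21 c+10)+336 n^4\end{aligned}$$ and let $S(a,b,c;n)$ be $$\frac{2^{-4n}P(n)\,(\frac12-b)_n(\frac12+b)_n(\frac12-c)_n(\frac12+c)_n(\frac12-2a+b)_n(\frac12-2a+c)_n(\frac12-2a+2b+c)_n(\frac12-2a+b+2c)_n}{(1)_n(1-a)_n(1-2a+b+c+2n)(1-a+b)_n(1-a+c)_n(1-2a+b+c)_n(1-2a+b+c)_{2n}(1-a+b+c)_n}.$$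 (1) For all $a,b,c\in\mathbb{C}$ such that none of $a,\ a-b,\ a-c,\ 2a-b-c,\ a-b-c$ is a positive integer, the series below converges absolutely and $$\sum_{n\ge0}S(a,b,c;n)=\frac{2^{-4a+2b+2c+5}\,\Gamma(1-a)\,\Gamma(1-a+b)\,\Gamma(1-a+c)\,\Gamma(1-2a+b+c)^2\,\Gamma(1-a+b+c)}{\pi\,\Gamma(\frac12-2a+b)\,\Gamma(\frac12-2a+c)\,\Gamma(\frac12-2a+2b+c)\,\Gamma(\frac12-2a+b+2c)},$$ where $1/\Gamma$ is read as $0$ at the poles of $\Gamma$. (2) With $a_n=2^{-6n}(\frac12)_n^7/(1)_n^7$ one has $S(0,0,0;n)=a_n(168n^3+76n^2+14n+1)$ for all $n\ge 0$, and $$\sum_{n\ge0}a_n(168n^3+76n^2+14n+1)=\frac{32}{\pi^3}.$$ (3) Let $V_N(S)$ be the $\mathbb{Q}$-linear span, in the space of functions $\mathbb{N}\to\mathbb{C}$, of the functions $n\mapsto[S(a,b,c;n)][a^ib^jc^k]$ with $i+j+k=N$, where $[\,\cdot\,][a^ib^jc^k]$ is the coefficient of $a^ib^jc^k$ in the power series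 expansion at $a=b=c=0$. Put $p_0=1+8n+28n^2$, $p_1=7+76n+252n^2$, $p_2=1+6n$, $p_3=83+546n$. The following series converge absolutely to the stated values, and their summands, as functions of $n$, belong to $V_1,V_2,V_2,V_3,V_4,V_4,V_5$ of $S$ respectively: $$\sum_{n\ge0}a_n\Big(\tfrac{p_1}{7}+(H_{2n}-H_n)p_0p_2\Big)=\frac{320\log 2}{7\pi^3},$$ $$\sum_{n\ge0}a_np_2\Big(\tfrac1{336}+\tfrac{1}{2688}\big(-5H_n^{(2)}+16H_{2n}^{(2)}\big)p_0\Big)=\frac{5}{504\pi},$$ $$\sum_{n\ge0}a_n\Big((H_{2n}-H_n)p_1+\tfrac1{32}\big(112H_n^2-224H_nH_{2n}+112H_{2n}^2+3H_n^{(2)}\big)p_0p_2+\tfrac{p_3}{28}\Big)=\frac{1600\log^2 2}{7\pi^3}-\frac{23}{14\pi},$$ $$\begin{aligned}\sum_{n\ge0}a_n\Big(1&+\tfrac1{24}\big(-5H_n^{(2)}+16H_{2n}^{(2)}\big)p_1+\tfrac73(H_{2n}-H_n)p_2\\&+\tfrac1{24}\big(35H_nH_n^{(2)}-35H_{2n}H_n^{(2)}+5H_n^{(3)}-112H_nH_{2n}^{(2)}+112H_{2n}H_{2n}^{(2)}-32H_{2n}^{(3)}\big)p_0p_2\Big)=\frac{100\log2}{9\pi}-\frac{36\zeta(3)}{\pi^3},\end{aligned}$$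 $$\sum_{n\ge0}a_n\Big(\tfrac1{1+2n}+\tfrac1{64}\big(-7H_n^{(4)}+128H_{2n}^{(4)}\big)p_0p_2\Big)=\frac{61\pi}{180},$$ $$\begin{aligned}\sum_{n\ge0}a_n\Big(\tfrac1{1+2n}&+\tfrac14\big(-5H_n^{(2)}+16H_{2n}^{(2)}\big)p_2\\&+\tfrac1{128}\big(50(H_n^{(2)})^2+3H_n^{(4)}-320H_n^{(2)}H_{2n}^{(2)}+512(H_{2n}^{(2)})^2\big)p_0p_2\Big)=\frac{16\pi}{45},\end{aligned}$$ $$\begin{aligned}\sum_{n\ge0}a_n\Big(&-\tfrac{1+7(1+2n)(H_n-H_{2n})}{(1+2n)^2}+\tfrac1{64}\big(-7H_n^{(4)}+128H_{2n}^{(4)}\big)p_1\\&+\tfrac1{64}\big(49H_nH_n^{(4)}-49H_{2n}H_n^{(4)}+14H_n^{(5)}-896H_nH_{2n}^{(4)}+896H_{2n}H_{2n}^{(4)}-512H_{2n}^{(5)}\big)p_0p_2\Big)=\frac{61\pi\log2}{18}-\frac{249\zeta(5)}{\pi^3}.\end{aligned}$$ The first, second and fifth of these were conjectured by Sun as (181),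 (183) and (185). -/

import Mathlib

open scoped Nat

noncomputable section

namespace GourevichExt

/-- The rising factorial `(x)_n = x (x + 1) ⋯ (x + n - 1)` of a complex number. -/
def rising (x : ℂ) (n : ℕ) : ℂ := (ascPochhammer ℂ n).eval x

/-- The polynomial `P(n)` with parameters `a, b, c`. -/
def P (a b c n : ℂ) : ℂ :=
  8 * n ^ 2 * (240 * a ^ 2 - 120 * a * (2 * b + 2 * c + 1) + 54 * b ^ 2 + 60 * b * (2 * c + 1)
      + 54 * c ^ 2 + 60 * c + 13)
    + (4 * a - 2 * b - 1) * (4 * a - 2 * c - 1)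
      * (16 * a ^ 2 - 8 * a * (3 * b + 3 * c + 1) + 8 * b ^ 2 + b * (20 * c + 6)
        + 8 * c ^ 2 + 6 * c + 1)
    + 8 * n * (-144 * a ^ 3 + 8 * a ^ 2 * (27 * b + 27 * c + 14)
        - 2 * a * (48 * b ^ 2 + 4 * b * (27 * c + 14) + 48 * c ^ 2 + 56 * c + 13)
        + 12 * b ^ 3 + 24 * b ^ 2 * (2 * c + 1) + b * (48 * c ^ 2 + 56 * c + 13)
        + 12 * c ^ 3 + 24 * c ^ 2 + 13 * c + 2)
    + 32 * n ^ 3 * (-42 * a + 21 * b + 21 * c + 10)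
    + 336 * n ^ 4

/-- The summand `S(a, b, c; n)`. -/
def S (a b c : ℂ) (n : ℕ) : ℂ :=
  ((2 : ℂ) ^ (4 * n))⁻¹ * P a b c n
    * (rising (1 / 2 - b) n * rising (b + 1 / 2) n * rising (1 / 2 - c) n * rising (c + 1 / 2) n
      * rising (-2 * a + b + 1 / 2) n * rising (-2 * a + c + 1 / 2) n
      * rising (-2 * a + 2 * b + c + 1 / 2) n * rising (-2 * a + b + 2 * c + 1 / 2) n)
    / (rising 1 n * rising (1 - a) n * (-2 * a + b + c + 2 * n + 1)
      * rising (-a + b + 1) n * rising (-a + c + 1) n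
      * rising (-2 * a + b + c + 1) n * rising (-2 * a + b + c + 1) (2 * n)
      * rising (-a + b + c + 1) n)

/-- The coefficient of `a ^ i * b ^ j * c ^ k` in the power series expansion at the origin of a
function `f` of three complex variables that is analytic around the origin. -/
def coeff (f : ℂ → ℂ → ℂ → ℂ) (i j k : ℕ) : ℂ :=
  iteratedDeriv i (fun a => iteratedDeriv j (fun b => iteratedDeriv k (fun c => f a b c) 0) 0) 0
    / ((i ! : ℂ) * (j ! : ℂ) * (k ! : ℂ))

/-- `V_N(S)`: the `ℚ`-span, inside the space of functions `ℕ → ℂ`, of the coefficients of `S`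
at the monomials of degree `N` in `a, b, c`. -/
def V (N : ℕ) : Submodule ℚ (ℕ → ℂ) :=
  Submodule.span ℚ
    {g | ∃ i j k : ℕ, i + j + k = N ∧ g = fun n => coeff (fun a b c => S a b c n) i j k}

/-- The series `∑ f n` is obtained from degree `N` coefficients of `S`, and it converges
(absolutely) to `v`. -/
def CoeffIdentity (N : ℕ) (f : ℕ → ℂ) (v : ℂ) : Prop :=
  f ∈ V N ∧ HasSum f v

/-- The generalized harmonic number `H_n^{(s)} = 1 + 2^{-s} + ⋯ + n^{-s}`. -/
def H (s n : ℕ) : ℂ := ∑ j ∈ Finset.Icc 1 n, 1 / (j : ℂ) ^ s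

/-- `a_n = (1 / 2^6)^n * (1/2)_n^7 / (1)_n^7`. -/
def A (n : ℕ) : ℂ := (1 / 2 ^ 6) ^ n * (rising (1 / 2) n ^ 7 / rising 1 n ^ 7)

def p0 (n : ℂ) : ℂ := 1 + 8 * n + 28 * n ^ 2

def p1 (n : ℂ) : ℂ := 7 + 76 * n + 252 * n ^ 2

def p2 (n : ℂ) : ℂ := 1 + 6 * n

def p3 (n : ℂ) : ℂ := 83 + 546 * n

end GourevichExt

end

open scoped Nat Topology

open Filter

noncomputable section

namespace GourevichExt

/-! ### The rising factorial and the hypergeometric part of the summand -/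

/-! The summation formula comes from a WZ-type recurrence in `a`. There is a rational certificate
for which the summand at `a`, minus an explicit factor times the summand at `a - 1`, is a forward
difference in `n` (`S_sub_shiftFactor_mul`). The certificate term vanishes at `n = 0` and tends to
`0`, so the sum F(a) satisfies F(a) = `shiftFactor` * F(a - 1), hence F(a) = `shiftProduct` k * F(a
- k) for every k.

Now let k tend to infinity. In F(a - k) / k^3 only the term `n = 0` survives, with limit 128:
consecutive terms have ratio at most 1/2 uniformly in `n`, and the first ratio tends to 0
(`tendsto_tsum_S`). By Euler's limit for the Gamma function, `shiftProduct` k * k^3 tends to the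
claimed value divided by 128 (`tendsto_shiftProduct`). Since the product of the two is constantly
F(a), the formula follows directly, with no analytic continuation.

For the harmonic-number series, restrict the formula to a line t ↦ (αt, βt, γt) with rational
direction and compare coefficients of t^N. The bound on the summand is uniform near the origin, so
Taylor coefficients may be taken termwise (`hasSum_taylor`). An N-th derivative along a rational
direction is a rational combination of mixed partials of order N, which gives membership in `V N`
(`taylor_line_mem_V`).

Both sides are computed through logarithms. A Pochhammer symbol, a Gamma factor or a power of 2 is
its value at 0 times exp of an explicit power series (`ExpSeries`), whose coefficients are harmonic
numbers on the side of the summand, and zeta values, log 2 and Euler's constant on the side of the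
value. Euler's constant drops out. Each stated series is a rational combination of such coefficients
along one to four lines, with weights chosen to cancel the unwanted products of harmonic numbers. -/

lemma rising_zero (x : ℂ) : rising x 0 = 1 := by simp [rising]

lemma rising_succ (x : ℂ) (n : ℕ) : rising x (n + 1) = rising x n * (x + n) := by
  simp [rising, ascPochhammer_succ_eval]

lemma rising_succ_left (x : ℂ) (n : ℕ) : rising x (n + 1) = x * rising (x + 1) n := by
  simp [rising, ascPochhammer_succ_left, Polynomial.eval_comp]

lemma rising_ne_zero {x : ℂ} (h : ∀ m : ℕ, x + m ≠ 0) (n : ℕ) : rising x n ≠ 0 := by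
  induction n with
  | zero => simp [rising_zero]
  | succ n ih => rw [rising_succ]; exact mul_ne_zero ih (h n)

lemma mul_rising_add_one (x : ℂ) (n : ℕ) : x * rising (x + 1) n = rising x n * (x + n) := by
  rw [← rising_succ_left, rising_succ]

lemma mul_mul_rising_add_two (x : ℂ) (n : ℕ) :
    x * (x + 1) * rising (x + 2) n = rising x n * ((x + n) * (x + n + 1)) := by
  have h := mul_rising_add_one (x + 1) n
  rw [show x + 1 + 1 = x + 2 by ring] at h
  linear_combination x * h + (x + 1 + n) * mul_rising_add_one x n

/-- The summand without its polynomial factor and without the factor `1 - 2a + b + c + 2n`. -/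
def core (a b c : ℂ) (n : ℕ) : ℂ :=
  (rising (1 / 2 - b) n * rising (b + 1 / 2) n * rising (1 / 2 - c) n * rising (c + 1 / 2) n
      * rising (-2 * a + b + 1 / 2) n * rising (-2 * a + c + 1 / 2) n
      * rising (-2 * a + 2 * b + c + 1 / 2) n * rising (-2 * a + b + 2 * c + 1 / 2) n)
    / (2 ^ (4 * n) * (rising 1 n * rising (1 - a) n * rising (-a + b + 1) n * rising (-a + c + 1) n
      * rising (-2 * a + b + c + 1) n * rising (-2 * a + b + c + 1) (2 * n)
      * rising (-a + b + c + 1) n))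

lemma S_eq_core (a b c : ℂ) (n : ℕ) :
    S a b c n = core a b c n * (P a b c n / (-2 * a + b + c + 2 * n + 1)) := by
  rw [S, core]
  simp only [div_eq_mul_inv, mul_inv]
  ring

/-- The quotient of two consecutive values of `core`. -/
def coreRatio (a b c n : ℂ) : ℂ :=
  ((1 / 2 - b + n) * (b + 1 / 2 + n) * (1 / 2 - c + n) * (c + 1 / 2 + n)
      * (-2 * a + b + 1 / 2 + n) * (-2 * a + c + 1 / 2 + n)
      * (-2 * a + 2 * b + c + 1 / 2 + n) * (-2 * a + b + 2 * c + 1 / 2 + n))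
    / (16 * ((1 + n) * (1 - a + n) * (-a + b + 1 + n) * (-a + c + 1 + n)
      * (-2 * a + b + c + 1 + n)
      * ((-2 * a + b + c + 1 + 2 * n) * (-2 * a + b + c + 1 + (2 * n + 1)))
      * (-a + b + c + 1 + n)))

lemma core_zero (a b c : ℂ) : core a b c 0 = 1 := by simp [core, rising_zero]

lemma prod_pairs_eight {R : Type*} [CommRing R]
    (r₁ r₂ r₃ r₄ r₅ r₆ r₇ r₈ s₁ s₂ s₃ s₄ s₅ s₆ s₇ s₈ : R) :
    r₁ * s₁ * (r₂ * s₂) * (r₃ * s₃) * (r₄ * s₄) * (r₅ * s₅) * (r₆ * s₆) * (r₇ * s₇) * (r₈ * s₈)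
      = r₁ * r₂ * r₃ * r₄ * r₅ * r₆ * r₇ * r₈ * (s₁ * s₂ * s₃ * s₄ * s₅ * s₆ * s₇ * s₈) := by
  ring

lemma prod_pairs_seven (t r₁ r₂ r₃ r₄ r₅ r₆ r₇ s₁ s₂ s₃ s₄ s₅ s₆ s₆' s₇ : ℂ) :
    t * 2 ^ 4 * (r₁ * s₁ * (r₂ * s₂) * (r₃ * s₃) * (r₄ * s₄) * (r₅ * s₅) * (r₆ * s₆ * s₆')
        * (r₇ * s₇))
      = t * (r₁ * r₂ * r₃ * r₄ * r₅ * r₆ * r₇)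
        * (16 * (s₁ * s₂ * s₃ * s₄ * s₅ * (s₆ * s₆') * s₇)) := by
  ring

/-- No admissibility is needed: both sides are the same quotient of products, also when a
denominator is zero. The growth bounds below therefore hold for all parameters. -/
lemma core_succ (a b c : ℂ) (n : ℕ) :
    core a b c (n + 1) = core a b c n * coreRatio a b c n := by
  rw [core, core, coreRatio, div_mul_div_comm, show 2 * (n + 1) = 2 * n + 1 + 1 by ring,
    show 4 * (n + 1) = 4 * n + 4 by ring, pow_add]
  simp only [rising_succ]
  push_cast
  exact congr_arg₂ (· / ·) (prod_pairs_eight ..) (prod_pairs_seven ..)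

/-- The condition on the parameters under which no denominator of the summand vanishes. -/
def Admissible (a b c : ℂ) : Prop :=
  ∀ m : ℕ, a ≠ m + 1 ∧ a - b ≠ m + 1 ∧ a - c ≠ m + 1 ∧ 2 * a - b - c ≠ m + 1 ∧
    a - b - c ≠ m + 1

namespace Admissible

variable {a b c : ℂ} (h : Admissible a b c) (n : ℕ)
include h

lemma sub_ne : 1 - a + n ≠ 0 := fun h0 => (h n).1 (by linear_combination -h0)

lemma sub_b_ne : -a + b + 1 + n ≠ 0 := fun h0 => (h n).2.1 (by linear_combination -h0)

lemma sub_c_ne : -a + c + 1 + n ≠ 0 := fun h0 => (h n).2.2.1 (by linear_combination -h0)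

lemma two_sub_ne : -2 * a + b + c + 1 + n ≠ 0 :=
  fun h0 => (h n).2.2.2.1 (by linear_combination -h0)

lemma sub_bc_ne : -a + b + c + 1 + n ≠ 0 := fun h0 => (h n).2.2.2.2 (by linear_combination -h0)

lemma shift : Admissible (a - n) b c := by
  intro m
  have h1 := h (m + n)
  -- The condition on `2 * a - b - c` moves by `2 * n` when `a` moves by `n`; the others move by
  -- `n`.
  have h2 := (h (m + 2 * n)).2.2.2.1
  push_cast at h1 h2
  refine ⟨fun e => h1.1 ?_, fun e => h1.2.1 ?_, fun e => h1.2.2.1 ?_, fun e => h2 ?_,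
    fun e => h1.2.2.2.2 ?_⟩ <;> linear_combination e

end Admissible

/-! ### The telescoping relation between the parameters `a` and `a - 1` -/

/-- The polynomial `P` in the coordinates `m = n + 1/2`, `p = n + 1/2 - 2a + b + c`,
`A = (b² + c²)/2`, `K = ((b² - c²)/4)²`. -/
def polyHat (m p A K : ℂ) : ℂ :=
  16 * (A ^ 2 - 4 * K) + 16 * (m + p) * A - 32 * (m ^ 2 + m * p + p ^ 2) * A
    - 8 * (m + p) + 32 * (m ^ 2 + 2 * m * p + p ^ 2)
    - 8 * (5 * m ^ 3 + 17 * m ^ 2 * p + 17 * m * p ^ 2 + 5 * p ^ 3)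
    + 16 * (m ^ 4 + 5 * m ^ 3 * p + 9 * m ^ 2 * p ^ 2 + 5 * m * p ^ 3 + p ^ 4)

/-- The polynomial factor of the telescoping certificate, in the coordinates of `polyHat`. -/
def certHat (m p A K : ℂ) : ℂ :=
  -16 * (A ^ 2 - 4 * K) + 16 * (m + p) * A + 32 * (m * p + 2 * p ^ 2) * A
    - 8 * (m + p) + 16 * (m ^ 2 + 2 * m * p + p ^ 2)
    - 8 * (m ^ 3 + m ^ 2 * p - 3 * m * p ^ 2 - 3 * p ^ 3)
    - 16 * (m ^ 3 * p + 5 * m ^ 2 * p ^ 2 + 9 * m * p ^ 3 + 6 * p ^ 4)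

/-- In these coordinates `a ↦ a - 1` is `p ↦ p + 2`, and `n ↦ n + 1` moves `m` and `p` by 1. The
parameters `b, c` enter only through `b² + c²` and `(b² - c²)²`, and `A² - 4K = b²c²`. -/
lemma P_eq_polyHat (a b c n : ℂ) :
    P a b c n = polyHat (n + 1 / 2) (n + 1 / 2 - 2 * a + b + c) ((b ^ 2 + c ^ 2) / 2)
      (((b ^ 2 - c ^ 2) / 4) ^ 2) := by
  rw [P, polyHat]; ring

/-- This is the telescoping relation with all denominators cleared; the whole recurrence in `a`
rests on this one polynomial identity. -/
lemma polyHat_identity (m p A K : ℂ) :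
    polyHat m p A K * ((m + p + 1) ^ 4 - 4 * A * (m + p + 1) ^ 2 + 16 * K) * (p + 1 / 2)
        * (p + 3 / 2) * (m + p + 1) * (m + p + 2)
      - (p ^ 4 - 2 * A * p ^ 2 + A ^ 2 - 4 * K)
        * ((p + 1) ^ 4 - 2 * A * (p + 1) ^ 2 + A ^ 2 - 4 * K) * polyHat m (p + 2) A K
      = (m ^ 4 - 2 * A * m ^ 2 + A ^ 2 - 4 * K) * (p ^ 4 - 2 * A * p ^ 2 + A ^ 2 - 4 * K)
        * certHat (m + 1) (p + 1) A K
      - (m - 1 / 2) * ((m + p + 1) ^ 4 - 4 * A * (m + p + 1) ^ 2 + 16 * K)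
        * (p + 3 / 2) * (m + p + 1) * (m + p + 2) * certHat m p A K := by
  rw [polyHat, polyHat, certHat, certHat]; ring

/-- The polynomial factor of the telescoping certificate. -/
def cert (a b c n : ℂ) : ℂ :=
  certHat (n + 1 / 2) (n + 1 / 2 - 2 * a + b + c) ((b ^ 2 + c ^ 2) / 2)
    (((b ^ 2 - c ^ 2) / 4) ^ 2)

/-- The telescoping certificate. -/
def certTerm (a b c : ℂ) (n : ℕ) : ℂ :=
  core a b c n * (n * cert a b c n
    / ((-2 * a + b + c + 1 + n) * (-2 * a + b + c + 1 + 2 * n)))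

/-- The quotient of the sums at `a` and at `a - 1`. -/
def shiftFactor (a b c : ℂ) : ℂ :=
  ((-2 * a + b + 1 / 2) * (-2 * a + b + 1 / 2 + 1)
      * ((-2 * a + c + 1 / 2) * (-2 * a + c + 1 / 2 + 1))
      * ((-2 * a + 2 * b + c + 1 / 2) * (-2 * a + 2 * b + c + 1 / 2 + 1))
      * ((-2 * a + b + 2 * c + 1 / 2) * (-2 * a + b + 2 * c + 1 / 2 + 1)))
    / (16 * ((1 - a) * (-a + b + 1) * (-a + c + 1) * (-a + b + c + 1)
      * ((-2 * a + b + c + 1) * (-2 * a + b + c + 1 + 1)) ^ 2))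

/-- The left side is `(m² - b²)(m² - c²)` with `m = n + 1/2`. -/
lemma numerator_m (b c n : ℂ) :
    (1 / 2 - b + n) * (b + 1 / 2 + n) * (1 / 2 - c + n) * (c + 1 / 2 + n)
      = (n + 1 / 2) ^ 4 - 2 * ((b ^ 2 + c ^ 2) / 2) * (n + 1 / 2) ^ 2
        + ((b ^ 2 + c ^ 2) / 2) ^ 2 - 4 * ((b ^ 2 - c ^ 2) / 4) ^ 2 := by
  ring

/-- The four factors are `p - c`, `p - b`, `p + b`, `p + c`, so the product is `(p² - b²)(p² - c²)`.
-/
lemma numerator_p (a b c n : ℂ) :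
    (-2 * a + b + 1 / 2 + n) * (-2 * a + c + 1 / 2 + n)
      * (-2 * a + 2 * b + c + 1 / 2 + n) * (-2 * a + b + 2 * c + 1 / 2 + n)
      = (n + 1 / 2 - 2 * a + b + c) ^ 4
        - 2 * ((b ^ 2 + c ^ 2) / 2) * (n + 1 / 2 - 2 * a + b + c) ^ 2
        + ((b ^ 2 + c ^ 2) / 2) ^ 2 - 4 * ((b ^ 2 - c ^ 2) / 4) ^ 2 := by
  ring

/-- With `s = m + p + 1`, the factors are the halves of `s ± b ± c`, and the product over the signs
is `(s² - (b + c)²)(s² - (b - c)²)`. -/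
lemma denominator_eq (a b c n : ℂ) :
    16 * ((1 - a + n) * (-a + b + 1 + n) * (-a + c + 1 + n) * (-a + b + c + 1 + n))
      = (n + 1 / 2 + (n + 1 / 2 - 2 * a + b + c) + 1) ^ 4
        - 4 * ((b ^ 2 + c ^ 2) / 2) * (n + 1 / 2 + (n + 1 / 2 - 2 * a + b + c) + 1) ^ 2
        + 16 * ((b ^ 2 - c ^ 2) / 4) ^ 2 := by
  ring

/-- The step from the polynomial identity to fractions, with every linear factor replaced by an
independent symbol. `Nm`, `Np` stand for the two quartic numerators, `D` for the quartic
denominator, `p, p'` for the shifts of `p` by 1/2 and 3/2, and `s, s', s''` for `m + p`, `m + p +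
1`, `m + p + 2`. -/
lemma telescoping_fraction {P₁ P₂ V₁ V₂ D Nm Np Np' n n' p p' s s' s'' : ℂ} (hD : D ≠ 0)
    (hn : n' ≠ 0) (hp : p ≠ 0) (hp' : p' ≠ 0) (hs : s ≠ 0) (hs' : s' ≠ 0) (hs'' : s'' ≠ 0)
    (key : P₁ * D * p * p' * s' * s'' - Np * Np' * P₂
      = Nm * Np * V₁ - n * D * p' * s' * s'' * V₂) :
    P₁ / s - Np * Np' / (D * (p * p' * s * s')) * (P₂ / s'')
      = Nm * Np / (n' * D * (p * (s * s'))) * (n' * V₁ / (p' * s'')) - n * V₂ / (p * s) := by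
  field_simp
  linear_combination key

lemma product_rearrangement_numerator {y₁ y₂ y₃ y₄ x₁ x₂ x₃ x₄ r₁ r₂ r₃ r₄ q₁ q₂ q₃ q₄
    u₁ u₂ u₃ u₄ v₁ v₂ v₃ v₄ b₁ b₂ b₃ b₄ : ℂ}
    (h₁ : x₁ * y₁ * r₁ = q₁ * (u₁ * v₁)) (h₂ : x₂ * y₂ * r₂ = q₂ * (u₂ * v₂))
    (h₃ : x₃ * y₃ * r₃ = q₃ * (u₃ * v₃)) (h₄ : x₄ * y₄ * r₄ = q₄ * (u₄ * v₄)) :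
    x₁ * y₁ * (x₂ * y₂) * (x₃ * y₃) * (x₄ * y₄) * (b₁ * b₂ * b₃ * b₄ * r₁ * r₂ * r₃ * r₄)
      = b₁ * b₂ * b₃ * b₄ * q₁ * q₂ * q₃ * q₄ * (u₁ * u₂ * u₃ * u₄ * (v₁ * v₂ * v₃ * v₄)) := by
  calc _ = b₁ * b₂ * b₃ * b₄ * ((x₁ * y₁ * r₁) * (x₂ * y₂ * r₂) * (x₃ * y₃ * r₃)
        * (x₄ * y₄ * r₄)) := by ring
    _ = _ := by rw [h₁, h₂, h₃, h₄]; ring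

lemma product_rearrangement_denominator {t r x₁ x₂ x₃ x₄ r₁ r₂ r₃ r₄ q₁ q₂ q₃ q₄ u₁ u₂ u₃ u₄
    e e' g g' f f' k k' l l' : ℂ} (h₁ : x₁ * r₁ = q₁ * u₁) (h₂ : x₂ * r₂ = q₂ * u₂)
    (h₃ : x₃ * r₃ = q₃ * u₃) (h₄ : x₄ * r₄ = q₄ * u₄)
    (h₅ : e * e' * g = f * (k * k')) (h₆ : e * e' * g' = f' * (l * l')) :
    16 * (x₁ * x₂ * x₃ * x₄ * (e * e') ^ 2) * (t * (r * r₁ * r₂ * r₃ * g * g' * r₄))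
      = t * (r * q₁ * q₂ * q₃ * f * f' * q₄)
        * (16 * (u₁ * u₂ * u₃ * u₄) * (k * k' * l * l')) := by
  calc _ = 16 * t * r * ((x₁ * r₁) * (x₂ * r₂) * (x₃ * r₃) * (x₄ * r₄) * (e * e' * g)
        * (e * e' * g')) := by ring
    _ = _ := by rw [h₁, h₂, h₃, h₄, h₅, h₆]; ring

/-- The telescoping relation with the common factor `core a b c n` removed, so that only rational
functions of `n` remain. -/
lemma telescoping_ratio {a b c : ℂ} (h : Admissible a b c) (n : ℕ) :
    P a b c n / (-2 * a + b + c + 2 * n + 1)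
      - ((-2 * a + b + 1 / 2 + n) * (-2 * a + c + 1 / 2 + n)
          * (-2 * a + 2 * b + c + 1 / 2 + n) * (-2 * a + b + 2 * c + 1 / 2 + n)
          * ((-2 * a + b + 1 / 2 + (n + 1)) * (-2 * a + c + 1 / 2 + (n + 1))
          * (-2 * a + 2 * b + c + 1 / 2 + (n + 1)) * (-2 * a + b + 2 * c + 1 / 2 + (n + 1))))
          / (16 * ((1 - a + n) * (-a + b + 1 + n) * (-a + c + 1 + n) * (-a + b + c + 1 + n))
            * ((-2 * a + b + c + 1 + n) * (-2 * a + b + c + 1 + n + 1)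
              * (-2 * a + b + c + 1 + 2 * n) * (-2 * a + b + c + 1 + 2 * n + 1)))
        * (P (a - 1) b c n / (-2 * (a - 1) + b + c + 2 * n + 1))
      = coreRatio a b c n * ((n + 1) * cert a b c (n + 1)
          / ((-2 * a + b + c + 1 + (n + 1)) * (-2 * a + b + c + 1 + 2 * (n + 1))))
        - n * cert a b c n
          / ((-2 * a + b + c + 1 + n) * (-2 * a + b + c + 1 + 2 * n)) := by
  have key := polyHat_identity (n + 1 / 2) (n + 1 / 2 - 2 * a + b + c) ((b ^ 2 + c ^ 2) / 2)
    (((b ^ 2 - c ^ 2) / 4) ^ 2)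
  have e1 := numerator_m b c n
  have e2 := numerator_p a b c n
  have e2' := numerator_p a b c (n + 1)
  have e3 := denominator_eq a b c n
  rw [show (n + 1 + 1 / 2 - 2 * a + b + c : ℂ) = n + 1 / 2 - 2 * a + b + c + 1 by ring] at e2'
  have e4 : (1 / 2 - b + n) * (b + 1 / 2 + n) * (1 / 2 - c + n) * (c + 1 / 2 + n)
      * (-2 * a + b + 1 / 2 + n) * (-2 * a + c + 1 / 2 + n)
      * (-2 * a + 2 * b + c + 1 / 2 + n) * (-2 * a + b + 2 * c + 1 / 2 + n)
      = ((1 / 2 - b + n) * (b + 1 / 2 + n) * (1 / 2 - c + n) * (c + 1 / 2 + n))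
      * ((-2 * a + b + 1 / 2 + n) * (-2 * a + c + 1 / 2 + n)
      * (-2 * a + 2 * b + c + 1 / 2 + n) * (-2 * a + b + 2 * c + 1 / 2 + n)) := by
    simp only [mul_assoc]
  have e5 : 16 * ((1 + n) * (1 - a + n) * (-a + b + 1 + n) * (-a + c + 1 + n)
      * (-2 * a + b + c + 1 + n)
      * ((-2 * a + b + c + 1 + 2 * n) * (-2 * a + b + c + 1 + (2 * n + 1)))
      * (-a + b + c + 1 + n))
      = (1 + n) * (16 * ((1 - a + n) * (-a + b + 1 + n) * (-a + c + 1 + n)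
        * (-a + b + c + 1 + n))) * ((-2 * a + b + c + 1 + n) * ((-2 * a + b + c + 1 + 2 * n)
        * (-2 * a + b + c + 1 + (2 * n + 1)))) := by
    generalize (1 + n : ℂ) = t₁, (1 - a + n : ℂ) = t₂, (-a + b + 1 + n : ℂ) = t₃,
      (-a + c + 1 + n : ℂ) = t₄, (-2 * a + b + c + 1 + n : ℂ) = t₅,
      (-2 * a + b + c + 1 + 2 * n : ℂ) = t₆, (-2 * a + b + c + 1 + (2 * n + 1) : ℂ) = t₇,
      (-a + b + c + 1 + n : ℂ) = t₈
    ring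
  have hD : 16 * ((1 - a + n) * (-a + b + 1 + n) * (-a + c + 1 + n) * (-a + b + c + 1 + n)) ≠ 0 :=
    mul_ne_zero (by norm_num) (mul_ne_zero (mul_ne_zero (mul_ne_zero (h.sub_ne n) (h.sub_b_ne n))
      (h.sub_c_ne n)) (h.sub_bc_ne n))
  have hn : (1 + n : ℂ) ≠ 0 := by rw [add_comm]; exact Nat.cast_add_one_ne_zero n
  have h1 := h.two_sub_ne n
  have h2 := h.two_sub_ne (n + 1)
  have h3 := h.two_sub_ne (2 * n)
  have h4 := h.two_sub_ne (2 * n + 1)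
  have h5 := h.two_sub_ne (2 * n + 2)
  push_cast at h2 h3 h4 h5
  rw [coreRatio, e4, e5, e1, e2, e2', e3]
  rw [e3] at hD
  rw [P_eq_polyHat, P_eq_polyHat, cert, cert,
    show (n + 1 / 2 - 2 * (a - 1) + b + c : ℂ) = n + 1 / 2 - 2 * a + b + c + 2 by ring,
    show (n + 1 + 1 / 2 - 2 * a + b + c : ℂ) = n + 1 / 2 - 2 * a + b + c + 1 by ring,
    show (n + 1 + 1 / 2 : ℂ) = n + 1 / 2 + 1 by ring]
  rw [show (-2 * a + b + c + 1 + n : ℂ) = n + 1 / 2 - 2 * a + b + c + 1 / 2 by ring] at h1 ⊢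
  rw [show (-2 * a + b + c + 1 + (n + 1) : ℂ) = n + 1 / 2 - 2 * a + b + c + 3 / 2 by ring]
    at h2 ⊢
  rw [show (-2 * a + b + c + 1 + 2 * n : ℂ) = n + 1 / 2 + (n + 1 / 2 - 2 * a + b + c) by ring]
    at h3 ⊢
  rw [show (-2 * a + b + c + 1 + (2 * n + 1) : ℂ)
    = n + 1 / 2 + (n + 1 / 2 - 2 * a + b + c) + 1 by ring] at h4 ⊢
  rw [show (-2 * a + b + c + 1 + (2 * n + 2) : ℂ)
    = n + 1 / 2 + (n + 1 / 2 - 2 * a + b + c) + 2 by ring] at h5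
  rw [show (-2 * a + b + c + 1 + 2 * (n + 1) : ℂ)
    = n + 1 / 2 + (n + 1 / 2 - 2 * a + b + c) + 2 by ring,
    show (-2 * a + b + c + 2 * n + 1 : ℂ) = n + 1 / 2 + (n + 1 / 2 - 2 * a + b + c) by ring,
    show (-2 * (a - 1) + b + c + 2 * n + 1 : ℂ)
      = n + 1 / 2 + (n + 1 / 2 - 2 * a + b + c) + 2 by ring,
    show (n + 1 / 2 - 2 * a + b + c + 1 / 2 + 1 : ℂ)
      = n + 1 / 2 - 2 * a + b + c + 3 / 2 by ring]
  rw [add_comm 1 (n : ℂ)] at hn ⊢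
  refine telescoping_fraction hD hn h1 h2 h3 h4 h5 ?_
  rw [show (n + 1 / 2 - 1 / 2 : ℂ) = n by ring] at key
  exact key

/-- Replacing `a` by `a - 1` shifts each Pochhammer base by 0, 1 or 2. The constants in
`shiftFactor` are exactly what turns the shifted symbols back into the original ones times factors
depending on `n`. -/
lemma shiftFactor_mul_core (a b c : ℂ) (n : ℕ) :
    shiftFactor a b c * core (a - 1) b c n
      = core a b c n * (((-2 * a + b + 1 / 2 + n) * (-2 * a + c + 1 / 2 + n)
          * (-2 * a + 2 * b + c + 1 / 2 + n) * (-2 * a + b + 2 * c + 1 / 2 + n)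
          * ((-2 * a + b + 1 / 2 + (n + 1)) * (-2 * a + c + 1 / 2 + (n + 1))
          * (-2 * a + 2 * b + c + 1 / 2 + (n + 1)) * (-2 * a + b + 2 * c + 1 / 2 + (n + 1))))
          / (16 * ((1 - a + n) * (-a + b + 1 + n) * (-a + c + 1 + n) * (-a + b + c + 1 + n))
            * ((-2 * a + b + c + 1 + n) * (-2 * a + b + c + 1 + n + 1)
              * (-2 * a + b + c + 1 + 2 * n) * (-2 * a + b + c + 1 + 2 * n + 1)))) := by
  have x₁ := mul_mul_rising_add_two (-2 * a + b + 1 / 2) n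
  have x₂ := mul_mul_rising_add_two (-2 * a + c + 1 / 2) n
  have x₃ := mul_mul_rising_add_two (-2 * a + 2 * b + c + 1 / 2) n
  have x₄ := mul_mul_rising_add_two (-2 * a + b + 2 * c + 1 / 2) n
  have d₁ := mul_rising_add_one (1 - a) n
  have d₂ := mul_rising_add_one (-a + b + 1) n
  have d₃ := mul_rising_add_one (-a + c + 1) n
  have d₄ := mul_rising_add_one (-a + b + c + 1) n
  have e₁ := mul_mul_rising_add_two (-2 * a + b + c + 1) n
  have e₂ := mul_mul_rising_add_two (-2 * a + b + c + 1) (2 * n)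
  push_cast at e₂
  rw [shiftFactor, core, core, div_mul_div_comm, div_mul_div_comm,
    show -2 * (a - 1) + b + 1 / 2 = -2 * a + b + 1 / 2 + 2 by ring,
    show -2 * (a - 1) + c + 1 / 2 = -2 * a + c + 1 / 2 + 2 by ring,
    show -2 * (a - 1) + 2 * b + c + 1 / 2 = -2 * a + 2 * b + c + 1 / 2 + 2 by ring,
    show -2 * (a - 1) + b + 2 * c + 1 / 2 = -2 * a + b + 2 * c + 1 / 2 + 2 by ring,
    show 1 - (a - 1) = 1 - a + 1 by ring, show -(a - 1) + b + 1 = -a + b + 1 + 1 by ring,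
    show -(a - 1) + c + 1 = -a + c + 1 + 1 by ring,
    show -(a - 1) + b + c + 1 = -a + b + c + 1 + 1 by ring,
    show -2 * (a - 1) + b + c + 1 = -2 * a + b + c + 1 + 2 by ring]
  simp only [← add_assoc]
  refine congr_arg₂ (· / ·) (product_rearrangement_numerator x₁ x₂ x₃ x₄) ?_
  exact product_rearrangement_denominator d₁ d₂ d₃ d₄ e₁ e₂

/-- Passing from `a` to `a - 1` changes the summand by a difference. -/
lemma S_sub_shiftFactor_mul {a b c : ℂ} (h : Admissible a b c) (n : ℕ) :
    S a b c n - shiftFactor a b c * S (a - 1) b c n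
      = certTerm a b c (n + 1) - certTerm a b c n := by
  rw [S_eq_core, S_eq_core, ← mul_assoc, shiftFactor_mul_core, certTerm, certTerm, core_succ,
    mul_assoc (core a b c n), mul_assoc (core a b c n), ← mul_sub, ← mul_sub]
  push_cast
  rw [telescoping_ratio h]

/-! ### Bounds -/

/-- Give `m, p` weight 1, `A` weight 2, `K` weight 4: both polynomials have weighted degree 4.
Homogenised by a fifth variable `1 / T`, they become `T ^ 4` times a continuous function evaluated
on the closed unit ball, which is compact. -/
lemma exists_norm_polyHat_le : ∃ C : ℝ, 0 ≤ C ∧ ∀ (m p A K : ℂ) (T : ℝ), 1 ≤ T → ‖m‖ ≤ T →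
    ‖p‖ ≤ T → ‖A‖ ≤ T ^ 2 → ‖K‖ ≤ T ^ 4 →
    ‖polyHat m p A K‖ ≤ C * T ^ 4 ∧ ‖certHat m p A K‖ ≤ C * T ^ 4 := by
  let G : ℂ × ℂ × ℂ × ℂ × ℂ → ℂ := fun x =>
    16 * (x.2.2.1 ^ 2 - 4 * x.2.2.2.1) + 16 * (x.1 + x.2.1) * x.2.2.1 * x.2.2.2.2
    - 32 * (x.1 ^ 2 + x.1 * x.2.1 + x.2.1 ^ 2) * x.2.2.1
    - 8 * (x.1 + x.2.1) * x.2.2.2.2 ^ 3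
    + 32 * (x.1 ^ 2 + 2 * x.1 * x.2.1 + x.2.1 ^ 2) * x.2.2.2.2 ^ 2
    - 8 * (5 * x.1 ^ 3 + 17 * x.1 ^ 2 * x.2.1 + 17 * x.1 * x.2.1 ^ 2 + 5 * x.2.1 ^ 3) * x.2.2.2.2
    + 16 * (x.1 ^ 4 + 5 * x.1 ^ 3 * x.2.1 + 9 * x.1 ^ 2 * x.2.1 ^ 2 + 5 * x.1 * x.2.1 ^ 3
      + x.2.1 ^ 4)
  let G' : ℂ × ℂ × ℂ × ℂ × ℂ → ℂ := fun x =>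
    -16 * (x.2.2.1 ^ 2 - 4 * x.2.2.2.1) + 16 * (x.1 + x.2.1) * x.2.2.1 * x.2.2.2.2
    + 32 * (x.1 * x.2.1 + 2 * x.2.1 ^ 2) * x.2.2.1
    - 8 * (x.1 + x.2.1) * x.2.2.2.2 ^ 3
    + 16 * (x.1 ^ 2 + 2 * x.1 * x.2.1 + x.2.1 ^ 2) * x.2.2.2.2 ^ 2
    - 8 * (x.1 ^ 3 + x.1 ^ 2 * x.2.1 - 3 * x.1 * x.2.1 ^ 2 - 3 * x.2.1 ^ 3) * x.2.2.2.2
    - 16 * (x.1 ^ 3 * x.2.1 + 5 * x.1 ^ 2 * x.2.1 ^ 2 + 9 * x.1 * x.2.1 ^ 3 + 6 * x.2.1 ^ 4)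
  have hG : Continuous G := by fun_prop
  have hG' : Continuous G' := by fun_prop
  obtain ⟨C, hC⟩ := (isCompact_closedBall (0 : ℂ × ℂ × ℂ × ℂ × ℂ) 1).exists_bound_of_continuousOn
    hG.continuousOn
  obtain ⟨C', hC'⟩ :=
    (isCompact_closedBall (0 : ℂ × ℂ × ℂ × ℂ × ℂ) 1).exists_bound_of_continuousOn
    hG'.continuousOn
  refine ⟨max 0 (max C C'), le_max_left _ _, fun m p A K T hT hm hp hA hK => ?_⟩
  have hT0 : (0 : ℝ) < T := by linarith
  have hT' : (T : ℂ) ≠ 0 := by exact_mod_cast hT0.ne'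
  have hTn : ‖(T : ℂ)‖ = T := by rw [Complex.norm_real, Real.norm_of_nonneg hT0.le]
  have hx : (m / T, p / T, A / T ^ 2, K / T ^ 4, 1 / (T : ℂ)) ∈
      Metric.closedBall (0 : ℂ × ℂ × ℂ × ℂ × ℂ) 1 := by
    rw [mem_closedBall_zero_iff]
    simp only [Prod.norm_mk, norm_div, norm_pow, hTn, norm_one, sup_le_iff]
    refine ⟨?_, ?_, ?_, ?_, ?_⟩ <;> rw [div_le_one (by positivity)] <;> assumption
  have h1 : polyHat m p A K
      = T ^ 4 * G (m / T, p / T, A / T ^ 2, K / T ^ 4, 1 / (T : ℂ)) := by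
    simp only [G, polyHat]; field_simp
  have h2 : certHat m p A K
      = T ^ 4 * G' (m / T, p / T, A / T ^ 2, K / T ^ 4, 1 / (T : ℂ)) := by
    simp only [G', certHat]; field_simp
  rw [h1, h2, norm_mul, norm_mul, norm_pow, hTn, mul_comm, mul_comm (T ^ 4)]
  exact ⟨mul_le_mul_of_nonneg_right ((hC _ hx).trans (by simp)) (by positivity),
    mul_le_mul_of_nonneg_right ((hC' _ hx).trans (by simp)) (by positivity)⟩

/-- The polynomials `P` and `cert` have degree at most four. -/
lemma exists_norm_P_le : ∃ C : ℝ, 0 ≤ C ∧ ∀ (a b c n : ℂ) (T : ℝ), 1 ≤ T → ‖a‖ ≤ T → ‖b‖ ≤ T →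
    ‖c‖ ≤ T → ‖n‖ ≤ T → ‖P a b c n‖ ≤ C * T ^ 4 ∧ ‖cert a b c n‖ ≤ C * T ^ 4 := by
  obtain ⟨C, hC0, hC⟩ := exists_norm_polyHat_le
  -- The 6 counts `n`, `1 / 2`, twice `a`, `b` and `c` in the coordinate `p`, each at most `T`.
  refine ⟨C * 6 ^ 4, by positivity, fun a b c n T hT ha hb hc hn => ?_⟩
  have hb2 : ‖b ^ 2‖ ≤ T ^ 2 := by rw [norm_pow]; gcongr
  have hc2 : ‖c ^ 2‖ ≤ T ^ 2 := by rw [norm_pow]; gcongr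
  have h2 : ‖(1 / 2 : ℂ)‖ ≤ T := by norm_num; linarith
  have hm : ‖n + 1 / 2‖ ≤ 2 * T := (norm_add_le _ _).trans (by linarith)
  have hp : ‖n + 1 / 2 - 2 * a + b + c‖ ≤ 6 * T := by
    have : ‖2 * a‖ ≤ 2 * T := by rw [norm_mul, Complex.norm_two]; linarith
    have h1 := norm_add_le (n + 1 / 2 - 2 * a + b) c
    have h2 := norm_add_le (n + 1 / 2 - 2 * a) b
    have h3 := norm_sub_le (n + 1 / 2) (2 * a)
    linarith
  have hA : ‖(b ^ 2 + c ^ 2) / 2‖ ≤ T ^ 2 := by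
    rw [norm_div, Complex.norm_two]
    have := norm_add_le (b ^ 2) (c ^ 2)
    linarith
  have hK : ‖((b ^ 2 - c ^ 2) / 4) ^ 2‖ ≤ (T ^ 2) ^ 2 := by
    rw [norm_pow, norm_div, RCLike.norm_ofNat]
    have := norm_sub_le (b ^ 2) (c ^ 2)
    have h0 := norm_nonneg (b ^ 2 - c ^ 2)
    gcongr
    linarith
  have hT2 : T ^ 2 ≤ (6 * T) ^ 2 := by gcongr; linarith
  have := hC _ _ _ _ (6 * T) (by linarith) (hm.trans (by linarith)) hp (hA.trans hT2)
    (hK.trans ((by gcongr : (T ^ 2) ^ 2 ≤ ((6 * T) ^ 2) ^ 2).trans (by ring_nf; rfl)))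
  rw [P_eq_polyHat, cert]
  refine ⟨this.1.trans (le_of_eq (by ring)), this.2.trans (le_of_eq (by ring))⟩

/-- Uniformity in both `n` and `k` is the difficulty, since `n` may stay small while `k` grows. One
factor of `(n + B) ^ 4` is traded against `n + 1`, and each of the other three is paired with one
`2k + n + B`: the product `(n + C)(2k + n + C)` equals `(k + n + C)² - k²`. -/
lemma quotient_bound_aux {n k B : ℝ} (hn : 0 ≤ n) (hk : 0 ≤ k) (hB : 1 ≤ B)
    (h : 10 * B ^ 2 ≤ k + n) :
    (n + B) ^ 4 * (2 * k + n + B) ^ 4 ≤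
      1 / 2 * (16 * ((n + 1) * (k + n - B) ^ 4 * (2 * k + n - B) * (2 * k + 2 * n - B) ^ 2)) := by
  set C := 2 * B ^ 2 with hC
  set y := k + n with hy
  have hBC : B ≤ C := by nlinarith
  have hy5 : 5 * C ≤ y := by linarith
  have h1 : (n + B) ^ 4 ≤ (n + 1) * (n + C) ^ 3 := by
    have e1 : 4 * B ≤ 3 * C + 1 := by nlinarith
    have e2 : 6 * B ^ 2 ≤ 3 * C ^ 2 + 3 * C := by nlinarith
    have e3 : 4 * B ^ 3 ≤ C ^ 3 + 3 * C ^ 2 := by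
      have : B ^ 3 ≤ B ^ 4 := pow_le_pow_right₀ hB (by norm_num)
      have : C ^ 2 = 4 * B ^ 4 := by rw [hC]; ring
      have : 0 ≤ C ^ 3 := by positivity
      linarith
    have e4 : B ^ 4 ≤ C ^ 3 := by
      have : B ^ 4 ≤ B ^ 6 := pow_le_pow_right₀ hB (by norm_num)
      have : C ^ 3 = 8 * B ^ 6 := by rw [hC]; ring
      have : 0 ≤ B ^ 6 := by positivity
      linarith
    have f1 := mul_le_mul_of_nonneg_right e1 (pow_nonneg hn 3)
    have f2 := mul_le_mul_of_nonneg_right e2 (pow_nonneg hn 2)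
    have f3 := mul_le_mul_of_nonneg_right e3 hn
    linarith [show (n + 1) * (n + C) ^ 3 = n ^ 4 + (3 * C + 1) * n ^ 3 + (3 * C ^ 2 + 3 * C) * n ^ 2
      + (C ^ 3 + 3 * C ^ 2) * n + C ^ 3 by ring, show (n + B) ^ 4 = n ^ 4 + 4 * B * n ^ 3
      + 6 * B ^ 2 * n ^ 2 + 4 * B ^ 3 * n + B ^ 4 by ring]
  have h2 : (n + C) * (2 * k + n + B) ≤ (y + C) ^ 2 := by
    have : (n + C) * (2 * k + n + B) ≤ (n + C) * (2 * k + n + C) := by gcongr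
    nlinarith [sq_nonneg k]
  have h3 : y + C ≤ 3 / 2 * (y - C) := by linarith
  have h4 : 2 * k + n + B ≤ 3 / 2 * (2 * k + n - B) := by linarith
  have hyC : 0 ≤ y - C := by linarith
  have hkn : 0 ≤ 2 * k + n - B := by linarith
  have hC0 : 0 ≤ C := by positivity
  calc (n + B) ^ 4 * (2 * k + n + B) ^ 4
      ≤ ((n + 1) * (n + C) ^ 3) * (2 * k + n + B) ^ 4 := by gcongr
    _ = (n + 1) * ((n + C) * (2 * k + n + B)) ^ 3 * (2 * k + n + B) := by ring
    _ ≤ (n + 1) * ((y + C) ^ 2) ^ 3 * (3 / 2 * (2 * k + n - B)) := by gcongr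
    _ ≤ (n + 1) * ((3 / 2 * (y - C)) ^ 2) ^ 3 * (3 / 2 * (2 * k + n - B)) := by gcongr
    -- The constant 32 is 16 · 4 / 2, and `(3 / 2) ^ 7` is about 17, so there is room to spare.
    _ = (3 / 2) ^ 7 / 32 * (1 / 2 * (16 * ((n + 1) * (y - C) ^ 4 * (2 * k + n - B)
        * (2 * (y - C)) ^ 2))) := by ring
    _ ≤ 1 * (1 / 2 * (16 * ((n + 1) * (y - C) ^ 4 * (2 * k + n - B) * (2 * (y - C)) ^ 2))) := by
        gcongr; norm_num
    _ ≤ 1 / 2 * (16 * ((n + 1) * (y - B) ^ 4 * (2 * k + n - B) * (2 * k + 2 * n - B) ^ 2)) := by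
        rw [one_mul]; gcongr; linarith

lemma norm_add_real_le {w z : ℂ} {r B : ℝ} (hr : 0 ≤ r) (hw : ‖w‖ ≤ B) (hz : z = w + r) :
    ‖z‖ ≤ r + B := by
  rw [hz]
  refine (norm_add_le _ _).trans ?_
  rw [Complex.norm_real, Real.norm_of_nonneg hr]
  linarith

lemma le_norm_add_real {w z : ℂ} {r B : ℝ} (hr : 0 ≤ r) (hw : ‖w‖ ≤ B) (hz : z = w + r) :
    r - B ≤ ‖z‖ := by
  have h := norm_sub_le (w + r) w
  rw [add_sub_cancel_left, Complex.norm_real, Real.norm_of_nonneg hr] at h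
  rw [hz]
  linarith

/-- Every linear form in `a, b, c` occurring in the summand has coefficients and constant term of
absolute value at most 2. -/
lemma norm_combination_le (a b c q : ℂ) (r s t : ℝ) (hr : |r| ≤ 2) (hs : |s| ≤ 2) (ht : |t| ≤ 2)
    (hq : ‖q‖ ≤ 2) : ‖(r : ℂ) * a + (s : ℂ) * b + (t : ℂ) * c + q‖
      ≤ 4 * (‖a‖ + ‖b‖ + ‖c‖) + 2 := by
  have h1 := norm_add_le ((r : ℂ) * a + (s : ℂ) * b + (t : ℂ) * c) q
  have h2 := norm_add_le ((r : ℂ) * a + (s : ℂ) * b) ((t : ℂ) * c)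
  have h3 := norm_add_le ((r : ℂ) * a) ((s : ℂ) * b)
  rw [norm_mul, norm_mul, Complex.norm_real, Complex.norm_real, Real.norm_eq_abs,
    Real.norm_eq_abs] at h3
  rw [norm_mul (t : ℂ), Complex.norm_real, Real.norm_eq_abs] at h2
  have i1 := mul_le_mul_of_nonneg_right hr (norm_nonneg a)
  have i2 := mul_le_mul_of_nonneg_right hs (norm_nonneg b)
  have i3 := mul_le_mul_of_nonneg_right ht (norm_nonneg c)
  have := norm_nonneg a
  have := norm_nonneg b
  have := norm_nonneg c
  linarith

lemma div_mul_self_le_of_nonneg {x : ℝ} (hx : 0 ≤ x) (y : ℝ) : x / y * y ≤ x := by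
  rcases eq_or_ne y 0 with rfl | hy
  · simpa using hx
  · rw [div_mul_cancel₀ _ hy]

/-- A radius for the parameters. -/
def radius (a b c : ℂ) : ℝ := 4 * (‖a‖ + ‖b‖ + ‖c‖) + 2

lemma two_le_radius (a b c : ℂ) : 2 ≤ radius a b c := by
  have : 0 ≤ ‖a‖ + ‖b‖ + ‖c‖ := by positivity
  rw [radius]; linarith

lemma norm_coreRatio_mul_le (a b c : ℂ) (k n : ℕ) (h : radius a b c ≤ k + n) :
    ‖coreRatio (a - k) b c n‖ * (16 * (((n : ℝ) + 1) * (k + n - radius a b c) ^ 4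
      * (2 * k + n - radius a b c) * (2 * k + 2 * n - radius a b c) ^ 2))
      ≤ (n + radius a b c) ^ 4 * (2 * k + n + radius a b c) ^ 4 := by
  set B := radius a b c with hB
  have hB2 : 2 ≤ B := two_le_radius a b c
  have hk : (0 : ℝ) ≤ k := by positivity
  have hn : (0 : ℝ) ≤ n := by positivity
  have comb : ∀ r s t : ℝ, ∀ q w : ℂ, |r| ≤ 2 → |s| ≤ 2 → |t| ≤ 2 → ‖q‖ ≤ 2 →
      w = (r : ℂ) * a + (s : ℂ) * b + (t : ℂ) * c + q → ‖w‖ ≤ B := by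
    intro r s t q w hr hs ht hq hw
    rw [hw]; exact norm_combination_le a b c q r s t hr hs ht hq
  have q1 : ‖(1 / 2 : ℂ)‖ ≤ 2 := by norm_num
  have q2 : ‖(1 : ℂ)‖ ≤ 2 := by norm_num
  have q3 : ‖(2 : ℂ)‖ ≤ 2 := by norm_num
  have a1 : ‖1 / 2 - b + n‖ ≤ n + B := norm_add_real_le hn
    (comb 0 (-1) 0 (1 / 2) (1 / 2 - b) (by norm_num) (by norm_num) (by norm_num) q1
      (by push_cast; ring)) (by push_cast; ring)
  have a2 : ‖b + 1 / 2 + n‖ ≤ n + B := norm_add_real_le hn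
    (comb 0 1 0 (1 / 2) (b + 1 / 2) (by norm_num) (by norm_num) (by norm_num) q1
      (by push_cast; ring)) (by push_cast; ring)
  have a3 : ‖1 / 2 - c + n‖ ≤ n + B := norm_add_real_le hn
    (comb 0 0 (-1) (1 / 2) (1 / 2 - c) (by norm_num) (by norm_num) (by norm_num) q1
      (by push_cast; ring)) (by push_cast; ring)
  have a4 : ‖c + 1 / 2 + n‖ ≤ n + B := norm_add_real_le hn
    (comb 0 0 1 (1 / 2) (c + 1 / 2) (by norm_num) (by norm_num) (by norm_num) q1
      (by push_cast; ring)) (by push_cast; ring)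
  have h2kn : (0 : ℝ) ≤ 2 * k + n := by positivity
  have hkn : (0 : ℝ) ≤ k + n := by positivity
  have h2k2n : (0 : ℝ) ≤ 2 * k + 2 * n := by positivity
  have a5 : ‖-2 * (a - k) + b + 1 / 2 + n‖ ≤ 2 * k + n + B := norm_add_real_le h2kn
    (comb (-2) 1 0 (1 / 2) (-2 * a + b + 1 / 2) (by norm_num) (by norm_num) (by norm_num) q1
      (by push_cast; ring)) (by push_cast; ring)
  have a6 : ‖-2 * (a - k) + c + 1 / 2 + n‖ ≤ 2 * k + n + B := norm_add_real_le h2kn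
    (comb (-2) 0 1 (1 / 2) (-2 * a + c + 1 / 2) (by norm_num) (by norm_num) (by norm_num) q1
      (by push_cast; ring)) (by push_cast; ring)
  have a7 : ‖-2 * (a - k) + 2 * b + c + 1 / 2 + n‖ ≤ 2 * k + n + B := norm_add_real_le h2kn
    (comb (-2) 2 1 (1 / 2) (-2 * a + 2 * b + c + 1 / 2) (by norm_num) (by norm_num)
      (by norm_num) q1 (by push_cast; ring)) (by push_cast; ring)
  have a8 : ‖-2 * (a - k) + b + 2 * c + 1 / 2 + n‖ ≤ 2 * k + n + B := norm_add_real_le h2kn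
    (comb (-2) 1 2 (1 / 2) (-2 * a + b + 2 * c + 1 / 2) (by norm_num) (by norm_num)
      (by norm_num) q1 (by push_cast; ring)) (by push_cast; ring)
  have b1 : ‖(1 + n : ℂ)‖ = n + 1 := by
    rw [add_comm]; exact_mod_cast Complex.norm_natCast (n + 1)
  have b2 : k + n - B ≤ ‖1 - (a - k) + n‖ := le_norm_add_real hkn
    (comb (-1) 0 0 1 (1 - a) (by norm_num) (by norm_num) (by norm_num) q2
      (by push_cast; ring)) (by push_cast; ring)
  have b3 : k + n - B ≤ ‖-(a - k) + b + 1 + n‖ := le_norm_add_real hkn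
    (comb (-1) 1 0 1 (-a + b + 1) (by norm_num) (by norm_num) (by norm_num) q2
      (by push_cast; ring)) (by push_cast; ring)
  have b4 : k + n - B ≤ ‖-(a - k) + c + 1 + n‖ := le_norm_add_real hkn
    (comb (-1) 0 1 1 (-a + c + 1) (by norm_num) (by norm_num) (by norm_num) q2
      (by push_cast; ring)) (by push_cast; ring)
  have b5 : 2 * k + n - B ≤ ‖-2 * (a - k) + b + c + 1 + n‖ := le_norm_add_real h2kn
    (comb (-2) 1 1 1 (-2 * a + b + c + 1) (by norm_num) (by norm_num) (by norm_num) q2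
      (by push_cast; ring)) (by push_cast; ring)
  have b6 : 2 * k + 2 * n - B ≤ ‖-2 * (a - k) + b + c + 1 + 2 * n‖ := le_norm_add_real h2k2n
    (comb (-2) 1 1 1 (-2 * a + b + c + 1) (by norm_num) (by norm_num) (by norm_num) q2
      (by push_cast; ring)) (by push_cast; ring)
  have b7 : 2 * k + 2 * n - B ≤ ‖-2 * (a - k) + b + c + 1 + (2 * n + 1)‖ :=
    le_norm_add_real h2k2n (comb (-2) 1 1 2 (-2 * a + b + c + 2) (by norm_num) (by norm_num)
      (by norm_num) q3 (by push_cast; ring)) (by push_cast; ring)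
  have b8 : k + n - B ≤ ‖-(a - k) + b + c + 1 + n‖ := le_norm_add_real hkn
    (comb (-1) 1 1 1 (-a + b + c + 1) (by norm_num) (by norm_num) (by norm_num) q2
      (by push_cast; ring)) (by push_cast; ring)
  have c1 : 0 ≤ k + n - B := by linarith
  have c2 : 0 ≤ 2 * k + n - B := by linarith
  have c3 : 0 ≤ 2 * k + 2 * n - B := by linarith
  have hcore : ‖coreRatio (a - k) b c n‖ * (16 * (((n : ℝ) + 1) * ‖1 - (a - k) + n‖
      * ‖-(a - k) + b + 1 + n‖ * ‖-(a - k) + c + 1 + n‖ * ‖-2 * (a - k) + b + c + 1 + n‖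
      * (‖-2 * (a - k) + b + c + 1 + 2 * n‖ * ‖-2 * (a - k) + b + c + 1 + (2 * n + 1)‖)
      * ‖-(a - k) + b + c + 1 + n‖))
      ≤ ‖1 / 2 - b + n‖ * ‖b + 1 / 2 + n‖ * ‖1 / 2 - c + n‖ * ‖c + 1 / 2 + n‖
      * ‖-2 * (a - k) + b + 1 / 2 + n‖ * ‖-2 * (a - k) + c + 1 / 2 + n‖
      * ‖-2 * (a - k) + 2 * b + c + 1 / 2 + n‖ * ‖-2 * (a - k) + b + 2 * c + 1 / 2 + n‖ := by
    rw [coreRatio, norm_div]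
    simp only [norm_mul, b1, RCLike.norm_ofNat]
    exact div_mul_self_le_of_nonneg (by positivity) _
  calc _ = ‖coreRatio (a - k) b c n‖ * (16 * (((n : ℝ) + 1) * (k + n - B) * (k + n - B)
        * (k + n - B) * (2 * k + n - B) * ((2 * k + 2 * n - B) * (2 * k + 2 * n - B))
        * (k + n - B))) := by ring
    _ ≤ _ := by gcongr
    _ ≤ _ := hcore
    _ ≤ (n + B) * (n + B) * (n + B) * (n + B) * (2 * k + n + B) * (2 * k + n + B)
        * (2 * k + n + B) * (2 * k + n + B) := by gcongr
    _ = _ := by ring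

lemma norm_coreRatio_le_half (a b c : ℂ) (k n : ℕ) (h : 10 * radius a b c ^ 2 ≤ k + n) :
    ‖coreRatio (a - k) b c n‖ ≤ 1 / 2 := by
  have hB2 := two_le_radius a b c
  have hB : radius a b c < k + n := by nlinarith
  have h1 := norm_coreRatio_mul_le a b c k n hB.le
  have h2 := quotient_bound_aux (Nat.cast_nonneg n) (Nat.cast_nonneg k)
    (by linarith : 1 ≤ radius a b c) h
  refine le_of_mul_le_mul_right (h1.trans h2) ?_
  have hk : (0 : ℝ) ≤ k := by positivity
  have hn : (0 : ℝ) ≤ n := by positivity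
  have c1 : 0 < k + n - radius a b c := by linarith
  have c2 : 0 < 2 * k + n - radius a b c := by linarith
  have c3 : 0 < 2 * k + 2 * n - radius a b c := by linarith
  positivity

/-- At `n = 0` four numerator factors do not grow with `k`, while seven growing factors remain in
the denominator against four in the numerator. A decay of order `1 / k` is enough, so two powers of
`k - B` are given away. -/
lemma norm_coreRatio_zero_le (a b c : ℂ) (k : ℕ) (h : 10 * radius a b c ^ 2 ≤ k) :
    ‖coreRatio (a - k) b c 0‖ ≤ radius a b c ^ 4 / (k - radius a b c) := by
  have hB2 := two_le_radius a b c
  set B := radius a b c with hB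
  have h20 : 20 * B ≤ k := by nlinarith
  have h1 := norm_coreRatio_mul_le a b c k 0 (by push_cast; linarith)
  simp only [Nat.cast_zero, add_zero, zero_add, mul_zero, one_mul, ← hB] at h1
  have c1 : 1 ≤ k - B := by linarith
  have c2 : 0 < 2 * k - B := by linarith
  rw [le_div_iff₀ (by linarith)]
  refine le_of_mul_le_mul_right (a := 16 * ((k - B) ^ 3 * (2 * k - B) ^ 3)) ?_ (by positivity)
  calc ‖coreRatio (a - k) b c 0‖ * (k - B) * (16 * ((k - B) ^ 3 * (2 * k - B) ^ 3))
      = ‖coreRatio (a - k) b c 0‖ * (16 * ((k - B) ^ 4 * (2 * k - B) * (2 * k - B) ^ 2)) := by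
        ring
    _ ≤ B ^ 4 * (2 * k + B) ^ 4 := h1
    _ ≤ B ^ 4 * (9 / 8 * (2 * k - B)) ^ 4 := by gcongr; linarith
    _ = B ^ 4 * ((9 / 8) ^ 4 * (2 * k - B) * (2 * k - B) ^ 3) := by ring
    _ ≤ B ^ 4 * ((9 / 8) ^ 4 * (3 * (k - B) ^ 3) * (2 * k - B) ^ 3) := by
        have : (k - B : ℝ) ≤ (k - B) ^ 3 := le_self_pow₀ c1 (by norm_num)
        gcongr
        linarith
    _ ≤ B ^ 4 * (16 * ((k - B) ^ 3 * (2 * k - B) ^ 3)) := by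
        rw [show (9 / 8 : ℝ) ^ 4 * (3 * (k - B) ^ 3) * (2 * k - B) ^ 3
          = (9 / 8) ^ 4 * 3 * ((k - B) ^ 3 * (2 * k - B) ^ 3) by ring]
        gcongr
        norm_num

lemma tendsto_coreRatio_zero (a b c : ℂ) :
    Tendsto (fun k : ℕ => coreRatio (a - k) b c 0) atTop (𝓝 0) := by
  have h1 : Tendsto (fun k : ℕ => radius a b c ^ 4 / (k - radius a b c)) atTop (𝓝 0) :=
    Tendsto.const_div_atTop
      (tendsto_atTop_add_const_right _ _ tendsto_natCast_atTop_atTop) _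
  refine squeeze_zero_norm' ?_ h1
  filter_upwards [tendsto_natCast_atTop_atTop.eventually_ge_atTop (10 * radius a b c ^ 2)]
    with k hk
  exact norm_coreRatio_zero_le a b c k hk

lemma norm_core_le_pow {a b c : ℂ} (h : ∀ n : ℕ, ‖coreRatio a b c n‖ ≤ 1 / 2) (n : ℕ) :
    ‖core a b c n‖ ≤ (1 / 2) ^ n := by
  induction n with
  | zero => simp [core_zero]
  | succ n ih =>
    rw [core_succ, norm_mul, pow_succ]
    exact mul_le_mul ih (h n) (norm_nonneg _) (by positivity)

/-- Keeping the first ratio separate makes every term with positive index vanish in the limit `a → a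
- k`. -/
lemma norm_core_succ_le_pow {a b c : ℂ} (h : ∀ n : ℕ, ‖coreRatio a b c n‖ ≤ 1 / 2) (n : ℕ) :
    ‖core a b c (n + 1)‖ ≤ ‖coreRatio a b c 0‖ * (1 / 2) ^ n := by
  induction n with
  | zero => simp [core_succ, core_zero]
  | succ n ih =>
    rw [core_succ, norm_mul, pow_succ, ← mul_assoc]
    exact mul_le_mul ih (h (n + 1)) (norm_nonneg _) (by positivity)

lemma exists_norm_core_le (a b c : ℂ) :
    ∃ M : ℝ, ∀ n : ℕ, ‖core a b c n‖ ≤ M * (1 / 2) ^ n := by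
  obtain ⟨N, hN⟩ := exists_nat_ge (10 * radius a b c ^ 2)
  -- From the index `N` on the ratios are at most 1/2; the sum absorbs the finitely many earlier
  -- terms.
  refine ⟨∑ i ∈ Finset.range (N + 1), ‖core a b c i‖ * 2 ^ i, fun n => ?_⟩
  rcases le_total n N with hn | hn
  · rw [one_div, inv_pow, ← div_eq_mul_inv, le_div_iff₀ (by positivity)]
    exact Finset.single_le_sum (f := fun i => ‖core a b c i‖ * 2 ^ i)
      (fun i _ => by positivity) (Finset.mem_range.2 (by omega))
  · induction n, hn using Nat.le_induction with
    | base =>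
      rw [one_div, inv_pow, ← div_eq_mul_inv, le_div_iff₀ (by positivity)]
      exact Finset.single_le_sum (f := fun i => ‖core a b c i‖ * 2 ^ i)
        (fun i _ => by positivity) (Finset.mem_range.2 (by omega))
    | succ n hn ih =>
      have h1 : ‖coreRatio (a - (0 : ℕ)) b c n‖ ≤ 1 / 2 := by
        refine norm_coreRatio_le_half a b c 0 n (hN.trans ?_)
        simpa using (Nat.cast_le (α := ℝ)).2 hn
      rw [Nat.cast_zero, sub_zero] at h1
      rw [core_succ, norm_mul, pow_succ, ← mul_assoc]
      refine mul_le_mul ih h1 (norm_nonneg _) ?_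
      exact (norm_nonneg _).trans ih

/-! ### The sum over `n` and the shift of `a` -/

lemma norm_two_sub_le {a b c : ℂ} (k n : ℕ) :
    2 * k + 2 * n - radius a b c ≤ ‖-2 * (a - k) + b + c + 2 * n + 1‖ := by
  refine le_norm_add_real (w := (-2 : ℝ) * a + (1 : ℝ) * b + (1 : ℝ) * c + 1) (by positivity)
    (norm_combination_le a b c 1 (-2) 1 1 (by norm_num) (by norm_num) (by norm_num)
      (by norm_num)) ?_
  push_cast
  ring

lemma summable_pow_mul_half (C : ℝ) (m : ℕ) :
    Summable fun n : ℕ => C * ((n : ℝ) + 1) ^ m * (1 / 2) ^ n := by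
  have h := (summable_nat_add_iff 1).2 (summable_pow_mul_geometric_of_norm_lt_one m
    (r := (1 / 2 : ℝ)) (by norm_num))
  refine (h.mul_left (2 * C)).congr fun n => ?_
  push_cast
  rw [pow_succ]
  ring

/-- The size of the parameters and of the summation index. -/
lemma norm_le_size (a b c : ℂ) (k n : ℕ) (hk : 1 ≤ k) :
    1 ≤ (‖a‖ + ‖b‖ + ‖c‖ + 2) * k * (n + 1) ∧ ‖a - k‖ ≤ (‖a‖ + ‖b‖ + ‖c‖ + 2) * k * (n + 1) ∧
      ‖b‖ ≤ (‖a‖ + ‖b‖ + ‖c‖ + 2) * k * (n + 1) ∧ ‖c‖ ≤ (‖a‖ + ‖b‖ + ‖c‖ + 2) * k * (n + 1) ∧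
      ‖(n : ℂ)‖ ≤ (‖a‖ + ‖b‖ + ‖c‖ + 2) * k * (n + 1) := by
  have hk1 : (1 : ℝ) ≤ k := by exact_mod_cast hk
  have hn : (0 : ℝ) ≤ n := by positivity
  have ha := norm_nonneg a
  have hb := norm_nonneg b
  have hc := norm_nonneg c
  have hkn : (1 : ℝ) ≤ k * (n + 1) := by nlinarith
  have h1 : (k : ℝ) ≤ k * (n + 1) := by nlinarith
  have h2 : (n : ℝ) ≤ k * (n + 1) := by nlinarith
  have h3 := norm_sub_le a k
  rw [Complex.norm_natCast] at h3 ⊢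
  rw [mul_assoc]
  set q : ℝ := k * (n + 1)
  have ha' : ‖a‖ ≤ ‖a‖ * q := le_mul_of_one_le_right ha hkn
  have hb' : ‖b‖ ≤ ‖b‖ * q := le_mul_of_one_le_right hb hkn
  have hc' : ‖c‖ ≤ ‖c‖ * q := le_mul_of_one_le_right hc hkn
  refine ⟨?_, ?_, ?_, ?_, ?_⟩ <;> linarith

/-- The quartic `P` contributes `k ^ 4` and the linear denominator, of size at least `k`, removes
one power. This fixes the normalisation by `k ^ 3` used below. -/
lemma exists_norm_S_le_of_core (a b c : ℂ) : ∃ C : ℝ, 0 ≤ C ∧ ∀ k n : ℕ, 1 ≤ k → radius a b c ≤ k →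
    ‖S (a - k) b c n‖ ≤ ‖core (a - k) b c n‖ * (C * (n + 1) ^ 4 * k ^ 3) := by
  obtain ⟨C, hC0, hC⟩ := exists_norm_P_le
  refine ⟨C * (‖a‖ + ‖b‖ + ‖c‖ + 2) ^ 4, by positivity, fun k n hk hB => ?_⟩
  obtain ⟨h0, h1, h2, h3, h4⟩ := norm_le_size a b c k n hk
  have hP := (hC (a - k) b c n _ h0 h1 h2 h3 h4).1
  have hd := norm_two_sub_le (a := a) (b := b) (c := c) k n
  have hk1 : (0 : ℝ) < k := by exact_mod_cast hk
  have hn : (0 : ℝ) ≤ n := by positivity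
  rw [S_eq_core, norm_mul, norm_div]
  refine mul_le_mul_of_nonneg_left ?_ (norm_nonneg _)
  rw [div_le_iff₀ (by linarith)]
  calc ‖P (a - k) b c n‖ ≤ C * ((‖a‖ + ‖b‖ + ‖c‖ + 2) * k * (n + 1)) ^ 4 := hP
    _ = C * (‖a‖ + ‖b‖ + ‖c‖ + 2) ^ 4 * (n + 1) ^ 4 * k ^ 3 * k := by ring
    _ ≤ _ := by gcongr; linarith

lemma summable_S (a b c : ℂ) : Summable fun n : ℕ => S a b c n := by
  obtain ⟨C, hC0, hC⟩ := exists_norm_P_le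
  obtain ⟨M, hM⟩ := exists_norm_core_le a b c
  have hM0 : 0 ≤ M := by simpa using (norm_nonneg _).trans (hM 0)
  refine .of_norm_bounded_eventually_nat (g := fun n : ℕ => M * (C * (‖a‖ + ‖b‖ + ‖c‖ + 3) ^ 4) *
    ((n : ℝ) + 1) ^ 4 * (1 / 2) ^ n) (summable_pow_mul_half _ 4) ?_
  filter_upwards [tendsto_natCast_atTop_atTop.eventually_ge_atTop (radius a b c + 1)] with n hn
  have h1 : 1 ≤ ‖-2 * a + b + c + 2 * n + 1‖ := by
    have h := norm_two_sub_le (a := a) (b := b) (c := c) 0 n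
    have := two_le_radius a b c
    simp only [Nat.cast_zero, sub_zero] at h
    linarith
  have hn0 : (0 : ℝ) ≤ n := by positivity
  have ha := norm_nonneg a
  have hb := norm_nonneg b
  have hc := norm_nonneg c
  have ht : ‖a‖ + ‖b‖ + ‖c‖ + 3 + n ≤ (‖a‖ + ‖b‖ + ‖c‖ + 3) * (n + 1) := by nlinarith
  have hP := (hC a b c n ((‖a‖ + ‖b‖ + ‖c‖ + 3) * (n + 1)) (by linarith) (by linarith)
    (by linarith) (by linarith) (by rw [Complex.norm_natCast]; linarith)).1
  rw [S_eq_core, norm_mul, norm_div]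
  calc ‖core a b c n‖ * (‖P a b c n‖ / ‖-2 * a + b + c + 2 * n + 1‖)
      ≤ (M * (1 / 2) ^ n) * (‖P a b c n‖ / 1) := by gcongr; exact hM n
    _ ≤ (M * (1 / 2) ^ n) * (C * ((‖a‖ + ‖b‖ + ‖c‖ + 3) * (n + 1)) ^ 4) := by
        rw [div_one]; gcongr
    _ = _ := by ring

lemma tendsto_certTerm (a b c : ℂ) : Tendsto (certTerm a b c) atTop (𝓝 0) := by
  obtain ⟨C, hC0, hC⟩ := exists_norm_P_le
  obtain ⟨M, hM⟩ := exists_norm_core_le a b c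
  have hM0 : 0 ≤ M := by simpa using (norm_nonneg _).trans (hM 0)
  refine squeeze_zero_norm' ?_ ((summable_pow_mul_half
    (M * (C * (‖a‖ + ‖b‖ + ‖c‖ + 3) ^ 4)) 5).tendsto_atTop_zero)
  filter_upwards [tendsto_natCast_atTop_atTop.eventually_ge_atTop (radius a b c + 1)] with n hn
  have hB := two_le_radius a b c
  have h1 : 1 ≤ ‖-2 * a + b + c + 1 + 2 * n‖ := by
    have h := norm_two_sub_le (a := a) (b := b) (c := c) 0 n
    simp only [Nat.cast_zero, sub_zero] at h
    rw [add_right_comm _ 1 _]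
    linarith
  have h2 : 1 ≤ ‖-2 * a + b + c + 1 + n‖ := by
    have h : (n : ℝ) - radius a b c ≤ ‖-2 * a + b + c + 1 + n‖ :=
      le_norm_add_real (w := (-2 : ℝ) * a + (1 : ℝ) * b + (1 : ℝ) * c + 1) (by positivity)
      (norm_combination_le a b c 1 (-2) 1 1 (by norm_num) (by norm_num) (by norm_num)
        (by norm_num)) (by push_cast; ring)
    linarith
  have hn0 : (0 : ℝ) ≤ n := by positivity
  have ha := norm_nonneg a
  have hb := norm_nonneg b
  have hc := norm_nonneg c
  have ht : ‖a‖ + ‖b‖ + ‖c‖ + 3 + n ≤ (‖a‖ + ‖b‖ + ‖c‖ + 3) * (n + 1) := by nlinarith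
  have hP := (hC a b c n ((‖a‖ + ‖b‖ + ‖c‖ + 3) * (n + 1)) (by linarith) (by linarith)
    (by linarith) (by linarith) (by rw [Complex.norm_natCast]; linarith)).2
  rw [certTerm, norm_mul, norm_div, norm_mul, norm_mul, Complex.norm_natCast]
  calc ‖core a b c n‖ * (n * ‖cert a b c n‖
        / (‖-2 * a + b + c + 1 + n‖ * ‖-2 * a + b + c + 1 + 2 * n‖))
      ≤ (M * (1 / 2) ^ n) * ((n + 1) * (C * ((‖a‖ + ‖b‖ + ‖c‖ + 3) * (n + 1)) ^ 4) / (1 * 1)) := by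
        gcongr
        · exact hM n
        · linarith
    _ = _ := by ring

/-- Summing the telescoping relation leaves only boundary terms: the one at 0 vanishes because of
the factor `n` in `certTerm`, the one at infinity by geometric decay. -/
lemma tsum_S_eq_shiftFactor_mul {a b c : ℂ} (h : Admissible a b c) :
    ∑' n, S a b c n = shiftFactor a b c * ∑' n, S (a - 1) b c n := by
  have h1 := ((summable_S a b c).hasSum.sub
    ((summable_S (a - 1) b c).hasSum.mul_left (shiftFactor a b c))).tendsto_sum_nat
  simp only [S_sub_shiftFactor_mul h, Finset.sum_range_sub] at h1
  have h2 := (tendsto_certTerm a b c).sub_const (certTerm a b c 0)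
  rw [show certTerm a b c 0 = 0 by simp [certTerm], sub_zero] at h2
  rw [show certTerm a b c 0 = 0 by simp [certTerm]] at h1
  exact sub_eq_zero.1 (tendsto_nhds_unique h1 h2)

/-- The quotient of the sums at `a` and at `a - k`. -/
def shiftProduct (a b c : ℂ) (k : ℕ) : ℂ :=
  (rising (-2 * a + b + 1 / 2) (2 * k) * rising (-2 * a + c + 1 / 2) (2 * k)
      * rising (-2 * a + 2 * b + c + 1 / 2) (2 * k) * rising (-2 * a + b + 2 * c + 1 / 2) (2 * k))
    / (2 ^ (4 * k) * (rising (1 - a) k * rising (-a + b + 1) k * rising (-a + c + 1) k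
      * rising (-a + b + c + 1) k * rising (-2 * a + b + c + 1) (2 * k) ^ 2))

lemma shiftProduct_succ (a b c : ℂ) (k : ℕ) :
    shiftProduct a b c (k + 1) = shiftProduct a b c k * shiftFactor (a - k) b c := by
  rw [shiftProduct, shiftProduct, shiftFactor, div_mul_div_comm,
    show 2 * (k + 1) = 2 * k + 1 + 1 by ring, show 4 * (k + 1) = 4 * k + 4 by ring, pow_add]
  simp only [rising_succ]
  push_cast
  rw [show -2 * (a - k) + b + 1 / 2 = -2 * a + b + 1 / 2 + 2 * k by ring,
    show -2 * (a - k) + c + 1 / 2 = -2 * a + c + 1 / 2 + 2 * k by ring,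
    show -2 * (a - k) + 2 * b + c + 1 / 2 = -2 * a + 2 * b + c + 1 / 2 + 2 * k by ring,
    show -2 * (a - k) + b + 2 * c + 1 / 2 = -2 * a + b + 2 * c + 1 / 2 + 2 * k by ring,
    show 1 - (a - k) = 1 - a + k by ring, show -(a - k) + b + 1 = -a + b + 1 + k by ring,
    show -(a - k) + c + 1 = -a + c + 1 + k by ring,
    show -(a - k) + b + c + 1 = -a + b + c + 1 + k by ring,
    show -2 * (a - k) + b + c + 1 = -2 * a + b + c + 1 + 2 * k by ring]
  simp only [← add_assoc]
  generalize rising (-2 * a + b + 1 / 2) _ = r₁, rising (-2 * a + c + 1 / 2) _ = r₂,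
    rising (-2 * a + 2 * b + c + 1 / 2) _ = r₃, rising (-2 * a + b + 2 * c + 1 / 2) _ = r₄,
    rising (1 - a) _ = q₁, rising (-a + b + 1) _ = q₂, rising (-a + c + 1) _ = q₃,
    rising (-a + b + c + 1) _ = q₄, rising (-2 * a + b + c + 1) _ = q₅,
    -2 * a + b + 1 / 2 + 2 * (k : ℂ) = x₁, -2 * a + c + 1 / 2 + 2 * (k : ℂ) = x₂,
    -2 * a + 2 * b + c + 1 / 2 + 2 * (k : ℂ) = x₃, -2 * a + b + 2 * c + 1 / 2 + 2 * (k : ℂ) = x₄,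
    1 - a + (k : ℂ) = y₁, -a + b + 1 + (k : ℂ) = y₂, -a + c + 1 + (k : ℂ) = y₃,
    -a + b + c + 1 + (k : ℂ) = y₄, -2 * a + b + c + 1 + 2 * (k : ℂ) = y₅, (2 : ℂ) ^ (4 * k) = t
  congr 1
  · rw [← sub_eq_zero]
    have : ∀ z₁ z₂ z₃ z₄ : ℂ, r₁ * x₁ * z₁ * (r₂ * x₂ * z₂) * (r₃ * x₃ * z₃) * (r₄ * x₄ * z₄)
      = r₁ * r₂ * r₃ * r₄ * (x₁ * z₁ * (x₂ * z₂) * (x₃ * z₃) * (x₄ * z₄)) := by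
      intros; ring
    rw [this, sub_self]
  · have : ∀ z : ℂ, t * 2 ^ 4 * (q₁ * y₁ * (q₂ * y₂) * (q₃ * y₃) * (q₄ * y₄) * (q₅ * y₅ * z) ^ 2)
      = t * (q₁ * q₂ * q₃ * q₄ * q₅ ^ 2) * (16 * (y₁ * y₂ * y₃ * y₄ * (y₅ * z) ^ 2)) := by
      intros; ring
    rw [this]

lemma tsum_S_eq_shiftProduct_mul {a b c : ℂ} (h : Admissible a b c) (k : ℕ) :
    ∑' n, S a b c n = shiftProduct a b c k * ∑' n, S (a - k) b c n := by
  induction k with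
  | zero => simp [shiftProduct, rising_zero]
  | succ k ih =>
    rw [ih, tsum_S_eq_shiftFactor_mul (h.shift k), shiftProduct_succ, ← mul_assoc]
    push_cast
    rw [sub_sub]

/-- The leading terms are `(-4k)(-4k)(16k²) / (2k) = 128 k³`; the function `g` is this quotient in
the variable `x = 1 / k`, continuous at 0. -/
lemma tendsto_S_zero (a b c : ℂ) :
    Tendsto (fun k : ℕ => S (a - k) b c 0 / (k : ℂ) ^ 3) atTop (𝓝 128) := by
  let g : ℂ → ℂ := fun x => (4 * (a * x - 1) - 2 * b * x - x) * (4 * (a * x - 1) - 2 * c * x - x)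
    * (16 * (a * x - 1) ^ 2 - 8 * (a * x - 1) * (3 * b + 3 * c + 1) * x
      + (8 * b ^ 2 + b * (20 * c + 6) + 8 * c ^ 2 + 6 * c + 1) * x ^ 2)
    / (-2 * (a * x - 1) + (b + c + 1) * x)
  have hg : ContinuousAt g 0 := by
    refine ContinuousAt.div (by fun_prop) (by fun_prop) (by norm_num)
  have h0 : Tendsto (fun k : ℕ => g ((k : ℂ)⁻¹)) atTop (𝓝 (g 0)) :=
    hg.tendsto.comp (tendsto_inv_atTop_nhds_zero_nat (𝕜 := ℂ))
  rw [show g 0 = 128 by norm_num [g]] at h0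
  refine h0.congr' ?_
  filter_upwards [eventually_ge_atTop 1] with k hk
  have hk0 : (k : ℂ) ≠ 0 := by exact_mod_cast (by omega : k ≠ 0)
  rw [S_eq_core, core_zero, one_mul]
  have hden : -2 * (a * (k : ℂ)⁻¹ - 1) + (b + c + 1) * (k : ℂ)⁻¹
      = (-2 * (a - k) + b + c + 2 * (0 : ℕ) + 1) * (k : ℂ)⁻¹ := by
    field_simp; push_cast; ring
  have hP : P (a - k) b c (0 : ℕ) = (k : ℂ) ^ 4 * ((4 * (a * (k : ℂ)⁻¹ - 1) - 2 * b * (k : ℂ)⁻¹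
      - (k : ℂ)⁻¹) * (4 * (a * (k : ℂ)⁻¹ - 1) - 2 * c * (k : ℂ)⁻¹ - (k : ℂ)⁻¹)
    * (16 * (a * (k : ℂ)⁻¹ - 1) ^ 2 - 8 * (a * (k : ℂ)⁻¹ - 1) * (3 * b + 3 * c + 1) * (k : ℂ)⁻¹
      + (8 * b ^ 2 + b * (20 * c + 6) + 8 * c ^ 2 + 6 * c + 1) * (k : ℂ)⁻¹ ^ 2)) := by
    simp only [P]; field_simp; push_cast; ring
  simp only [g]
  rw [hden, hP]
  generalize -2 * (a - k) + b + c + 2 * ((0 : ℕ) : ℂ) + 1 = d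
  field_simp

/-- Tannery's theorem with the majorant `C (n + 1) ^ 4 / 2 ^ n`. The terms with positive index carry
the factor `coreRatio (a - k) b c 0`, which tends to 0. -/
lemma tendsto_tsum_S (a b c : ℂ) :
    Tendsto (fun k : ℕ => (∑' n, S (a - k) b c n) / (k : ℂ) ^ 3) atTop (𝓝 128) := by
  obtain ⟨C, hC0, hC⟩ := exists_norm_S_le_of_core a b c
  have hhalf : ∀ᶠ k : ℕ in atTop, 1 ≤ k ∧ radius a b c ≤ k ∧
      ∀ n : ℕ, ‖coreRatio (a - k) b c n‖ ≤ 1 / 2 := by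
    filter_upwards [eventually_ge_atTop 1,
      tendsto_natCast_atTop_atTop.eventually_ge_atTop (10 * radius a b c ^ 2)] with k hk hk'
    have := two_le_radius a b c
    refine ⟨hk, by nlinarith, fun n => norm_coreRatio_le_half a b c k n ?_⟩
    have : (0 : ℝ) ≤ n := by positivity
    linarith
  have hlim : ∑' n : ℕ, (if n = 0 then 128 else 0 : ℂ) = 128 := by
    rw [tsum_ite_eq]
  rw [← hlim]
  simp_rw [← tsum_div_const]
  refine tendsto_tsum_of_dominated_convergence (summable_pow_mul_half C 4) ?_ ?_
  · intro n
    rcases n with _ | n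
    · simpa using tendsto_S_zero a b c
    · simp only [Nat.add_eq_zero_iff, one_ne_zero, and_false, if_false]
      have h1 : Tendsto (fun k : ℕ => ‖coreRatio (a - k) b c 0‖
          * ((1 / 2) ^ n * (C * (((n + 1 : ℕ) : ℝ) + 1) ^ 4))) atTop (𝓝 0) := by
        simpa using (tendsto_coreRatio_zero a b c).norm.mul_const
          ((1 / 2) ^ n * (C * (((n + 1 : ℕ) : ℝ) + 1) ^ 4))
      refine squeeze_zero_norm' ?_ h1
      filter_upwards [hhalf] with k hk
      have hk0 : (0 : ℝ) < k := by exact_mod_cast hk.1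
      have h3 := hC k (n + 1) hk.1 hk.2.1
      rw [norm_div, norm_pow, Complex.norm_natCast, div_le_iff₀ (by positivity)]
      calc _ ≤ _ := h3
        _ ≤ (‖coreRatio (a - k) b c 0‖ * (1 / 2) ^ n)
            * (C * (((n + 1 : ℕ) : ℝ) + 1) ^ 4 * k ^ 3) := by
          gcongr
          exact norm_core_succ_le_pow hk.2.2 n
        _ = _ := by ring
  · filter_upwards [hhalf] with k hk n
    have hk0 : (0 : ℝ) < k := by exact_mod_cast hk.1
    rw [norm_div, norm_pow, Complex.norm_natCast, div_le_iff₀ (by positivity)]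
    refine (hC k n hk.1 hk.2.1).trans ?_
    calc ‖core (a - k) b c n‖ * (C * (n + 1) ^ 4 * k ^ 3)
        ≤ (1 / 2) ^ n * (C * (n + 1) ^ 4 * k ^ 3) := by
          gcongr
          exact norm_core_le_pow hk.2.2 n
      _ = _ := by ring

/-! ### Asymptotics of rising factorials -/

lemma rising_eq_prod (z : ℂ) (m : ℕ) : rising z m = ∏ j ∈ Finset.range m, (z + j) := by
  induction m with
  | zero => simp [rising_zero]
  | succ m ih => rw [rising_succ, ih, Finset.prod_range_succ]

lemma rising_one (m : ℕ) : rising 1 m = (m ! : ℂ) := by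
  simp [rising]

/-- The rising factorial divided by its asymptotic growth. -/
def risingQuot (z : ℂ) (m : ℕ) : ℂ := rising z m * m / ((m : ℂ) ^ z * (m ! : ℂ))

lemma rising_eq_risingQuot (z : ℂ) {m : ℕ} (hm : m ≠ 0) :
    rising z m = risingQuot z m * ((m : ℂ) ^ z * (m ! : ℂ) / m) := by
  have h1 : (m : ℂ) ≠ 0 := by exact_mod_cast hm
  have h2 : (m : ℂ) ^ z ≠ 0 := by simp [Complex.cpow_eq_zero_iff, h1]
  have h3 : (m ! : ℂ) ≠ 0 := by exact_mod_cast m.factorial_ne_zero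
  rw [risingQuot]
  field_simp

/-- At a pole `z = -m` the product in Euler's sequence contains a zero factor from index `m` on, so
the reciprocals are eventually 0. This agrees with reading `1 / Γ` as 0 there. -/
lemma tendsto_inv_GammaSeq (z : ℂ) :
    Tendsto (fun m => (Complex.GammaSeq z m)⁻¹) atTop (𝓝 (Complex.Gamma z)⁻¹) := by
  by_cases h : Complex.Gamma z = 0
  · obtain ⟨m, rfl⟩ := (Complex.Gamma_eq_zero_iff z).1 h
    rw [h, inv_zero]
    refine tendsto_const_nhds.congr' ?_
    filter_upwards [eventually_ge_atTop m] with k hk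
    rw [Complex.GammaSeq, Finset.prod_eq_zero (i := m) (Finset.mem_range.2 (by omega)) (by simp)]
    simp
  · exact (Complex.GammaSeq_tendsto_Gamma z).inv₀ h

/-- Euler's product has one factor more than the rising factorial, so the two quotients differ by `m
/ (z + m)`, which tends to 1. No restriction on `z` is needed. -/
lemma tendsto_risingQuot (z : ℂ) :
    Tendsto (risingQuot z) atTop (𝓝 (Complex.Gamma z)⁻¹) := by
  have h1 : Tendsto (fun m : ℕ => (1 + z * (m : ℂ)⁻¹)⁻¹) atTop (𝓝 1) := by
    have := ((tendsto_inv_atTop_nhds_zero_nat (𝕜 := ℂ)).const_mul z).const_add 1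
    rw [mul_zero, add_zero] at this
    simpa using this.inv₀ (by simp)
  have h2 := (tendsto_inv_GammaSeq z).mul h1
  rw [mul_one] at h2
  refine h2.congr' ?_
  have hz : ∀ᶠ m : ℕ in atTop, z + m ≠ 0 := by
    filter_upwards [tendsto_natCast_atTop_atTop.eventually_gt_atTop ‖z‖] with m hm h0
    rw [eq_neg_of_add_eq_zero_left h0, norm_neg, Complex.norm_natCast] at hm
    exact lt_irrefl _ hm
  filter_upwards [hz, eventually_ge_atTop 1] with m hm hm1
  have hm0 : (m : ℂ) ≠ 0 := by exact_mod_cast (by omega : m ≠ 0)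
  rw [Complex.GammaSeq, ← rising_eq_prod, rising_succ, risingQuot,
    show (1 + z * (m : ℂ)⁻¹) = (z + m) / m by field_simp; ring, inv_div, inv_div,
    div_mul_div_comm]
  rw [show rising z m * (z + m) * m = rising z m * m * (z + m) by ring,
    mul_div_mul_right _ _ hm]

lemma rising_half (k : ℕ) : 4 ^ k * (k ! : ℂ) * rising (1 / 2) k = ((2 * k) ! : ℂ) := by
  induction k with
  | zero => simp [rising_zero]
  | succ k ih =>
    rw [show 2 * (k + 1) = 2 * k + 1 + 1 by ring, Nat.factorial_succ, Nat.factorial_succ,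
      Nat.factorial_succ, rising_succ]
    push_cast
    rw [← ih]
    ring

/-- After inserting the growth of each rising factorial, the powers of `2k` and `k` cancel up to `2
^ (-4a + 2b + 2c)` and a power of `k`. The factorials leave the square of `(2k)! / (4^k k!²)`, and
`k` times that square is `risingQuot (1/2) k ^ 2`. This is the source of the `1 / π` in the value.
-/
lemma shiftProduct_mul_pow (a b c : ℂ) {k : ℕ} (hk : k ≠ 0) :
    shiftProduct a b c k * (k : ℂ) ^ 3
      = (risingQuot (-2 * a + b + 1 / 2) (2 * k) * risingQuot (-2 * a + c + 1 / 2) (2 * k)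
        * risingQuot (-2 * a + 2 * b + c + 1 / 2) (2 * k)
        * risingQuot (-2 * a + b + 2 * c + 1 / 2) (2 * k))
        / (risingQuot (1 - a) k * risingQuot (-a + b + 1) k * risingQuot (-a + c + 1) k
          * risingQuot (-a + b + c + 1) k * risingQuot (-2 * a + b + c + 1) (2 * k) ^ 2)
        * ((2 : ℂ) ^ (-4 * a + 2 * b + 2 * c) / 4 * risingQuot (1 / 2) k ^ 2) := by
  have hk0 : (k : ℂ) ≠ 0 := by exact_mod_cast hk
  have h2k : 2 * k ≠ 0 := by omega
  have hkk : ((2 * k : ℕ) : ℂ) ≠ 0 := by exact_mod_cast h2k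
  have hf : (k ! : ℂ) ≠ 0 := by exact_mod_cast k.factorial_ne_zero
  have hf2 : ((2 * k) ! : ℂ) ≠ 0 := by exact_mod_cast (2 * k).factorial_ne_zero
  have hpow : (((2 * k : ℕ) : ℂ) ^ (-2 * a + b + 1 / 2) * ((2 * k : ℕ) : ℂ) ^ (-2 * a + c + 1 / 2)
      * ((2 * k : ℕ) : ℂ) ^ (-2 * a + 2 * b + c + 1 / 2)
      * ((2 * k : ℕ) : ℂ) ^ (-2 * a + b + 2 * c + 1 / 2))
      = (((2 * k : ℕ) : ℂ) ^ (-2 * a + b + c + 1)) ^ 2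
        * ((2 : ℂ) ^ (-4 * a + 2 * b + 2 * c) * (k : ℂ) ^ (-4 * a + 2 * b + 2 * c)) := by
    have e : (2 : ℂ) ^ (-4 * a + 2 * b + 2 * c) * (k : ℂ) ^ (-4 * a + 2 * b + 2 * c)
        = ((2 * k : ℕ) : ℂ) ^ (-4 * a + 2 * b + 2 * c) := by
      rw [Nat.cast_mul, Complex.natCast_mul_natCast_cpow]; norm_num
    rw [e, pow_two, ← Complex.cpow_add _ _ hkk, ← Complex.cpow_add _ _ hkk,
      ← Complex.cpow_add _ _ hkk, ← Complex.cpow_add _ _ hkk, ← Complex.cpow_add _ _ hkk]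
    congr 1
    ring
  have hpow' : (k : ℂ) ^ (1 - a) * (k : ℂ) ^ (-a + b + 1) * (k : ℂ) ^ (-a + c + 1)
      * (k : ℂ) ^ (-a + b + c + 1) = (k : ℂ) ^ 4 * (k : ℂ) ^ (-4 * a + 2 * b + 2 * c) := by
    rw [← Complex.cpow_natCast (k : ℂ) 4, ← Complex.cpow_add _ _ hk0, ← Complex.cpow_add _ _ hk0,
      ← Complex.cpow_add _ _ hk0, ← Complex.cpow_add _ _ hk0]
    congr 1
    push_cast
    ring
  have hhalf : risingQuot (1 / 2) k ^ 2 = k * (((2 * k) ! : ℂ) / (4 ^ k * (k ! : ℂ) ^ 2)) ^ 2 := by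
    have : ((k : ℂ) ^ (1 / 2 : ℂ)) ^ 2 = k := by
      rw [← Complex.cpow_nat_mul]; norm_num
    rw [risingQuot, div_pow, mul_pow _ (k ! : ℂ), this, ← rising_half]
    field_simp
  rw [shiftProduct]
  simp only [rising_eq_risingQuot _ h2k, rising_eq_risingQuot _ hk]
  rw [hhalf]
  have key : ∀ X₁ X₂ X₃ X₄ p₁ p₂ p₃ p₄ Y₁ Y₂ Y₃ Y₄ q₁ q₂ q₃ q₄ Z r w v f g t κ : ℂ,
      p₁ * p₂ * p₃ * p₄ = r ^ 2 * (w * v) → q₁ * q₂ * q₃ * q₄ = κ ^ 4 * v →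
      r ≠ 0 → v ≠ 0 → f ≠ 0 → g ≠ 0 → t ≠ 0 → κ ≠ 0 →
      (X₁ * (p₁ * g / (2 * κ)) * (X₂ * (p₂ * g / (2 * κ))) * (X₃ * (p₃ * g / (2 * κ)))
        * (X₄ * (p₄ * g / (2 * κ))))
        / (t ^ 2 * (Y₁ * (q₁ * f / κ) * (Y₂ * (q₂ * f / κ)) * (Y₃ * (q₃ * f / κ))
          * (Y₄ * (q₄ * f / κ)) * (Z * (r * g / (2 * κ))) ^ 2)) * κ ^ 3
      = X₁ * X₂ * X₃ * X₄ / (Y₁ * Y₂ * Y₃ * Y₄ * Z ^ 2)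
        * (w / 4 * (κ * (g / (t * f ^ 2)) ^ 2)) := by
    intro X₁ X₂ X₃ X₄ p₁ p₂ p₃ p₄ Y₁ Y₂ Y₃ Y₄ q₁ q₂ q₃ q₄ Z r w v f g t κ h1 h2 hr hv hf hg ht hκ
    rw [show X₁ * (p₁ * g / (2 * κ)) * (X₂ * (p₂ * g / (2 * κ))) * (X₃ * (p₃ * g / (2 * κ)))
        * (X₄ * (p₄ * g / (2 * κ))) = X₁ * X₂ * X₃ * X₄ * ((p₁ * p₂ * p₃ * p₄)
          * (g / (2 * κ)) ^ 4) by ring,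
      show t ^ 2 * (Y₁ * (q₁ * f / κ) * (Y₂ * (q₂ * f / κ)) * (Y₃ * (q₃ * f / κ))
          * (Y₄ * (q₄ * f / κ)) * (Z * (r * g / (2 * κ))) ^ 2)
        = (Y₁ * Y₂ * Y₃ * Y₄ * Z ^ 2) * (t ^ 2 * ((q₁ * q₂ * q₃ * q₄) * (f / κ) ^ 4)
          * (r * g / (2 * κ)) ^ 2) by ring, h1, h2]
    rw [← div_mul_div_comm, mul_assoc]
    congr 1
    field_simp
    norm_num
  rw [show (2 : ℂ) ^ (4 * k) = ((4 : ℂ) ^ k) ^ 2 by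
    rw [← pow_mul, show (4 : ℂ) = 2 ^ 2 by norm_num, ← pow_mul]; ring_nf]
  have := key _ _ _ _ (risingQuot (1 - a) k) (risingQuot (-a + b + 1) k)
    (risingQuot (-a + c + 1) k) (risingQuot (-a + b + c + 1) k) _ _ _ _
    (risingQuot (-2 * a + b + c + 1) (2 * k)) _ _ _ (k ! : ℂ) ((2 * k) ! : ℂ) (4 ^ k) k
    hpow hpow' (by simp [Complex.cpow_eq_zero_iff, hk0])
    (by simp [Complex.cpow_eq_zero_iff, hk0]) hf hf2 (pow_ne_zero _ (by norm_num)) hk0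
    (X₁ := risingQuot (-2 * a + b + 1 / 2) (2 * k)) (X₂ := risingQuot (-2 * a + c + 1 / 2) (2 * k))
    (X₃ := risingQuot (-2 * a + 2 * b + c + 1 / 2) (2 * k))
    (X₄ := risingQuot (-2 * a + b + 2 * c + 1 / 2) (2 * k))
  push_cast at this ⊢
  exact this

/-- The value of the series. -/
def value (a b c : ℂ) : ℂ :=
  Complex.Gamma (1 - a) * (2 : ℂ) ^ (-4 * a + 2 * b + 2 * c + 5)
      * Complex.Gamma (-a + b + 1) * Complex.Gamma (-a + c + 1)
      * Complex.Gamma (-2 * a + b + c + 1) ^ 2 * Complex.Gamma (-a + b + c + 1)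
    / (Real.pi * Complex.Gamma (-2 * a + b + 1 / 2) * Complex.Gamma (-2 * a + c + 1 / 2)
      * Complex.Gamma (-2 * a + 2 * b + c + 1 / 2)
      * Complex.Gamma (-2 * a + b + 2 * c + 1 / 2))

lemma Gamma_ne_zero_of_add_ne {z : ℂ} (h : ∀ n : ℕ, z + n ≠ 0) : Complex.Gamma z ≠ 0 :=
  Complex.Gamma_ne_zero fun m hm => h m (by rw [hm]; ring)

lemma tendsto_shiftProduct {a b c : ℂ} (h : Admissible a b c) :
    Tendsto (fun k : ℕ => shiftProduct a b c k * (k : ℂ) ^ 3) atTop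
      (𝓝 (value a b c / 128)) := by
  have h2 : Tendsto (fun k : ℕ => 2 * k) atTop atTop :=
    tendsto_id.const_mul_atTop' (by norm_num)
  have t : ∀ z, Tendsto (fun k : ℕ => risingQuot z (2 * k)) atTop (𝓝 (Complex.Gamma z)⁻¹) :=
    fun z => (tendsto_risingQuot z).comp h2
  have s := tendsto_risingQuot
  have g1 := Gamma_ne_zero_of_add_ne h.sub_ne
  have g2 := Gamma_ne_zero_of_add_ne h.sub_b_ne
  have g3 := Gamma_ne_zero_of_add_ne h.sub_c_ne
  have g4 := Gamma_ne_zero_of_add_ne h.sub_bc_ne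
  have g5 := Gamma_ne_zero_of_add_ne h.two_sub_ne
  have key := ((((t (-2 * a + b + 1 / 2)).mul (t (-2 * a + c + 1 / 2))).mul
    (t (-2 * a + 2 * b + c + 1 / 2))).mul (t (-2 * a + b + 2 * c + 1 / 2))).div
    (((((s (1 - a)).mul (s (-a + b + 1))).mul (s (-a + c + 1))).mul (s (-a + b + c + 1))).mul
      ((t (-2 * a + b + c + 1)).pow 2)) (mul_ne_zero (mul_ne_zero (mul_ne_zero (mul_ne_zero
        (inv_ne_zero g1) (inv_ne_zero g2)) (inv_ne_zero g3)) (inv_ne_zero g4))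
        (pow_ne_zero 2 (inv_ne_zero g5)))
  have key2 := key.mul (((s (1 / 2)).pow 2).const_mul ((2 : ℂ) ^ (-4 * a + 2 * b + 2 * c) / 4))
  have e : value a b c / 128 = (Complex.Gamma (-2 * a + b + 1 / 2))⁻¹
      * (Complex.Gamma (-2 * a + c + 1 / 2))⁻¹ * (Complex.Gamma (-2 * a + 2 * b + c + 1 / 2))⁻¹
      * (Complex.Gamma (-2 * a + b + 2 * c + 1 / 2))⁻¹
      / ((Complex.Gamma (1 - a))⁻¹ * (Complex.Gamma (-a + b + 1))⁻¹
        * (Complex.Gamma (-a + c + 1))⁻¹ * (Complex.Gamma (-a + b + c + 1))⁻¹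
        * (Complex.Gamma (-2 * a + b + c + 1))⁻¹ ^ 2)
      * ((2 : ℂ) ^ (-4 * a + 2 * b + 2 * c) / 4 * (Complex.Gamma (1 / 2))⁻¹ ^ 2) := by
    have hpi : Complex.Gamma (1 / 2) ^ 2 = Real.pi := by
      rw [Complex.Gamma_one_half_eq, ← Complex.cpow_nat_mul]; norm_num
    rw [inv_pow (Complex.Gamma (1 / 2)), hpi, value, Complex.cpow_add _ _ two_ne_zero,
      show (2 : ℂ) ^ (5 : ℂ) = 32 by
        rw [show (5 : ℂ) = (5 : ℕ) by norm_num, Complex.cpow_natCast]; norm_num]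
    simp only [div_eq_mul_inv, mul_inv, inv_inv, inv_pow]
    ring
  rw [e]
  refine key2.congr' ?_
  filter_upwards [eventually_ge_atTop 1] with k hk
  rw [shiftProduct_mul_pow a b c (by omega)]
  rfl

/-- The three-parameter summation formula. -/
theorem hasSum_S {a b c : ℂ} (h : Admissible a b c) : HasSum (S a b c) (value a b c) := by
  have h1 := (tendsto_shiftProduct h).mul (tendsto_tsum_S a b c)
  rw [div_mul_cancel₀ _ (by norm_num)] at h1
  have h2 : ∑' n, S a b c n = value a b c := by
    -- The product of the two sequences is the constant `∑' n, S a b c n` for `k ≥ 1`, since the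
    -- factors `k ^ 3` cancel.
    refine tendsto_nhds_unique (tendsto_const_nhds.congr' ?_) h1
    filter_upwards [eventually_ge_atTop 1] with k hk
    have hk0 : (k : ℂ) ≠ 0 := by exact_mod_cast (by omega : k ≠ 0)
    rw [tsum_S_eq_shiftProduct_mul h k]
    field_simp
  rw [← h2]
  exact (summable_S a b c).hasSum

/-! ### Directional derivatives and the spaces `V N` -/

section Directional

variable {E : Type*} [NormedAddCommGroup E] [NormedSpace ℂ E]

/-- The derivative of `F` in the direction `v`. -/
def dirDeriv (v : E) (F : E → ℂ) : E → ℂ := fun x => fderiv ℂ F x v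

lemma dirDeriv_congr {F G : E → ℂ} {p : E} (v : E) (h : F =ᶠ[𝓝 p] G) :
    dirDeriv v F =ᶠ[𝓝 p] dirDeriv v G := by
  filter_upwards [h.fderiv (𝕜 := ℂ)] with x hx
  simp only [dirDeriv, hx]

lemma iterate_dirDeriv_congr {F G : E → ℂ} {p : E} (v : E) (h : F =ᶠ[𝓝 p] G) (k : ℕ) :
    (dirDeriv v)^[k] F =ᶠ[𝓝 p] (dirDeriv v)^[k] G := by
  induction k with
  | zero => exact h
  | succ k ih => rw [Function.iterate_succ_apply', Function.iterate_succ_apply']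
                 exact dirDeriv_congr v ih

lemma analyticAt_dirDeriv {F : E → ℂ} {p : E} (v : E) (h : AnalyticAt ℂ F p) :
    AnalyticAt ℂ (dirDeriv v F) p :=
  ((ContinuousLinearMap.apply ℂ ℂ v).analyticAt _).comp h.fderiv

lemma analyticAt_iterate_dirDeriv {F : E → ℂ} {p : E} (v : E) (h : AnalyticAt ℂ F p) (k : ℕ) :
    AnalyticAt ℂ ((dirDeriv v)^[k] F) p := by
  induction k with
  | zero => exact h
  | succ k ih => rw [Function.iterate_succ_apply']; exact analyticAt_dirDeriv v ih

/-- Symmetry of the second derivative, stated near `p` and not only at `p` so that it can be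
differentiated again. -/
lemma dirDeriv_comm {F : E → ℂ} {p : E} (u v : E) (h : AnalyticAt ℂ F p) :
    dirDeriv u (dirDeriv v F) =ᶠ[𝓝 p] dirDeriv v (dirDeriv u F) := by
  filter_upwards [h.eventually_analyticAt] with x hx
  have key : ∀ u v : E, dirDeriv u (dirDeriv v F) x = fderiv ℂ (fderiv ℂ F) x u v := by
    intro u v
    have hd : HasFDerivAt (fderiv ℂ F) (fderiv ℂ (fderiv ℂ F) x) x :=
      hx.fderiv.differentiableAt.hasFDerivAt
    have := (ContinuousLinearMap.apply ℂ ℂ v).hasFDerivAt.comp x hd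
    have e : dirDeriv v F = (ContinuousLinearMap.apply ℂ ℂ v) ∘ fderiv ℂ F := rfl
    rw [dirDeriv, e, this.fderiv]
    rfl
  rw [key, key]
  exact (hx.contDiffAt (n := 2)).isSymmSndFDerivAt (by simp) u v

lemma iterate_dirDeriv_comm {F : E → ℂ} {p : E} (u v : E) (h : AnalyticAt ℂ F p) (k : ℕ) :
    (dirDeriv u)^[k] (dirDeriv v F) =ᶠ[𝓝 p] dirDeriv v ((dirDeriv u)^[k] F) := by
  induction k with
  | zero => exact EventuallyEq.rfl
  | succ k ih =>
    rw [Function.iterate_succ_apply', Function.iterate_succ_apply']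
    exact (dirDeriv_congr u ih).trans (dirDeriv_comm u v (analyticAt_iterate_dirDeriv u h k))

lemma iterate_dirDeriv_add {F G : E → ℂ} {p : E} (v : E) (hF : AnalyticAt ℂ F p)
    (hG : AnalyticAt ℂ G p) (k : ℕ) :
    (dirDeriv v)^[k] (F + G) =ᶠ[𝓝 p] (dirDeriv v)^[k] F + (dirDeriv v)^[k] G := by
  induction k with
  | zero => exact EventuallyEq.rfl
  | succ k ih =>
    rw [Function.iterate_succ_apply', Function.iterate_succ_apply',
      Function.iterate_succ_apply']
    refine (dirDeriv_congr v ih).trans ?_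
    filter_upwards [(analyticAt_iterate_dirDeriv v hF k).eventually_analyticAt,
      (analyticAt_iterate_dirDeriv v hG k).eventually_analyticAt] with x hx hy
    simp only [dirDeriv, Pi.add_apply]
    rw [fderiv_add hx.differentiableAt hy.differentiableAt]
    rfl

lemma iterate_dirDeriv_smul {F : E → ℂ} {p : E} (v : E) (hF : AnalyticAt ℂ F p) (c : ℂ) (k : ℕ) :
    (dirDeriv v)^[k] (c • F) =ᶠ[𝓝 p] c • (dirDeriv v)^[k] F := by
  induction k with
  | zero => exact EventuallyEq.rfl
  | succ k ih =>
    rw [Function.iterate_succ_apply', Function.iterate_succ_apply']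
    refine (dirDeriv_congr v ih).trans ?_
    filter_upwards [(analyticAt_iterate_dirDeriv v hF k).eventually_analyticAt] with x hx
    simp only [dirDeriv, Pi.smul_apply]
    rw [fderiv_const_smul hx.differentiableAt]
    rfl

lemma iteratedDeriv_line {F : E → ℂ} {p : E} (v : E) (h : AnalyticAt ℂ F p) (k : ℕ) :
    iteratedDeriv k (fun t : ℂ => F (p + t • v)) 0 = (dirDeriv v)^[k] F p := by
  induction k generalizing F with
  | zero => simp
  | succ k ih =>
    rw [iteratedDeriv_succ', Function.iterate_succ_apply, ← ih (analyticAt_dirDeriv v h)]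
    refine Filter.EventuallyEq.iteratedDeriv_eq k ?_
    have hc : Tendsto (fun t : ℂ => p + t • v) (𝓝 0) (𝓝 p) := by
      have : ContinuousAt (fun t : ℂ => p + t • v) 0 := by fun_prop
      simpa [ContinuousAt] using this
    filter_upwards [hc.eventually h.eventually_analyticAt] with t ht
    have h1 : HasDerivAt (fun t : ℂ => p + t • v) v t := by
      simpa using ((hasDerivAt_id t).smul_const v).const_add p
    exact (ht.differentiableAt.hasFDerivAt.comp_hasDerivAt t h1).deriv

end Directional

/-- The function of a vector that belongs to a function of three variables. -/
def uncurry₃ (f : ℂ → ℂ → ℂ → ℂ) : ℂ × ℂ × ℂ → ℂ := fun p => f p.1 p.2.1 p.2.2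

/-- A mixed partial derivative at the origin. -/
def mixed (F : ℂ × ℂ × ℂ → ℂ) (i j k : ℕ) : ℂ :=
  (dirDeriv (1, 0, 0))^[i] ((dirDeriv (0, 1, 0))^[j] ((dirDeriv (0, 0, 1))^[k] F)) 0

lemma mixed_dirDeriv_fst {F : ℂ × ℂ × ℂ → ℂ} (h : AnalyticAt ℂ F 0) (i j k : ℕ) :
    mixed (dirDeriv (1, 0, 0) F) i j k = mixed F (i + 1) j k := by
  rw [mixed, mixed, Function.iterate_succ_apply]
  refine (iterate_dirDeriv_congr _ ?_ i).eq_of_nhds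
  refine (iterate_dirDeriv_congr _ (iterate_dirDeriv_comm _ _ h k) j).trans ?_
  exact iterate_dirDeriv_comm _ _ (analyticAt_iterate_dirDeriv _ h k) j

lemma mixed_dirDeriv_snd {F : ℂ × ℂ × ℂ → ℂ} (h : AnalyticAt ℂ F 0) (i j k : ℕ) :
    mixed (dirDeriv (0, 1, 0) F) i j k = mixed F i (j + 1) k := by
  rw [mixed, mixed, Function.iterate_succ_apply _ j]
  refine (iterate_dirDeriv_congr _ ?_ i).eq_of_nhds
  exact iterate_dirDeriv_congr _ (iterate_dirDeriv_comm _ _ h k) j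

lemma mixed_dirDeriv_trd (F : ℂ × ℂ × ℂ → ℂ) (i j k : ℕ) :
    mixed (dirDeriv (0, 0, 1) F) i j k = mixed F i j (k + 1) := by
  rw [mixed, mixed, Function.iterate_succ_apply _ k]

/-- The nested one-variable derivatives in `coeff` are derivatives along coordinate lines;
analyticity gives each inner equality on a neighbourhood, as the next outer derivative requires. -/
lemma mixed_eq_coeff {f : ℂ → ℂ → ℂ → ℂ} (h : AnalyticAt ℂ (uncurry₃ f) 0) (i j k : ℕ) :
    mixed (uncurry₃ f) i j k = ((i ! * j ! * k ! : ℕ) : ℂ) * coeff f i j k := by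
  have h3 := analyticAt_iterate_dirDeriv (0, 0, 1) h k
  have h2 := analyticAt_iterate_dirDeriv (0, 1, 0) h3 j
  have e3 : ∀ᶠ p : ℂ × ℂ in 𝓝 0, iteratedDeriv k (fun c => f p.1 p.2 c) 0
      = (dirDeriv (0, 0, 1))^[k] (uncurry₃ f) (p.1, p.2, 0) := by
    have hc : Tendsto (fun p : ℂ × ℂ => ((p.1, p.2, 0) : ℂ × ℂ × ℂ)) (𝓝 0) (𝓝 0) := by
      have : ContinuousAt (fun p : ℂ × ℂ => ((p.1, p.2, 0) : ℂ × ℂ × ℂ)) 0 := by fun_prop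
      exact this
    filter_upwards [hc.eventually h.eventually_analyticAt] with p hp
    rw [← iteratedDeriv_line _ hp]
    simp [uncurry₃]
  have e2 : ∀ᶠ a : ℂ in 𝓝 0,
      iteratedDeriv j (fun b => iteratedDeriv k (fun c => f a b c) 0) 0
      = (dirDeriv (0, 1, 0))^[j] ((dirDeriv (0, 0, 1))^[k] (uncurry₃ f)) (a, 0, 0) := by
    have hc : Tendsto (fun a : ℂ => ((a, 0, 0) : ℂ × ℂ × ℂ)) (𝓝 0) (𝓝 0) := by
      have : ContinuousAt (fun a : ℂ => ((a, 0, 0) : ℂ × ℂ × ℂ)) 0 := by fun_prop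
      exact this
    -- An equality near the origin of the `(a, b)`-plane holds, for each fixed small `a`, for all
    -- `b` near 0.
    have e3' : ∀ᶠ a : ℂ in 𝓝 0, ∀ᶠ b : ℂ in 𝓝 0, iteratedDeriv k (fun c => f a b c) 0
        = (dirDeriv (0, 0, 1))^[k] (uncurry₃ f) (a, b, 0) :=
      Eventually.curry (la := 𝓝 (0 : ℂ)) (lb := 𝓝 (0 : ℂ)) (by rw [← nhds_prod_eq]; exact e3)
    filter_upwards [hc.eventually h3.eventually_analyticAt, e3'] with a ha hb
    rw [← iteratedDeriv_line _ ha]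
    refine Filter.EventuallyEq.iteratedDeriv_eq j ?_
    filter_upwards [hb] with b hb
    rw [hb]
    simp
  have e1 : iteratedDeriv i (fun a => iteratedDeriv j (fun b => iteratedDeriv k
      (fun c => f a b c) 0) 0) 0 = mixed (uncurry₃ f) i j k := by
    rw [mixed, ← iteratedDeriv_line _ h2]
    refine Filter.EventuallyEq.iteratedDeriv_eq i ?_
    filter_upwards [e2] with a ha
    rw [ha]
    simp
  have hi : (i ! : ℂ) ≠ 0 := by exact_mod_cast i.factorial_ne_zero
  have hj : (j ! : ℂ) ≠ 0 := by exact_mod_cast j.factorial_ne_zero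
  have hk : (k ! : ℂ) ≠ 0 := by exact_mod_cast k.factorial_ne_zero
  rw [coeff, e1]
  push_cast
  field_simp

/-- One derivative along `v` is the rational combination of the three coordinate derivatives;
induction applies to these, and commutation restores the order of differentiation fixed in `mixed`.
The weights do not depend on `n`, so the combination is one of functions of `n`. -/
lemma iterate_dirDeriv_mem_span (F : ℕ → ℂ × ℂ × ℂ → ℂ) (hF : ∀ n, AnalyticAt ℂ (F n) 0)
    (α β γ : ℚ) (N : ℕ) :
    (fun n => (dirDeriv ((α : ℂ), (β : ℂ), (γ : ℂ)))^[N] (F n) 0) ∈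
      Submodule.span ℚ {g : ℕ → ℂ | ∃ i j k : ℕ, i + j + k = N ∧ g = fun n => mixed (F n) i j k} := by
  induction N generalizing F with
  | zero =>
    exact Submodule.subset_span ⟨0, 0, 0, rfl, rfl⟩
  | succ N ih =>
    set v : ℂ × ℂ × ℂ := ((α : ℂ), (β : ℂ), (γ : ℂ))
    have hd : ∀ u n, AnalyticAt ℂ (dirDeriv u (F n)) 0 := fun u n => analyticAt_dirDeriv u (hF n)
    have e : (fun n => (dirDeriv v)^[N + 1] (F n) 0)
        = α • (fun n => (dirDeriv v)^[N] (dirDeriv (1, 0, 0) (F n)) 0)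
          + β • (fun n => (dirDeriv v)^[N] (dirDeriv (0, 1, 0) (F n)) 0)
          + γ • (fun n => (dirDeriv v)^[N] (dirDeriv (0, 0, 1) (F n)) 0) := by
      funext n
      have hv : dirDeriv v (F n) = (α : ℂ) • dirDeriv (1, 0, 0) (F n)
          + (β : ℂ) • dirDeriv (0, 1, 0) (F n) + (γ : ℂ) • dirDeriv (0, 0, 1) (F n) := by
        funext x
        simp only [dirDeriv, Pi.add_apply, Pi.smul_apply, ← map_smul, ← map_add]
        simp [v]
      have a1 := ((hd (1, 0, 0) n).const_smul (c := (α : ℂ)))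
      have a2 := ((hd (0, 1, 0) n).const_smul (c := (β : ℂ)))
      have a3 := ((hd (0, 0, 1) n).const_smul (c := (γ : ℂ)))
      rw [Function.iterate_succ_apply, hv,
        (iterate_dirDeriv_add v (a1.add a2) a3 N).eq_of_nhds, Pi.add_apply,
        (iterate_dirDeriv_add v a1 a2 N).eq_of_nhds, Pi.add_apply,
        (iterate_dirDeriv_smul v (hd _ n) _ N).eq_of_nhds,
        (iterate_dirDeriv_smul v (hd _ n) _ N).eq_of_nhds,
        (iterate_dirDeriv_smul v (hd _ n) _ N).eq_of_nhds]
      simp [Rat.smul_def]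
    have mono : ∀ u : ℂ × ℂ × ℂ, (∀ i j k : ℕ, i + j + k = N → ∃ i' j' k' : ℕ,
        i' + j' + k' = N + 1 ∧ ∀ n, mixed (dirDeriv u (F n)) i j k = mixed (F n) i' j' k') →
        (fun n => (dirDeriv v)^[N] (dirDeriv u (F n)) 0) ∈ Submodule.span ℚ
          {g : ℕ → ℂ | ∃ i j k : ℕ, i + j + k = N + 1 ∧ g = fun n => mixed (F n) i j k} := by
      intro u hu
      refine Submodule.span_mono ?_ (ih (fun n => dirDeriv u (F n)) (hd u))
      rintro g ⟨i, j, k, hs, rfl⟩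
      obtain ⟨i', j', k', hs', hm⟩ := hu i j k hs
      exact ⟨i', j', k', hs', funext hm⟩
    rw [e]
    refine add_mem (add_mem (Submodule.smul_mem _ _ (mono _ fun i j k hs => ?_))
      (Submodule.smul_mem _ _ (mono _ fun i j k hs => ?_)))
      (Submodule.smul_mem _ _ (mono _ fun i j k hs => ?_))
    · exact ⟨i + 1, j, k, by omega, fun n => mixed_dirDeriv_fst (hF n) i j k⟩
    · exact ⟨i, j + 1, k, by omega, fun n => mixed_dirDeriv_snd (hF n) i j k⟩
    · exact ⟨i, j, k + 1, by omega, fun n => mixed_dirDeriv_trd (F n) i j k⟩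

/-- The Taylor coefficient of order `N` at the origin. -/
def taylor (N : ℕ) (f : ℂ → ℂ) : ℂ := iteratedDeriv N f 0 / (N ! : ℂ)

/-- Taylor coefficients of `S` along a rational line through the origin belong to `V N`. -/
lemma taylor_line_mem_V (hS : ∀ n, AnalyticAt ℂ (uncurry₃ fun a b c => S a b c n) 0)
    (α β γ : ℚ) (N : ℕ) :
    (fun n => taylor N fun t => S (α * t) (β * t) (γ * t) n) ∈ V N := by
  have h := iterate_dirDeriv_mem_span _ hS α β γ N
  have hle : Submodule.span ℚ {g : ℕ → ℂ | ∃ i j k : ℕ, i + j + k = N ∧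
      g = fun n => mixed (uncurry₃ fun a b c => S a b c n) i j k} ≤ V N := by
    rw [Submodule.span_le]
    rintro g ⟨i, j, k, hs, rfl⟩
    have : (fun n => mixed (uncurry₃ fun a b c => S a b c n) i j k)
        = ((i ! * j ! * k ! : ℕ) : ℚ) • fun n => coeff (fun a b c => S a b c n) i j k := by
      funext n
      rw [mixed_eq_coeff (hS n)]
      simp [Rat.smul_def]
    rw [this]
    exact Submodule.smul_mem _ _ (Submodule.subset_span ⟨i, j, k, hs, rfl⟩)
  have e : (fun n => taylor N fun t => S (α * t) (β * t) (γ * t) n)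
      = ((N ! : ℚ)⁻¹) • fun n => (dirDeriv ((α : ℂ), (β : ℂ), (γ : ℂ)))^[N]
        (uncurry₃ fun a b c => S a b c n) 0 := by
    funext n
    rw [Pi.smul_apply, ← iteratedDeriv_line _ (hS n), taylor, Rat.smul_def]
    simp [uncurry₃, div_eq_inv_mul, mul_comm]
  rw [e]
  exact Submodule.smul_mem _ _ (hle h)

/-! ### Termwise Taylor coefficients -/

/-- Weierstrass's theorem, iterated: Cauchy's estimate on circles of radius `r / 2` bounds the
derivatives by `u n / (r / 2)` on the ball of half the radius. -/
lemma hasSum_iteratedDeriv {f : ℕ → ℂ → ℂ} {g : ℂ → ℂ} {u : ℕ → ℝ} {r : ℝ} (hr : 0 < r)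
    (hu : Summable u) (hf : ∀ n, DifferentiableOn ℂ (f n) (Metric.ball 0 r))
    (hb : ∀ n, ∀ t ∈ Metric.ball (0 : ℂ) r, ‖f n t‖ ≤ u n)
    (hs : ∀ t ∈ Metric.ball (0 : ℂ) r, HasSum (fun n => f n t) (g t)) (N : ℕ) :
    HasSum (fun n => iteratedDeriv N (f n) 0) (iteratedDeriv N g 0) := by
  induction N generalizing f g u r with
  | zero => simpa using hs 0 (Metric.mem_ball_self hr)
  | succ N ih =>
    simp only [iteratedDeriv_succ']
    have hsub : ∀ t ∈ Metric.ball (0 : ℂ) (r / 2),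
        Metric.closedBall t (r / 2) ⊆ Metric.ball (0 : ℂ) r := by
      intro t ht z hz
      rw [Metric.mem_ball] at ht ⊢
      rw [Metric.mem_closedBall] at hz
      linarith [dist_triangle z t 0]
    have hsub' : Metric.ball (0 : ℂ) (r / 2) ⊆ Metric.ball (0 : ℂ) r :=
      Metric.ball_subset_ball (by linarith)
    refine ih (u := fun n => u n / (r / 2)) (half_pos hr) (hu.div_const _) (fun n => ?_) ?_ ?_
    · exact ((hf n).deriv Metric.isOpen_ball).mono hsub'
    · intro n t ht
      refine Complex.norm_deriv_le_of_forall_mem_sphere_norm_le (half_pos hr) ?_ ?_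
      · exact ((hf n).mono (hsub t ht)).diffContOnCl_ball subset_rfl
      · intro z hz
        exact hb n z (hsub t ht (Metric.sphere_subset_closedBall hz))
    · intro t ht
      have h1 := Complex.hasSum_deriv_of_summable_norm hu hf Metric.isOpen_ball hb (hsub' ht)
      have h2 : (fun w => ∑' i, f i w) =ᶠ[𝓝 t] g := by
        filter_upwards [Metric.isOpen_ball.mem_nhds (hsub' ht)] with w hw
        exact (hs w hw).tsum_eq
      rwa [h2.deriv_eq] at h1

lemma hasSum_taylor {f : ℕ → ℂ → ℂ} {g : ℂ → ℂ} {u : ℕ → ℝ} {r : ℝ} (hr : 0 < r)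
    (hu : Summable u) (hf : ∀ n, DifferentiableOn ℂ (f n) (Metric.ball 0 r))
    (hb : ∀ n, ∀ t ∈ Metric.ball (0 : ℂ) r, ‖f n t‖ ≤ u n)
    (hs : ∀ t ∈ Metric.ball (0 : ℂ) r, HasSum (fun n => f n t) (g t)) (N : ℕ) :
    HasSum (fun n => taylor N (f n)) (taylor N g) :=
  (hasSum_iteratedDeriv hr hu hf hb hs N).div_const _

/-! ### The summand near the origin -/

/-- The bound 5 is attained by `-2a + 2b + c` and `-2a + b + 2c`. -/
lemma norm_linear_le {a b c : ℂ} (ha : ‖a‖ ≤ 1 / 100) (hb : ‖b‖ ≤ 1 / 100) (hc : ‖c‖ ≤ 1 / 100)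
    (r s t : ℝ) (hr : |r| + |s| + |t| ≤ 5) :
    ‖(r : ℂ) * a + (s : ℂ) * b + (t : ℂ) * c‖ ≤ 1 / 20 := by
  have h2 := norm_add_le ((r : ℂ) * a + (s : ℂ) * b) ((t : ℂ) * c)
  have h3 := norm_add_le ((r : ℂ) * a) ((s : ℂ) * b)
  simp only [norm_mul, Complex.norm_real, Real.norm_eq_abs] at h2 h3
  have i1 := mul_le_mul_of_nonneg_left ha (abs_nonneg r)
  have i2 := mul_le_mul_of_nonneg_left hb (abs_nonneg s)
  have i3 := mul_le_mul_of_nonneg_left hc (abs_nonneg t)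
  linarith

lemma admissible_of_norm_le {a b c : ℂ} (ha : ‖a‖ ≤ 1 / 100) (hb : ‖b‖ ≤ 1 / 100)
    (hc : ‖c‖ ≤ 1 / 100) : Admissible a b c := by
  intro m
  have key : ∀ r s t : ℝ, |r| + |s| + |t| ≤ 5 →
      (r : ℂ) * a + (s : ℂ) * b + (t : ℂ) * c ≠ m + 1 := by
    intro r s t hr h
    have h1 := norm_linear_le ha hb hc r s t hr
    rw [h] at h1
    have h2 : ‖(m + 1 : ℂ)‖ = m + 1 := by exact_mod_cast Complex.norm_natCast (m + 1)
    rw [h2] at h1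
    have : (0 : ℝ) ≤ m := by positivity
    linarith
  refine ⟨?_, ?_, ?_, ?_, ?_⟩
  · simpa using key 1 0 0 (by norm_num)
  · have := key 1 (-1) 0 (by norm_num)
    push_cast at this
    simpa [sub_eq_add_neg] using this
  · have := key 1 0 (-1) (by norm_num)
    push_cast at this
    simpa [sub_eq_add_neg] using this
  · have := key 2 (-1) (-1) (by norm_num)
    push_cast at this
    simpa [sub_eq_add_neg] using this
  · have := key 1 (-1) (-1) (by norm_num)
    push_cast at this
    simpa [sub_eq_add_neg] using this

/-- The value `n + 3/4` separates the numerator factors, near `n + 1/2`, from the denominator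
factors, near `n + 1` or larger. The remaining factor 16 gives more than the required 1/2. -/
lemma norm_coreRatio_le_half_of_norm_le {a b c : ℂ} (ha : ‖a‖ ≤ 1 / 100) (hb : ‖b‖ ≤ 1 / 100)
    (hc : ‖c‖ ≤ 1 / 100) (n : ℕ) : ‖coreRatio a b c n‖ ≤ 1 / 2 := by
  have hn : (0 : ℝ) ≤ n := by positivity
  have up : ∀ r s t : ℝ, ∀ z : ℂ, |r| + |s| + |t| ≤ 5 →
      z = (r : ℂ) * a + (s : ℂ) * b + (t : ℂ) * c + ((n + 1 / 2 : ℝ) : ℂ) →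
      ‖z‖ ≤ n + 3 / 4 := by
    intro r s t z hr hz
    have := norm_add_real_le (by positivity) (norm_linear_le ha hb hc r s t hr) hz
    linarith
  have low : ∀ r s t x : ℝ, ∀ z : ℂ, |r| + |s| + |t| ≤ 5 → n + 1 ≤ x →
      z = (r : ℂ) * a + (s : ℂ) * b + (t : ℂ) * c + (x : ℂ) →
      n + 3 / 4 ≤ ‖z‖ := by
    intro r s t x z hr hx hz
    have := le_norm_add_real (by linarith) (norm_linear_le ha hb hc r s t hr) hz
    linarith
  have a1 : ‖1 / 2 - b + n‖ ≤ n + 3 / 4 := up 0 (-1) 0 _ (by norm_num) (by push_cast; ring)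
  have a2 : ‖b + 1 / 2 + n‖ ≤ n + 3 / 4 := up 0 1 0 _ (by norm_num) (by push_cast; ring)
  have a3 : ‖1 / 2 - c + n‖ ≤ n + 3 / 4 := up 0 0 (-1) _ (by norm_num) (by push_cast; ring)
  have a4 : ‖c + 1 / 2 + n‖ ≤ n + 3 / 4 := up 0 0 1 _ (by norm_num) (by push_cast; ring)
  have a5 : ‖-2 * a + b + 1 / 2 + n‖ ≤ n + 3 / 4 :=
    up (-2) 1 0 _ (by norm_num) (by push_cast; ring)
  have a6 : ‖-2 * a + c + 1 / 2 + n‖ ≤ n + 3 / 4 :=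
    up (-2) 0 1 _ (by norm_num) (by push_cast; ring)
  have a7 : ‖-2 * a + 2 * b + c + 1 / 2 + n‖ ≤ n + 3 / 4 :=
    up (-2) 2 1 _ (by norm_num) (by push_cast; ring)
  have a8 : ‖-2 * a + b + 2 * c + 1 / 2 + n‖ ≤ n + 3 / 4 :=
    up (-2) 1 2 _ (by norm_num) (by push_cast; ring)
  have b1 : n + 3 / 4 ≤ ‖(1 + n : ℂ)‖ :=
    low 0 0 0 (n + 1) _ (by norm_num) le_rfl (by push_cast; ring)
  have b2 : n + 3 / 4 ≤ ‖1 - a + n‖ :=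
    low (-1) 0 0 (n + 1) _ (by norm_num) le_rfl (by push_cast; ring)
  have b3 : n + 3 / 4 ≤ ‖-a + b + 1 + n‖ :=
    low (-1) 1 0 (n + 1) _ (by norm_num) le_rfl (by push_cast; ring)
  have b4 : n + 3 / 4 ≤ ‖-a + c + 1 + n‖ :=
    low (-1) 0 1 (n + 1) _ (by norm_num) le_rfl (by push_cast; ring)
  have b5 : n + 3 / 4 ≤ ‖-2 * a + b + c + 1 + n‖ :=
    low (-2) 1 1 (n + 1) _ (by norm_num) le_rfl (by push_cast; ring)
  have b6 : n + 3 / 4 ≤ ‖-2 * a + b + c + 1 + 2 * n‖ :=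
    low (-2) 1 1 (2 * n + 1) _ (by norm_num) (by linarith) (by push_cast; ring)
  have b7 : n + 3 / 4 ≤ ‖-2 * a + b + c + 1 + (2 * n + 1)‖ :=
    low (-2) 1 1 (2 * n + 2) _ (by norm_num) (by linarith) (by push_cast; ring)
  have b8 : n + 3 / 4 ≤ ‖-a + b + c + 1 + n‖ :=
    low (-1) 1 1 (n + 1) _ (by norm_num) le_rfl (by push_cast; ring)
  rw [coreRatio, norm_div]
  refine div_le_of_le_mul₀ (norm_nonneg _) (by norm_num) ?_
  simp only [norm_mul, RCLike.norm_ofNat]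
  set x : ℝ := n + 3 / 4
  have hx : 0 ≤ x := by positivity
  calc _ ≤ x * x * x * x * x * x * x * x := by gcongr
    _ ≤ 1 / 2 * (16 * (x * x * x * x * x * (x * x) * x)) := by
      rw [show 1 / 2 * (16 * (x * x * x * x * x * (x * x) * x))
        = 8 * (x * x * x * x * x * x * x * x) by ring]
      exact le_mul_of_one_le_left (by positivity) (by norm_num)
    _ ≤ _ := by gcongr

lemma exists_norm_S_le : ∃ C : ℝ, ∀ a b c : ℂ, ‖a‖ ≤ 1 / 100 → ‖b‖ ≤ 1 / 100 → ‖c‖ ≤ 1 / 100 →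
    ∀ n : ℕ, ‖S a b c n‖ ≤ C * ((n : ℝ) + 1) ^ 4 * (1 / 2) ^ n := by
  obtain ⟨C, hC0, hC⟩ := exists_norm_P_le
  refine ⟨2 * C, fun a b c ha hb hc n => ?_⟩
  have hn : (0 : ℝ) ≤ n := by positivity
  have h1 := norm_core_le_pow (norm_coreRatio_le_half_of_norm_le ha hb hc) n
  have h2 := (hC a b c n (n + 1) (by linarith) (by linarith) (by linarith) (by linarith)
    (by rw [Complex.norm_natCast]; linarith)).1
  have h3 : 1 / 2 ≤ ‖-2 * a + b + c + 2 * n + 1‖ := by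
    have := le_norm_add_real (z := -2 * a + b + c + 2 * n + 1) (r := 2 * n + 1) (by positivity)
      (norm_linear_le ha hb hc (-2) 1 1 (by norm_num)) (by push_cast; ring)
    linarith
  rw [S_eq_core, norm_mul, norm_div]
  calc ‖core a b c n‖ * (‖P a b c n‖ / ‖-2 * a + b + c + 2 * n + 1‖)
      ≤ (1 / 2) ^ n * (C * (n + 1) ^ 4 / (1 / 2)) := by gcongr
    _ = _ := by ring

lemma analyticAt_rising {E : Type*} [NormedAddCommGroup E] [NormedSpace ℂ E] {g : E → ℂ} {p : E}
    (hg : AnalyticAt ℂ g p) (n : ℕ) : AnalyticAt ℂ (fun x => rising (g x) n) p := by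
  simp only [rising_eq_prod]
  exact Finset.analyticAt_fun_prod _ fun j _ => hg.add analyticAt_const

lemma analyticAt_S {E : Type*} [NormedAddCommGroup E] [NormedSpace ℂ E] {a b c : E → ℂ} {p : E}
    (ha : AnalyticAt ℂ a p) (hb : AnalyticAt ℂ b p) (hc : AnalyticAt ℂ c p)
    (h : Admissible (a p) (b p) (c p)) (n : ℕ) :
    AnalyticAt ℂ (fun x => S (a x) (b x) (c x) n) p := by
  have e : (-2 * a p + b p + c p + 2 * n + 1) ≠ 0 := by
    have := h.two_sub_ne (2 * n)
    push_cast at this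
    rwa [add_right_comm]
  have h1 : rising 1 n ≠ 0 := rising_ne_zero (fun m => by
    rw [add_comm]; exact Nat.cast_add_one_ne_zero m) n
  unfold S P
  refine AnalyticAt.fun_div (AnalyticAt.fun_mul (AnalyticAt.fun_mul analyticAt_const
    (by fun_prop)) ?_) ?_ ?_
  · refine AnalyticAt.fun_mul (AnalyticAt.fun_mul (AnalyticAt.fun_mul (AnalyticAt.fun_mul
      (AnalyticAt.fun_mul (AnalyticAt.fun_mul (AnalyticAt.fun_mul ?_ ?_) ?_) ?_) ?_) ?_) ?_) ?_ <;>
      exact analyticAt_rising (by fun_prop) _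
  · refine AnalyticAt.fun_mul (AnalyticAt.fun_mul (AnalyticAt.fun_mul (AnalyticAt.fun_mul
      (AnalyticAt.fun_mul (AnalyticAt.fun_mul (AnalyticAt.fun_mul ?_ ?_) ?_) ?_) ?_) ?_) ?_) ?_ <;>
      first | exact analyticAt_rising (by fun_prop) _ | fun_prop
  · exact mul_ne_zero (mul_ne_zero (mul_ne_zero (mul_ne_zero (mul_ne_zero (mul_ne_zero
      (mul_ne_zero h1 (rising_ne_zero h.sub_ne n)) e) (rising_ne_zero h.sub_b_ne n))
      (rising_ne_zero h.sub_c_ne n)) (rising_ne_zero h.two_sub_ne n))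
      (rising_ne_zero h.two_sub_ne _)) (rising_ne_zero h.sub_bc_ne n)

/-- Taylor coefficients along a rational line give an identity of `CoeffIdentity` type. -/
theorem coeffIdentity_line (α β γ : ℚ) (N : ℕ) :
    CoeffIdentity N (fun n => taylor N fun t => S (α * t) (β * t) (γ * t) n)
      (taylor N fun t => value (α * t) (β * t) (γ * t)) := by
  have h0 : Admissible 0 0 0 :=
    admissible_of_norm_le (by norm_num) (by norm_num) (by norm_num)
  refine ⟨taylor_line_mem_V (fun n => ?_) α β γ N, ?_⟩
  · exact analyticAt_S (p := (0 : ℂ × ℂ × ℂ)) analyticAt_fst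
      (analyticAt_fst.comp analyticAt_snd) (analyticAt_snd.comp analyticAt_snd) h0 n
  obtain ⟨C, hC⟩ := exists_norm_S_le
  -- Chosen so that the piece of the line with `‖t‖ < r` stays in the polydisc of radius 1/100; the
  -- `+ 1` covers the zero direction.
  set r : ℝ := 1 / 100 / (‖(α : ℂ)‖ + ‖(β : ℂ)‖ + ‖(γ : ℂ)‖ + 1) with hr
  have hr0 : 0 < r := by positivity
  have hq : ∀ q : ℂ, ‖q‖ ≤ ‖(α : ℂ)‖ + ‖(β : ℂ)‖ + ‖(γ : ℂ)‖ + 1 →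
      ∀ t ∈ Metric.ball (0 : ℂ) r, ‖q * t‖ ≤ 1 / 100 := by
    intro q hq t ht
    rw [mem_ball_zero_iff] at ht
    rw [norm_mul]
    calc ‖q‖ * ‖t‖ ≤ (‖(α : ℂ)‖ + ‖(β : ℂ)‖ + ‖(γ : ℂ)‖ + 1) * r := by gcongr
      _ = 1 / 100 := by rw [hr]; field_simp
  have ha := hq α (by linarith [norm_nonneg (β : ℂ), norm_nonneg (γ : ℂ)])
  have hb := hq β (by linarith [norm_nonneg (α : ℂ), norm_nonneg (γ : ℂ)])
  have hc := hq γ (by linarith [norm_nonneg (α : ℂ), norm_nonneg (β : ℂ)])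
  refine hasSum_taylor hr0 (summable_pow_mul_half C 4) (fun n t ht => ?_)
    (fun n t ht => hC _ _ _ (ha t ht) (hb t ht) (hc t ht) n)
    (fun t ht => hasSum_S (admissible_of_norm_le (ha t ht) (hb t ht) (hc t ht))) N
  exact (analyticAt_S (by fun_prop) (by fun_prop) (by fun_prop) (admissible_of_norm_le (ha t ht)
    (hb t ht) (hc t ht)) n).differentiableAt.differentiableWithinAt

lemma CoeffIdentity.add {N : ℕ} {f g : ℕ → ℂ} {v w : ℂ} (hf : CoeffIdentity N f v)
    (hg : CoeffIdentity N g w) : CoeffIdentity N (fun n => f n + g n) (v + w) :=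
  ⟨add_mem hf.1 hg.1, hf.2.add hg.2⟩

lemma CoeffIdentity.rat_mul {N : ℕ} {f : ℕ → ℂ} {v : ℂ} (q : ℚ) (hf : CoeffIdentity N f v) :
    CoeffIdentity N (fun n => (q : ℂ) * f n) (q * v) := by
  refine ⟨?_, hf.2.mul_left _⟩
  have := Submodule.smul_mem (V N) q hf.1
  convert this using 1
  funext n
  simp [Rat.smul_def]

/-! ### Taylor coefficients of exponentials of power series -/

/-- Near the origin, `f t = f 0 * exp (∑ q m * t ^ m)`. -/
def ExpSeries (f : ℂ → ℂ) (q : ℕ → ℂ) : Prop :=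
  ∃ r > 0, ∃ g : ℂ → ℂ, ∀ t : ℂ, ‖t‖ < r →
    f t = f 0 * Complex.exp (g t) ∧ HasSum (fun m => q m * t ^ m) (g t)

namespace ExpSeries

variable {f f₁ f₂ : ℂ → ℂ} {q q₁ q₂ : ℕ → ℂ}

lemma mul (h₁ : ExpSeries f₁ q₁) (h₂ : ExpSeries f₂ q₂) :
    ExpSeries (fun t => f₁ t * f₂ t) (fun m => q₁ m + q₂ m) := by
  obtain ⟨r₁, hr₁, g₁, h₁⟩ := h₁
  obtain ⟨r₂, hr₂, g₂, h₂⟩ := h₂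
  refine ⟨min r₁ r₂, lt_min hr₁ hr₂, fun t => g₁ t + g₂ t, fun t ht => ?_⟩
  obtain ⟨e₁, s₁⟩ := h₁ t (ht.trans_le (min_le_left _ _))
  obtain ⟨e₂, s₂⟩ := h₂ t (ht.trans_le (min_le_right _ _))
  refine ⟨?_, ?_⟩
  · beta_reduce
    rw [e₁, e₂, Complex.exp_add]; ring
  · simpa [add_mul] using s₁.add s₂

lemma inv (h : ExpSeries f q) : ExpSeries (fun t => (f t)⁻¹) (fun m => -q m) := by
  obtain ⟨r, hr, g, h⟩ := h
  refine ⟨r, hr, fun t => -g t, fun t ht => ?_⟩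
  obtain ⟨e, s⟩ := h t ht
  refine ⟨?_, by simpa using s.neg⟩
  beta_reduce
  rw [e, mul_inv, Complex.exp_neg]

lemma div (h₁ : ExpSeries f₁ q₁) (h₂ : ExpSeries f₂ q₂) :
    ExpSeries (fun t => f₁ t / f₂ t) (fun m => q₁ m - q₂ m) := by
  simpa [div_eq_mul_inv, sub_eq_add_neg] using h₁.mul h₂.inv

lemma const (c : ℂ) : ExpSeries (fun _ => c) (fun _ => 0) :=
  ⟨1, one_pos, fun _ => 0, fun t _ => ⟨by simp, by simp⟩⟩

lemma scale (h : ExpSeries f q) (y : ℂ) :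
    ExpSeries (fun t => f (y * t)) (fun m => y ^ m * q m) := by
  obtain ⟨r, hr, g, h⟩ := h
  refine ⟨r / (‖y‖ + 1), by positivity, fun t => g (y * t), fun t ht => ?_⟩
  have ht' : ‖y * t‖ < r := by
    rw [norm_mul]
    rw [lt_div_iff₀ (by positivity)] at ht
    nlinarith [norm_nonneg t, norm_nonneg y]
  obtain ⟨e, s⟩ := h _ ht'
  refine ⟨by beta_reduce; rw [e, mul_zero], ?_⟩
  refine s.congr_fun ?_
  intro m
  rw [mul_pow]; ring

lemma congr (h : ExpSeries f₁ q₁) (hf : ∀ t, f₂ t = f₁ t) (hq : ∀ m, q₂ m = q₁ m) :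
    ExpSeries f₂ q₂ := by
  rwa [show f₂ = f₁ from funext hf, show q₂ = q₁ from funext hq]

lemma congr_nhds (h : ExpSeries f₁ q) (hf : f₂ =ᶠ[𝓝 0] f₁) : ExpSeries f₂ q := by
  obtain ⟨r, hr, g, h⟩ := h
  obtain ⟨s, hs, hs'⟩ := Metric.eventually_nhds_iff_ball.1 hf
  refine ⟨min r s, lt_min hr hs, g, fun t ht => ?_⟩
  obtain ⟨e, h2⟩ := h t (ht.trans_le (min_le_left _ _))
  refine ⟨?_, h2⟩
  rw [hs' t (by simpa using ht.trans_le (min_le_right _ _)), hs' 0 (by simpa using hs), e]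

/-- The exponent of `1 + t`. -/
def logCoeff (m : ℕ) : ℂ := (-1) ^ (m + 1) / m

/-- Here `x + y * t` is `x (1 + (y / x) t)`, and the exponent is that of the logarithm series.
`logCoeff 0` is 0 because it divides by zero, as it should be. -/
lemma linear {x : ℂ} (hx : x ≠ 0) (y : ℂ) :
    ExpSeries (fun t => x + y * t) (fun m => logCoeff m * (y ^ m * (1 / x ^ m))) := by
  have h1 : ExpSeries (fun t => 1 + t) logCoeff := by
    refine ⟨1, one_pos, fun t => Complex.log (1 + t), fun t ht => ⟨?_, ?_⟩⟩
    · beta_reduce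
      rw [add_zero, one_mul, Complex.exp_log]
      intro h
      rw [eq_neg_of_add_eq_zero_right h] at ht
      simp at ht
    · refine (Complex.hasSum_taylorSeries_log ht).congr_fun ?_
      intro m
      rw [logCoeff]; ring
  refine ((const x).mul (h1.scale (y / x))).congr (fun t => ?_) (fun m => ?_)
  · field_simp
  · rw [div_pow]; ring

lemma rising {x : ℂ} (hx : ∀ j : ℕ, x + j ≠ 0) (y : ℂ) (n : ℕ) :
    ExpSeries (fun t => GourevichExt.rising (x + y * t) n)
      (fun m => logCoeff m * (y ^ m * ∑ j ∈ Finset.range n, 1 / (x + j) ^ m)) := by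
  induction n with
  | zero => simpa [rising_zero] using const 1
  | succ n ih =>
    refine (ih.mul (linear (hx n) y)).congr (fun t => ?_) (fun m => ?_)
    · rw [rising_succ]; ring
    · rw [Finset.sum_range_succ]; ring

end ExpSeries

/-! ### Rules for Taylor coefficients and the recursion for exponentials -/

lemma taylor_congr {f g : ℂ → ℂ} (h : f =ᶠ[𝓝 0] g) (N : ℕ) : taylor N f = taylor N g := by
  rw [taylor, taylor, h.iteratedDeriv_eq]

lemma taylor_zero (f : ℂ → ℂ) : taylor 0 f = f 0 := by simp [taylor]

lemma taylor_succ (N : ℕ) (f : ℂ → ℂ) : (N + 1 : ℂ) * taylor (N + 1) f = taylor N (deriv f) := by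
  have h1 : (N ! : ℂ) ≠ 0 := by exact_mod_cast N.factorial_ne_zero
  have h2 : (N + 1 : ℂ) ≠ 0 := Nat.cast_add_one_ne_zero N
  rw [taylor, taylor, iteratedDeriv_succ', Nat.factorial_succ]
  push_cast
  field_simp

lemma taylor_mul {f g : ℂ → ℂ} (hf : AnalyticAt ℂ f 0) (hg : AnalyticAt ℂ g 0) (N : ℕ) :
    taylor N (fun t => f t * g t)
      = ∑ k ∈ Finset.range (N + 1), taylor k f * taylor (N - k) g := by
  rw [taylor, iteratedDeriv_fun_mul hf.contDiffAt hg.contDiffAt, Finset.sum_div]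
  refine Finset.sum_congr rfl fun k hk => ?_
  have hkN : k ≤ N := Nat.lt_succ_iff.1 (Finset.mem_range.1 hk)
  have h1 : (N ! : ℂ) ≠ 0 := by exact_mod_cast N.factorial_ne_zero
  have h2 : (k ! : ℂ) ≠ 0 := by exact_mod_cast k.factorial_ne_zero
  have h3 : ((N - k) ! : ℂ) ≠ 0 := by exact_mod_cast (N - k).factorial_ne_zero
  rw [taylor, taylor, Nat.cast_choose ℂ hkN]
  field_simp

lemma taylor_monomial (c : ℂ) (m N : ℕ) :
    taylor N (fun t => c * t ^ m) = if m = N then c else 0 := by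
  have h1 : (N ! : ℂ) ≠ 0 := by exact_mod_cast N.factorial_ne_zero
  rw [taylor, iteratedDeriv_const_mul_field, iteratedDeriv_fun_pow_zero]
  split_ifs with h2 h3 h3
  · subst h3; field_simp
  · exact absurd h2.symm h3
  · exact absurd h3.symm h2
  · simp

lemma taylor_of_hasSum {g : ℂ → ℂ} {q : ℕ → ℂ} {r : ℝ} (hr : 0 < r)
    (h : ∀ t : ℂ, ‖t‖ < r → HasSum (fun m => q m * t ^ m) (g t)) :
    AnalyticAt ℂ g 0 ∧ ∀ N, taylor N g = q N := by
  have hs : Summable fun m => ‖q m‖ * (r / 2) ^ m := by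
    have h1 := (h ((r / 2 : ℝ) : ℂ) (by
      rw [Complex.norm_real, Real.norm_of_nonneg (by positivity)]; linarith)).summable.norm
    refine h1.congr fun m => ?_
    rw [norm_mul, norm_pow, Complex.norm_real, Real.norm_of_nonneg (by positivity)]
  have hb : ∀ m, ∀ t ∈ Metric.ball (0 : ℂ) (r / 2), ‖q m * t ^ m‖ ≤ ‖q m‖ * (r / 2) ^ m := by
    intro m t ht
    rw [mem_ball_zero_iff] at ht
    rw [norm_mul, norm_pow]
    gcongr
  have hball : ∀ t ∈ Metric.ball (0 : ℂ) (r / 2), HasSum (fun m => q m * t ^ m) (g t) := by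
    intro t ht
    rw [mem_ball_zero_iff] at ht
    exact h t (by linarith)
  have hd : ∀ m, DifferentiableOn ℂ (fun t : ℂ => q m * t ^ m) (Metric.ball 0 (r / 2)) :=
    fun m => by fun_prop
  constructor
  · have h2 := Complex.differentiableOn_tsum_of_summable_norm hs hd Metric.isOpen_ball hb
    have h3 : DifferentiableOn ℂ g (Metric.ball 0 (r / 2)) :=
      h2.congr fun t ht => (hball t ht).tsum_eq.symm
    exact h3.analyticAt (Metric.ball_mem_nhds _ (by positivity))
  · intro N
    have h2 := hasSum_taylor (half_pos hr) hs hd hb hball N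
    simp only [taylor_monomial] at h2
    exact h2.unique (hasSum_ite_eq N (q N) |>.congr_fun (by intro b; split_ifs with h <;> simp [h]))

namespace ExpSeries

variable {f : ℂ → ℂ} {q : ℕ → ℂ}

lemma analyticAt (h : ExpSeries f q) : AnalyticAt ℂ f 0 := by
  obtain ⟨r, hr, g, h⟩ := h
  have hg := (taylor_of_hasSum hr fun t ht => (h t ht).2).1
  have h1 : AnalyticAt ℂ (fun t => f 0 * Complex.exp (g t)) 0 := by fun_prop
  refine h1.congr ?_
  filter_upwards [Metric.ball_mem_nhds (0 : ℂ) hr] with t ht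
  exact (h t (by simpa using ht)).1.symm

/-- Compare coefficients in `f' = g' f`, where `g` is the sum of the exponent series. -/
lemma taylor_succ (h : ExpSeries f q) (N : ℕ) :
    (N + 1 : ℂ) * taylor (N + 1) f
      = ∑ k ∈ Finset.range (N + 1), (k + 1) * q (k + 1) * taylor (N - k) f := by
  have hf := h.analyticAt
  obtain ⟨r, hr, g, h⟩ := h
  obtain ⟨hg, hq⟩ := taylor_of_hasSum hr fun t ht => (h t ht).2
  have h1 : f =ᶠ[𝓝 0] fun t => f 0 * Complex.exp (g t) := by
    filter_upwards [Metric.ball_mem_nhds (0 : ℂ) hr] with t ht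
    exact (h t (by simpa using ht)).1
  have h2 : deriv f =ᶠ[𝓝 0] fun t => deriv g t * f t := by
    filter_upwards [h1.deriv, h1, hg.eventually_analyticAt] with t ht ht' hgt
    rw [ht, ht', ((hgt.differentiableAt.hasDerivAt.cexp).const_mul (f 0)).deriv]
    ring
  rw [GourevichExt.taylor_succ, taylor_congr h2, taylor_mul hg.deriv hf]
  refine Finset.sum_congr rfl fun k _ => ?_
  rw [← GourevichExt.taylor_succ, hq]

/-- The Taylor coefficients of the exponential of a power series up to order five. -/
lemma taylor_eq (h : ExpSeries f q) :
    taylor 0 f = f 0 ∧ taylor 1 f = f 0 * q 1 ∧ taylor 2 f = f 0 * (q 2 + q 1 ^ 2 / 2) ∧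
    taylor 3 f = f 0 * (q 3 + q 1 * q 2 + q 1 ^ 3 / 6) ∧
    taylor 4 f = f 0 * (q 4 + q 1 * q 3 + q 2 ^ 2 / 2 + q 1 ^ 2 * q 2 / 2 + q 1 ^ 4 / 24) ∧
    taylor 5 f = f 0 * (q 5 + q 1 * q 4 + q 2 * q 3 + q 1 ^ 2 * q 3 / 2 + q 1 * q 2 ^ 2 / 2
      + q 1 ^ 3 * q 2 / 6 + q 1 ^ 5 / 120) := by
  have t0 : taylor 0 f = f 0 := GourevichExt.taylor_zero f
  have t1 := h.taylor_succ 0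
  have t2 := h.taylor_succ 1
  have t3 := h.taylor_succ 2
  have t4 := h.taylor_succ 3
  have t5 := h.taylor_succ 4
  simp only [Finset.sum_range_succ, Finset.sum_range_zero] at t1 t2 t3 t4 t5
  norm_num at t1 t2 t3 t4 t5
  rw [t0] at t1 t2 t3 t4 t5
  rw [t1] at t2 t3 t4 t5
  have e2 : taylor 2 f = f 0 * (q 2 + q 1 ^ 2 / 2) := by linear_combination t2 / 2
  rw [e2] at t3 t4 t5
  have e3 : taylor 3 f = f 0 * (q 3 + q 1 * q 2 + q 1 ^ 3 / 6) := by linear_combination t3 / 3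
  rw [e3] at t4 t5
  have e4 : taylor 4 f = f 0 * (q 4 + q 1 * q 3 + q 2 ^ 2 / 2 + q 1 ^ 2 * q 2 / 2
      + q 1 ^ 4 / 24) := by linear_combination t4 / 4
  rw [e4] at t5
  refine ⟨t0, by rw [t1]; ring, e2, e3, e4, ?_⟩
  linear_combination t5 / 5

end ExpSeries

/-! ### The Gamma function -/

/-- The exponent of `Γ (1 + t)`. -/
def gammaCoeff : ℕ → ℂ
  | 0 => 0
  | 1 => -Real.eulerMascheroniConstant
  | m + 2 => (-1) ^ m * riemannZeta (m + 2) / (m + 2)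

lemma hasSum_zeta (m : ℕ) :
    HasSum (fun j : ℕ => 1 / ((j : ℂ) + 1) ^ (m + 2)) (riemannZeta (m + 2)) := by
  have h1 : Summable fun j : ℕ => 1 / ((j : ℂ) + 1) ^ (m + 2) := by
    refine Summable.of_norm ?_
    have h := (summable_nat_add_iff 1).2
      (Real.summable_one_div_nat_pow.2 (by omega : 1 < m + 2))
    refine h.congr fun j => ?_
    have hj : ‖((j : ℂ) + 1)‖ = j + 1 := by exact_mod_cast Complex.norm_natCast (j + 1)
    rw [norm_div, norm_pow, hj, norm_one]
    push_cast
    rfl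
  have h2 : riemannZeta (m + 2) = ∑' j : ℕ, 1 / ((j : ℂ) + 1) ^ (m + 2) := by
    rw [zeta_eq_tsum_one_div_nat_add_one_cpow (by simp; linarith [(Nat.cast_nonneg m : (0 : ℝ) ≤ m)])]
    refine tsum_congr fun j => ?_
    rw [← Complex.cpow_natCast]
    push_cast
    rfl
  rw [h2]
  exact h1.hasSum

lemma hasSum_sub_log {x : ℂ} (hx : ‖x‖ < 1) (j : ℕ) :
    HasSum (fun m : ℕ => (-1) ^ m * x ^ (m + 2) / (m + 2) * (1 / ((j : ℂ) + 1) ^ (m + 2)))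
      (x / (j + 1) - Complex.log (1 + x / (j + 1))) := by
  have hj : ((j : ℂ) + 1) ≠ 0 := Nat.cast_add_one_ne_zero j
  have hj' : (1 : ℝ) ≤ ‖(j + 1 : ℂ)‖ := by
    have : ‖(j + 1 : ℂ)‖ = j + 1 := by exact_mod_cast Complex.norm_natCast (j + 1)
    rw [this]
    linarith [(Nat.cast_nonneg j : (0 : ℝ) ≤ j)]
  have hz : ‖x / (j + 1)‖ < 1 := by
    rw [norm_div]
    exact (div_le_self (norm_nonneg _) hj').trans_lt hx
  have h1 := (Complex.hasSum_taylorSeries_log hz).neg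
  -- Dropping the terms of index 0 (which is 0) and 1 (which is linear in `x`) accounts for the
  -- summand `x / (j + 1)`.
  rw [← hasSum_nat_add_iff' 2] at h1
  simp only [Finset.sum_range_succ, Finset.sum_range_zero] at h1
  norm_num at h1
  rw [show x / (j + 1) - Complex.log (1 + x / (j + 1))
    = -Complex.log (1 + x / (j + 1)) + x / (j + 1) by ring]
  refine h1.congr_fun fun m => ?_
  rw [div_pow]
  ring

/-- Dominated by the product of `1 / (j + 1)²` and `‖x‖ ^ m`. This justifies exchanging the sum over
`j` with the expansion of the logarithm. -/
lemma summable_double {x : ℂ} (hx : ‖x‖ < 1) :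
    Summable fun p : ℕ × ℕ =>
      (-1) ^ p.2 * x ^ (p.2 + 2) / (p.2 + 2) * (1 / ((p.1 : ℂ) + 1) ^ (p.2 + 2)) := by
  have h1 : Summable fun j : ℕ => 1 / ((j : ℝ) + 1) ^ 2 := by
    have h := (summable_nat_add_iff 1).2 (Real.summable_one_div_nat_pow.2 (by norm_num : 1 < 2))
    simpa using h
  have h2 : Summable fun m : ℕ => ‖x‖ ^ m := summable_geometric_of_lt_one (norm_nonneg _) hx
  refine Summable.of_norm_bounded
    (h1.mul_of_nonneg h2 (fun j => by positivity) (fun m => by positivity)) ?_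
  rintro ⟨j, m⟩
  have hj : ‖((j : ℂ) + 1)‖ = j + 1 := by exact_mod_cast Complex.norm_natCast (j + 1)
  have hm : ‖((m : ℂ) + 2)‖ = m + 2 := by exact_mod_cast Complex.norm_natCast (m + 2)
  have hj0 : (0 : ℝ) ≤ j := by positivity
  have hm0 : (0 : ℝ) ≤ m := by positivity
  simp only [norm_mul, norm_div, norm_pow, norm_neg, norm_one, one_pow, hj, hm, one_mul]
  rw [mul_comm]
  gcongr ?_ * ?_
  · gcongr
    · linarith
    · omega
  · calc ‖x‖ ^ (m + 2) / (m + 2) ≤ ‖x‖ ^ (m + 2) := div_le_self (by positivity) (by linarith)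
      _ ≤ ‖x‖ ^ m := pow_le_pow_of_le_one (norm_nonneg _) hx.le (by omega)

lemma hasSum_logGamma_part {x : ℂ} (hx : ‖x‖ < 1) : ∃ L : ℂ,
    HasSum (fun j : ℕ => x / (j + 1) - Complex.log (1 + x / (j + 1))) L ∧
    HasSum (fun m : ℕ => (-1) ^ m * riemannZeta (m + 2) / (m + 2) * x ^ (m + 2)) L := by
  have h := (summable_double hx).hasSum
  refine ⟨_, h.prod_fiberwise fun j => hasSum_sub_log hx j, ?_⟩
  have h' := (Equiv.prodComm ℕ ℕ).hasSum_iff.2 h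
  refine h'.prod_fiberwise fun m => ?_
  have := (hasSum_zeta m).mul_left ((-1) ^ m * x ^ (m + 2) / (m + 2))
  rw [show (-1) ^ m * riemannZeta (m + 2) / (m + 2) * x ^ (m + 2)
    = (-1) ^ m * x ^ (m + 2) / (m + 2) * riemannZeta (m + 2) by ring]
  exact this

lemma hasSum_gammaCoeff {x : ℂ} (hx : ‖x‖ < 1) : ∃ L : ℂ,
    HasSum (fun j : ℕ => x / (j + 1) - Complex.log (1 + x / (j + 1))) L ∧
    HasSum (fun m : ℕ => gammaCoeff m * x ^ m) (-Real.eulerMascheroniConstant * x + L) := by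
  obtain ⟨L, h1, h2⟩ := hasSum_logGamma_part hx
  refine ⟨L, h1, ?_⟩
  rw [← hasSum_nat_add_iff' 2]
  simp only [Finset.sum_range_succ, Finset.sum_range_zero, gammaCoeff]
  simpa using h2

lemma one_add_div_ne_zero {x : ℂ} (hx : ‖x‖ < 1) (j : ℕ) : 1 + x / (j + 1) ≠ 0 := by
  intro h
  have h0 : ((j : ℂ) + 1) ≠ 0 := Nat.cast_add_one_ne_zero j
  have h1 : x = -(j + 1 : ℂ) := by
    field_simp at h
    linear_combination h
  have h2 : ‖x‖ = j + 1 := by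
    rw [h1, norm_neg]; exact_mod_cast Complex.norm_natCast (j + 1)
  rw [h2] at hx
  linarith [(Nat.cast_nonneg j : (0 : ℝ) ≤ j)]

/-- The finite form of Weierstrass's product for `1 / Γ(1 + x)`: adding and subtracting `x` times
the harmonic number makes the sum of logarithms converge, and harmonic number minus logarithm tends
to Euler's constant. -/
lemma risingQuot_one_add {x : ℂ} (hx : ‖x‖ < 1) {n : ℕ} (hn : n ≠ 0) :
    risingQuot (1 + x) n = Complex.exp (x * ((harmonic n - Real.log n : ℝ) : ℂ)
      - ∑ j ∈ Finset.range n, (x / (j + 1) - Complex.log (1 + x / (j + 1)))) := by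
  have hn0 : (n : ℂ) ≠ 0 := by exact_mod_cast hn
  have hf : (n ! : ℂ) ≠ 0 := by exact_mod_cast n.factorial_ne_zero
  have h1 : rising (1 + x) n = (n ! : ℂ) * ∏ j ∈ Finset.range n, (1 + x / (j + 1)) := by
    rw [rising_eq_prod, ← Finset.prod_range_add_one_eq_factorial]
    push_cast
    rw [← Finset.prod_mul_distrib]
    refine Finset.prod_congr rfl fun j _ => ?_
    have : ((j : ℂ) + 1) ≠ 0 := Nat.cast_add_one_ne_zero j
    field_simp
    ring
  have h2 : ∏ j ∈ Finset.range n, (1 + x / (j + 1))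
      = Complex.exp (∑ j ∈ Finset.range n, Complex.log (1 + x / (j + 1))) := by
    rw [Complex.exp_sum]
    exact Finset.prod_congr rfl fun j _ => (Complex.exp_log (one_add_div_ne_zero hx j)).symm
  have h3 : (n : ℂ) ^ (1 + x) = n * Complex.exp (x * Real.log n) := by
    rw [Complex.cpow_add _ _ hn0, Complex.cpow_one, Complex.cpow_def_of_ne_zero hn0,
      ← Complex.natCast_log, mul_comm x]
  have h4 : ((harmonic n : ℝ) : ℂ) = ∑ j ∈ Finset.range n, 1 / ((j : ℂ) + 1) := by
    rw [harmonic]; push_cast; simp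
  rw [risingQuot, h1, h2, h3, Complex.ofReal_sub, h4, Finset.sum_sub_distrib, mul_sub,
    Finset.mul_sum]
  have h5 : ∀ a b c : ℂ, Complex.exp (a - b - (a - c)) = Complex.exp c / Complex.exp b := by
    intro a b c; rw [← Complex.exp_sub]; congr 1; ring
  simp only [mul_one_div]
  rw [h5]
  have h6 := Complex.exp_ne_zero (x * Real.log n)
  field_simp

lemma Gamma_one_add {x L : ℂ} (hx : ‖x‖ < 1)
    (hL : HasSum (fun j : ℕ => x / (j + 1) - Complex.log (1 + x / (j + 1))) L) :
    Complex.Gamma (1 + x) = Complex.exp (-Real.eulerMascheroniConstant * x + L) := by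
  have h1 : Tendsto (fun n : ℕ => ((harmonic n - Real.log n : ℝ) : ℂ)) atTop
      (𝓝 (Real.eulerMascheroniConstant : ℂ)) :=
    (Complex.continuous_ofReal.tendsto _).comp Real.tendsto_harmonic_sub_log
  have h2 := (Complex.continuous_exp.tendsto _).comp ((h1.const_mul x).sub hL.tendsto_sum_nat)
  have h3 : (Complex.Gamma (1 + x))⁻¹
      = Complex.exp (x * Real.eulerMascheroniConstant - L) := by
    refine tendsto_nhds_unique (tendsto_risingQuot (1 + x)) (h2.congr' ?_)
    filter_upwards [eventually_ge_atTop 1] with n hn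
    exact (risingQuot_one_add hx (by omega)).symm
  rw [← inv_inv (Complex.Gamma (1 + x)), h3, ← Complex.exp_neg]
  congr 1
  ring

lemma expSeries_Gamma_one : ExpSeries (fun t => Complex.Gamma (1 + t)) gammaCoeff := by
  choose! L hL using fun (x : ℂ) (hx : ‖x‖ < 1) => hasSum_gammaCoeff hx
  refine ⟨1, one_pos, fun t => -Real.eulerMascheroniConstant * t + L t, fun t ht => ⟨?_, (hL t ht).2⟩⟩
  beta_reduce
  rw [add_zero, Complex.Gamma_one, one_mul]
  exact Gamma_one_add ht (hL t ht).1

lemma expSeries_two_cpow (c d : ℂ) :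
    ExpSeries (fun t => (2 : ℂ) ^ (c * t + d)) (fun m => if m = 1 then c * (Real.log 2 : ℂ) else 0) := by
  refine ⟨1, one_pos, fun t => c * Real.log 2 * t, fun t _ => ⟨?_, ?_⟩⟩
  · beta_reduce
    rw [mul_zero, zero_add, Complex.cpow_add _ _ two_ne_zero, mul_comm,
      Complex.cpow_def_of_ne_zero two_ne_zero (c * t), Complex.ofReal_log zero_le_two]
    push_cast
    congr 2
    ring
  · have h := hasSum_ite_eq 1 (c * Real.log 2 * t)
    refine h.congr_fun fun m => ?_
    rcases eq_or_ne m 1 with rfl | hm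
    · simp
    · simp [hm]

/-- The exponent of `Γ (1 / 2 + t)`. -/
def gammaHalfCoeff (m : ℕ) : ℂ :=
  (2 ^ m - 1) * gammaCoeff m + if m = 1 then -2 * (Real.log 2 : ℂ) else 0

/-- Legendre duplication writes `Γ(1/2 + t)` as `Γ(1 + 2t) 2^(-2t) √π / Γ(1 + t)`. The first and
last factors give `2 ^ m - 1`, the power of 2 gives the correction at `m = 1`. -/
lemma expSeries_Gamma_half :
    ExpSeries (fun t => Complex.Gamma (1 / 2 + t)) gammaHalfCoeff := by
  have h1 := ((expSeries_Gamma_one.scale 2).mul (expSeries_two_cpow (-2) 0)).mul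
    (ExpSeries.const (√Real.pi))
  have h2 := h1.div expSeries_Gamma_one
  refine (h2.congr (f₂ := fun t => Complex.Gamma (1 + 2 * t) * (2 : ℂ) ^ (-2 * t + 0)
    * (√Real.pi : ℂ) / Complex.Gamma (1 + t)) (q₂ := gammaHalfCoeff) (fun t => rfl)
    (fun m => ?_)).congr_nhds ?_
  · rw [gammaHalfCoeff]
    split_ifs <;> ring
  · filter_upwards [Metric.ball_mem_nhds (0 : ℂ) one_pos] with t ht
    rw [mem_ball_zero_iff] at ht
    have h3 : Complex.Gamma (1 + t) ≠ 0 := by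
      refine Complex.Gamma_ne_zero_of_re_pos ?_
      have := (abs_le.1 (Complex.abs_re_le_norm t)).1
      simp
      linarith
    have h4 := Complex.Gamma_mul_Gamma_add_half (1 / 2 + t)
    rw [eq_div_iff h3]
    rw [show 1 / 2 + t + 1 / 2 = 1 + t by ring, show 2 * (1 / 2 + t) = 1 + 2 * t by ring,
      show 1 - (1 + 2 * t) = -2 * t + 0 by ring] at h4
    exact h4

/-! ### Expansion of the summand and of the sum along a line -/

/-- The Taylor coefficients of `exp (∑ q m * t ^ m)` up to order five. -/
def bell (q : ℕ → ℂ) : ℕ → ℂ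
  | 0 => 1
  | 1 => q 1
  | 2 => q 2 + q 1 ^ 2 / 2
  | 3 => q 3 + q 1 * q 2 + q 1 ^ 3 / 6
  | 4 => q 4 + q 1 * q 3 + q 2 ^ 2 / 2 + q 1 ^ 2 * q 2 / 2 + q 1 ^ 4 / 24
  | 5 => q 5 + q 1 * q 4 + q 2 * q 3 + q 1 ^ 2 * q 3 / 2 + q 1 * q 2 ^ 2 / 2
      + q 1 ^ 3 * q 2 / 6 + q 1 ^ 5 / 120
  | _ => 0

lemma ExpSeries.taylor_eq_bell {f : ℂ → ℂ} {q : ℕ → ℂ} (h : ExpSeries f q) {N : ℕ} (hN : N ≤ 5) :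
    taylor N f = f 0 * bell q N := by
  obtain ⟨h0, h1, h2, h3, h4, h5⟩ := h.taylor_eq
  interval_cases N
  · rw [h0, bell, mul_one]
  · exact h1
  · exact h2
  · exact h3
  · exact h4
  · exact h5

lemma H_succ (s n : ℕ) : H s (n + 1) = H s n + 1 / ((n : ℂ) + 1) ^ s := by
  rw [H, H, Finset.sum_Icc_succ_top (by omega)]
  push_cast
  rfl

lemma sum_one_add (m n : ℕ) : ∑ j ∈ Finset.range n, 1 / (1 + (j : ℂ)) ^ m = H m n := by
  induction n with
  | zero => simp [H]
  | succ n ih => rw [Finset.sum_range_succ, ih, H_succ, add_comm (1 : ℂ)]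

/-- The sum is `2 ^ m` times the sum over odd integers below `2n`, that is, over all integers up to
`2n` minus the even ones. -/
lemma sum_half_add (m n : ℕ) :
    ∑ j ∈ Finset.range n, 1 / (1 / 2 + (j : ℂ)) ^ m = 2 ^ m * H m (2 * n) - H m n := by
  induction n with
  | zero => simp [H]
  | succ n ih =>
    have h1 : ((n : ℂ) + 1) ≠ 0 := Nat.cast_add_one_ne_zero n
    have h2 : (2 * (n : ℂ) + 1) ≠ 0 := by exact_mod_cast Nat.succ_ne_zero (2 * n)
    rw [Finset.sum_range_succ, ih, show 2 * (n + 1) = 2 * n + 1 + 1 by ring, H_succ, H_succ, H_succ]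
    push_cast
    rw [show (1 / 2 + n : ℂ) = (2 * n + 1) / 2 by ring,
      show (2 * n + 1 + 1 : ℂ) = 2 * (n + 1) by ring, div_pow, mul_pow]
    field_simp
    ring

namespace ExpSeries

lemma rising_one_add (n : ℕ) {l : ℂ → ℂ} (y : ℂ) (hl : ∀ t, l t = 1 + y * t) :
    ExpSeries (fun t => GourevichExt.rising (l t) n) (fun m => logCoeff m * (y ^ m * H m n)) := by
  have h := rising (x := 1)
    (fun j => by rw [add_comm]; exact Nat.cast_add_one_ne_zero j) y n
  simp only [sum_one_add] at h
  exact h.congr (fun t => by rw [hl]) fun m => rfl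

lemma rising_half_add (n : ℕ) {l : ℂ → ℂ} (y : ℂ) (hl : ∀ t, l t = 1 / 2 + y * t) :
    ExpSeries (fun t => GourevichExt.rising (l t) n)
      (fun m => logCoeff m * (y ^ m * (2 ^ m * H m (2 * n) - H m n))) := by
  have h := rising (x := 1 / 2) (fun j => by
    have : (2 * (j : ℂ) + 1) ≠ 0 := by exact_mod_cast Nat.succ_ne_zero (2 * j)
    intro h
    apply this
    linear_combination 2 * h) y n
  simp only [sum_half_add] at h
  exact h.congr (fun t => by rw [hl]) fun m => rfl

lemma Gamma_one_add {l : ℂ → ℂ} (y : ℂ) (hl : ∀ t, l t = 1 + y * t) :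
    ExpSeries (fun t => Complex.Gamma (l t)) (fun m => y ^ m * gammaCoeff m) :=
  (expSeries_Gamma_one.scale y).congr (fun t => by rw [hl]) fun m => rfl

lemma Gamma_half_add {l : ℂ → ℂ} (y : ℂ) (hl : ∀ t, l t = 1 / 2 + y * t) :
    ExpSeries (fun t => Complex.Gamma (l t)) (fun m => y ^ m * gammaHalfCoeff m) :=
  (expSeries_Gamma_half.scale y).congr (fun t => by rw [hl]) fun m => rfl

lemma pow {f : ℂ → ℂ} {q : ℕ → ℂ} (h : ExpSeries f q) :
    ExpSeries (fun t => f t ^ 2) (fun m => 2 * q m) :=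
  (h.mul h).congr (fun _ => pow_two _) fun _ => two_mul _

end ExpSeries

/-- The exponent of the hypergeometric part of `S` along a line. -/
def sCoeff (α β γ : ℂ) (n m : ℕ) : ℂ :=
  ExpSeries.logCoeff m *
    (((-β) ^ m + β ^ m + (-γ) ^ m + γ ^ m + (β - 2 * α) ^ m + (γ - 2 * α) ^ m
        + (2 * β + γ - 2 * α) ^ m + (β + 2 * γ - 2 * α) ^ m) * (2 ^ m * H m (2 * n) - H m n)
      - ((-α) ^ m + (β - α) ^ m + (γ - α) ^ m + (β + γ - 2 * α) ^ m + (β + γ - α) ^ m) * H m n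
      - (β + γ - 2 * α) ^ m * H m (2 * n)
      - (β + γ - 2 * α) ^ m * (1 / (2 * n + 1) ^ m))

/-- The linear denominator `1 - 2a + b + c + 2n` is included here, so that only the polynomial `P`
is left outside the exponential; it produces the powers of `1 / (2n + 1)`. -/
lemma expSeries_core (α β γ : ℂ) (n : ℕ) :
    ExpSeries (fun t => core (α * t) (β * t) (γ * t) n
      / (-2 * (α * t) + β * t + γ * t + 2 * n + 1)) (sCoeff α β γ n) := by
  have h2 : (2 * (n : ℂ) + 1) ≠ 0 := by exact_mod_cast Nat.succ_ne_zero (2 * n)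
  have hnum := (((((((ExpSeries.rising_half_add n (l := fun t => 1 / 2 - β * t) (-β)
      (fun t => by ring)).mul
    (ExpSeries.rising_half_add n (l := fun t => β * t + 1 / 2) β (fun t => by ring))).mul
    (ExpSeries.rising_half_add n (l := fun t => 1 / 2 - γ * t) (-γ) (fun t => by ring))).mul
    (ExpSeries.rising_half_add n (l := fun t => γ * t + 1 / 2) γ (fun t => by ring))).mul
    (ExpSeries.rising_half_add n (l := fun t => -2 * (α * t) + β * t + 1 / 2) (β - 2 * α)
      (fun t => by ring))).mul
    (ExpSeries.rising_half_add n (l := fun t => -2 * (α * t) + γ * t + 1 / 2) (γ - 2 * α)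
      (fun t => by ring))).mul
    (ExpSeries.rising_half_add n (l := fun t => -2 * (α * t) + 2 * (β * t) + γ * t + 1 / 2)
      (2 * β + γ - 2 * α) (fun t => by ring))).mul
    (ExpSeries.rising_half_add n (l := fun t => -2 * (α * t) + β * t + 2 * (γ * t) + 1 / 2)
      (β + 2 * γ - 2 * α) (fun t => by ring))
  have hden := (ExpSeries.const (2 ^ (4 * n))).mul
    (((((((ExpSeries.const (rising 1 n)).mul
    (ExpSeries.rising_one_add n (l := fun t => 1 - α * t) (-α) (fun t => by ring))).mul
    (ExpSeries.rising_one_add n (l := fun t => -(α * t) + β * t + 1) (β - α)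
      (fun t => by ring))).mul
    (ExpSeries.rising_one_add n (l := fun t => -(α * t) + γ * t + 1) (γ - α)
      (fun t => by ring))).mul
    (ExpSeries.rising_one_add n (l := fun t => -2 * (α * t) + β * t + γ * t + 1)
      (β + γ - 2 * α) (fun t => by ring))).mul
    (ExpSeries.rising_one_add (2 * n) (l := fun t => -2 * (α * t) + β * t + γ * t + 1)
      (β + γ - 2 * α) (fun t => by ring))).mul
    (ExpSeries.rising_one_add n (l := fun t => -(α * t) + β * t + γ * t + 1) (β + γ - α)
      (fun t => by ring)))
  refine ((hnum.div hden).div (ExpSeries.linear h2 (β + γ - 2 * α))).congr (fun t => ?_)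
    (fun m => ?_)
  · rw [core]
    congr 1
    ring
  · rw [sCoeff]; ring

/-- The exponent of the value of the series along a line. -/
def valueCoeff (α β γ : ℂ) (m : ℕ) : ℂ :=
  ((-α) ^ m + (β - α) ^ m + (γ - α) ^ m + (β + γ - α) ^ m + 2 * (β + γ - 2 * α) ^ m) * gammaCoeff m
    - ((β - 2 * α) ^ m + (γ - 2 * α) ^ m + (2 * β + γ - 2 * α) ^ m + (β + 2 * γ - 2 * α) ^ m)
      * gammaHalfCoeff m
    + if m = 1 then (-4 * α + 2 * β + 2 * γ) * (Real.log 2 : ℂ) else 0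

lemma expSeries_value (α β γ : ℂ) :
    ExpSeries (fun t => value (α * t) (β * t) (γ * t)) (valueCoeff α β γ) := by
  have hnum := (((((ExpSeries.Gamma_one_add (l := fun t => 1 - α * t) (-α) (fun t => by ring)).mul
    ((expSeries_two_cpow (-4 * α + 2 * β + 2 * γ) 5).congr
      (f₂ := fun t => (2 : ℂ) ^ (-4 * (α * t) + 2 * (β * t) + 2 * (γ * t) + 5))
      (fun t => by congr 1; ring) (fun m => rfl))).mul
    (ExpSeries.Gamma_one_add (l := fun t => -(α * t) + β * t + 1) (β - α) (fun t => by ring))).mul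
    (ExpSeries.Gamma_one_add (l := fun t => -(α * t) + γ * t + 1) (γ - α) (fun t => by ring))).mul
    (ExpSeries.Gamma_one_add (l := fun t => -2 * (α * t) + β * t + γ * t + 1) (β + γ - 2 * α)
      (fun t => by ring)).pow).mul
    (ExpSeries.Gamma_one_add (l := fun t => -(α * t) + β * t + γ * t + 1) (β + γ - α)
      (fun t => by ring))
  have hden := ((((ExpSeries.const (Real.pi : ℂ)).mul
    (ExpSeries.Gamma_half_add (l := fun t => -2 * (α * t) + β * t + 1 / 2) (β - 2 * α)
      (fun t => by ring))).mul
    (ExpSeries.Gamma_half_add (l := fun t => -2 * (α * t) + γ * t + 1 / 2) (γ - 2 * α)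
      (fun t => by ring))).mul
    (ExpSeries.Gamma_half_add (l := fun t => -2 * (α * t) + 2 * (β * t) + γ * t + 1 / 2)
      (2 * β + γ - 2 * α) (fun t => by ring))).mul
    (ExpSeries.Gamma_half_add (l := fun t => -2 * (α * t) + β * t + 2 * (γ * t) + 1 / 2)
      (β + 2 * γ - 2 * α) (fun t => by ring))
  refine (hnum.div hden).congr (fun t => rfl) (fun m => ?_)
  rw [valueCoeff]; ring

lemma value_zero : value 0 0 0 = 32 / (Real.pi : ℂ) ^ 3 := by
  have hpi : (Real.pi : ℂ) ≠ 0 := by exact_mod_cast Real.pi_ne_zero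
  have h1 : Complex.Gamma (1 / 2) ^ 2 = Real.pi := by
    rw [Complex.Gamma_one_half_eq, ← Complex.cpow_nat_mul]; norm_num
  have h2 : (2 : ℂ) ^ (5 : ℂ) = 32 := by
    rw [show (5 : ℂ) = (5 : ℕ) by norm_num, Complex.cpow_natCast]; norm_num
  have h3 : Complex.Gamma (1 / 2) ^ 4 = (Real.pi : ℂ) ^ 2 := by rw [← h1]; ring
  rw [value]
  norm_num [h2]
  norm_num at h3
  rw [show (Real.pi : ℂ) * Complex.Gamma (1 / 2) * Complex.Gamma (1 / 2) * Complex.Gamma (1 / 2)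
    * Complex.Gamma (1 / 2) = Real.pi * Complex.Gamma (1 / 2) ^ 4 by ring, h3]
  congr 1
  ring

lemma taylor_value (α β γ : ℂ) {N : ℕ} (hN : N ≤ 5) :
    taylor N (fun t => value (α * t) (β * t) (γ * t))
      = 32 / (Real.pi : ℂ) ^ 3 * bell (valueCoeff α β γ) N := by
  rw [(expSeries_value α β γ).taylor_eq_bell hN]
  simp only [mul_zero, value_zero]

/-- One of the eight numerator symbols `(1/2)_n` cancels, since `(2n)! = 4^n n! (1/2)_n`. The
remaining powers of 2 combine to `2^(-6n)`. -/
lemma core_origin (n : ℕ) : core 0 0 0 n = A n := by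
  have h0 : rising (1 / 2) n ≠ 0 := by
    refine rising_ne_zero (fun m => ?_) n
    have : (2 * (m : ℂ) + 1) ≠ 0 := by exact_mod_cast Nat.succ_ne_zero (2 * m)
    intro h
    apply this
    linear_combination 2 * h
  have hf : (n ! : ℂ) ≠ 0 := by exact_mod_cast n.factorial_ne_zero
  have h1 : rising 1 (2 * n) = 4 ^ n * (n ! : ℂ) * rising (1 / 2) n := by
    rw [rising_half, rising_one]
  have h2 : (4 : ℂ) ^ n = (2 ^ n) ^ 2 := by rw [← pow_mul, mul_comm, pow_mul]; norm_num
  have h3 : (2 : ℂ) ^ (4 * n) = (2 ^ n) ^ 4 := by rw [← pow_mul, mul_comm]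
  have h4 : ((1 : ℂ) / 2 ^ 6) ^ n = 1 / (2 ^ n) ^ 6 := by
    rw [div_pow, one_pow, ← pow_mul, ← pow_mul, mul_comm]
  have h5 : (2 : ℂ) ^ n ≠ 0 := pow_ne_zero _ two_ne_zero
  rw [core, A, h3, h4]
  simp only [mul_zero, add_zero, sub_zero, zero_add, neg_zero]
  rw [h1, h2, rising_one]
  field_simp

/-- The coefficients of the polynomial `P` along a line. -/
def polyCoeff (α β γ : ℂ) (n : ℕ) : ℕ → ℂ
  | 0 => (2 * n + 1) * (168 * (n : ℂ) ^ 3 + 76 * (n : ℂ) ^ 2 + 14 * n + 1)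
  | 1 => (β + γ - 2 * α) * (672 * (n : ℂ) ^ 3 + 480 * (n : ℂ) ^ 2 + 104 * n + 8)
  | 2 => (β ^ 2 + γ ^ 2) / 2 * (-96 * (n : ℂ) ^ 2 - 64 * n - 8)
      + (β + γ - 2 * α) ^ 2 * (480 * (n : ℂ) ^ 2 + 224 * n + 24)
  | 3 => (β ^ 2 + γ ^ 2) / 2 * (β + γ - 2 * α) * (-96 * n - 32)
      + (β + γ - 2 * α) ^ 3 * (144 * n + 32)
  | 4 => 16 * (β * γ) ^ 2 - 16 * (β ^ 2 + γ ^ 2) * (β + γ - 2 * α) ^ 2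
      + 16 * (β + γ - 2 * α) ^ 4
  | _ => 0

lemma P_line (α β γ t : ℂ) (n : ℕ) : P (α * t) (β * t) (γ * t) n
    = ∑ k ∈ Finset.range 5, polyCoeff α β γ n k * t ^ k := by
  simp only [Finset.sum_range_succ, Finset.sum_range_zero, polyCoeff]
  rw [P_eq_polyHat, polyHat]
  ring

lemma taylor_P (α β γ : ℂ) (n N : ℕ) :
    AnalyticAt ℂ (fun t => P (α * t) (β * t) (γ * t) n) 0 ∧
    taylor N (fun t => P (α * t) (β * t) (γ * t) n) = polyCoeff α β γ n N := by
  have h : ∀ t : ℂ, ‖t‖ < 1 →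
      HasSum (fun m => polyCoeff α β γ n m * t ^ m) (P (α * t) (β * t) (γ * t) n) := by
    intro t _
    rw [P_line]
    refine hasSum_sum_of_ne_finset_zero fun m hm => ?_
    rw [Finset.mem_range, not_lt] at hm
    obtain ⟨k, rfl⟩ := Nat.exists_eq_add_of_le' hm
    rw [polyCoeff, zero_mul]
    all_goals intros; omega
  exact ⟨(taylor_of_hasSum one_pos h).1, (taylor_of_hasSum one_pos h).2 N⟩

/-- The Taylor coefficients of the summand along a line. -/
lemma taylor_S (α β γ : ℂ) {N : ℕ} (hN : N ≤ 5) (n : ℕ) :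
    taylor N (fun t => S (α * t) (β * t) (γ * t) n)
      = A n / (2 * n + 1)
        * ∑ k ∈ Finset.range (N + 1), polyCoeff α β γ n k * bell (sCoeff α β γ n) (N - k) := by
  have hE := expSeries_core α β γ n
  have e : (fun t => S (α * t) (β * t) (γ * t) n) = fun t => P (α * t) (β * t) (γ * t) n
      * (core (α * t) (β * t) (γ * t) n / (-2 * (α * t) + β * t + γ * t + 2 * n + 1)) := by
    funext t
    rw [S_eq_core]; ring
  rw [e, taylor_mul (taylor_P α β γ n N).1 hE.analyticAt, Finset.mul_sum]
  refine Finset.sum_congr rfl fun k hk => ?_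
  rw [(taylor_P α β γ n k).2, hE.taylor_eq_bell (by omega)]
  simp only [mul_zero, core_origin, zero_add]
  ring

/-! ### The harmonic-number series -/

lemma CoeffIdentity.congr {N : ℕ} {f g : ℕ → ℂ} {v w : ℂ} (h : CoeffIdentity N f v)
    (hf : ∀ n, f n = g n) (hv : v = w) : CoeffIdentity N g w := by
  rw [← hv, ← funext hf]
  exact h

/-- Each harmonic-number series is a rational combination of these. Write `s = β + γ - 2α`: the
first-order exponent of the summand is `s (7(H_{2n} - H_n) - 1/(2n + 1))`, and that of the value is
`10 s log 2`, Euler's constant cancelling. -/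
lemma coeffIdentity_bell (α β γ : ℚ) {N : ℕ} (hN : N ≤ 5) :
    CoeffIdentity N (fun n => A n / (2 * n + 1)
        * ∑ k ∈ Finset.range (N + 1), polyCoeff α β γ n k * bell (sCoeff α β γ n) (N - k))
      (32 / (Real.pi : ℂ) ^ 3 * bell (valueCoeff α β γ) N) :=
  (coeffIdentity_line α β γ N).congr (fun n => taylor_S α β γ hN n) (taylor_value α β γ hN)

lemma coeffIdentity_one : CoeffIdentity 1
      (fun n : ℕ => A n *
        (p1 n / 7 + (-H 1 n + H 1 (2 * n)) * p0 n * p2 n))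
      (320 * (Real.log 2 : ℂ) / (7 * (Real.pi : ℂ) ^ 3)) := by
  have hpi : (Real.pi : ℂ) ≠ 0 := by exact_mod_cast Real.pi_ne_zero
  refine ((coeffIdentity_bell 0 1 0 (N := 1) (by norm_num)).rat_mul (1 / 7)).congr
    (fun n => ?_) ?_
  · have h : (2 * (n : ℂ) + 1) ≠ 0 := by exact_mod_cast Nat.succ_ne_zero (2 * n)
    have h' : (1 + 2 * (n : ℂ)) ≠ 0 := by rwa [add_comm]
    simp only [Finset.sum_range_succ, Finset.sum_range_zero, polyCoeff, bell, sCoeff,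
      ExpSeries.logCoeff, p0, p1, p2]
    push_cast
    rw [add_comm (1 : ℂ) (2 * n)] at *
    field_simp
    ring
  · simp only [bell, valueCoeff, gammaHalfCoeff, gammaCoeff]
    norm_num
    field_simp
    ring

/-- The direction (0, 1, -1) has `s = 0`, and all odd exponents vanish on it, so neither `H^{(1)}`
nor log 2 appears. -/
lemma coeffIdentity_two : CoeffIdentity 2
      (fun n : ℕ => A n * p2 n *
        (1 / 336 + (-5 * H 2 n + 16 * H 2 (2 * n)) * p0 n / 2688))
      (5 / (504 * (Real.pi : ℂ))) := by
  have hpi : (Real.pi : ℂ) ≠ 0 := by exact_mod_cast Real.pi_ne_zero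
  refine ((coeffIdentity_bell 0 1 (-1) (N := 2) (by norm_num)).rat_mul (-1 / 2688)).congr
    (fun n => ?_) ?_
  · have h : (2 * (n : ℂ) + 1) ≠ 0 := by exact_mod_cast Nat.succ_ne_zero (2 * n)
    have h' : (1 + 2 * (n : ℂ)) ≠ 0 := by rwa [add_comm]
    simp only [Finset.sum_range_succ, Finset.sum_range_zero, polyCoeff, bell, sCoeff,
      ExpSeries.logCoeff, p0, p2]
    push_cast
    rw [add_comm (1 : ℂ) (2 * n)] at *
    field_simp
    ring
  · simp only [bell, valueCoeff, gammaHalfCoeff, gammaCoeff]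
    norm_num [riemannZeta_two]
    field_simp
    ring

/-- The coefficient of `H_{2n}^{(2)}` comes with weight 32 along (0, 1, -1) and 31 along (0, 1, 0);
the factor -31/224 makes these cancel. -/
lemma coeffIdentity_two_sq : CoeffIdentity 2
      (fun n : ℕ => A n *
        ((-H 1 n + H 1 (2 * n)) * p1 n
          + 1 / 32 * (112 * H 1 n ^ 2 - 224 * H 1 n * H 1 (2 * n) + 112 * H 1 (2 * n) ^ 2
              + 3 * H 2 n) * p0 n * p2 n
          + p3 n / 28))
      (1600 * (Real.log 2 : ℂ) ^ 2 / (7 * (Real.pi : ℂ) ^ 3) - 23 / (14 * (Real.pi : ℂ))) := by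
  have hpi : (Real.pi : ℂ) ≠ 0 := by exact_mod_cast Real.pi_ne_zero
  refine (((coeffIdentity_bell 0 1 (-1) (N := 2) (by norm_num)).rat_mul (-31 / 224)).add
    ((coeffIdentity_bell 0 1 0 (N := 2) (by norm_num)).rat_mul (1 / 7))).congr
    (fun n => ?_) ?_
  · have h : (2 * (n : ℂ) + 1) ≠ 0 := by exact_mod_cast Nat.succ_ne_zero (2 * n)
    have h' : (1 + 2 * (n : ℂ)) ≠ 0 := by rwa [add_comm]
    simp only [Finset.sum_range_succ, Finset.sum_range_zero, polyCoeff, bell, sCoeff,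
      ExpSeries.logCoeff, p0, p1, p2, p3]
    push_cast
    rw [add_comm (1 : ℂ) (2 * n)] at *
    field_simp
    ring
  · simp only [bell, valueCoeff, gammaHalfCoeff, gammaCoeff]
    norm_num [riemannZeta_two]
    field_simp
    ring

/-- The two directions have `s = 1` and `s = 2`; the weights satisfy `-1/6 + 2³/48 = 0`, which
removes the cube of the first-order exponent. -/
lemma coeffIdentity_three : CoeffIdentity 3
      (fun n : ℕ => A n *
        (1 + 1 / 24 * (-5 * H 2 n + 16 * H 2 (2 * n)) * p1 n
          + 7 / 3 * (-H 1 n + H 1 (2 * n)) * p2 n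
          + 1 / 24 * (35 * H 1 n * H 2 n - 35 * H 1 (2 * n) * H 2 n + 5 * H 3 n
              - 112 * H 1 n * H 2 (2 * n) + 112 * H 1 (2 * n) * H 2 (2 * n)
              - 32 * H 3 (2 * n)) * p0 n * p2 n))
      (100 * (Real.log 2 : ℂ) / (9 * (Real.pi : ℂ))
        - 36 * riemannZeta 3 / (Real.pi : ℂ) ^ 3) := by
  have hpi : (Real.pi : ℂ) ≠ 0 := by exact_mod_cast Real.pi_ne_zero
  refine (((coeffIdentity_bell 0 1 0 (N := 3) (by norm_num)).rat_mul (-1 / 6)).add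
    ((coeffIdentity_bell 0 1 1 (N := 3) (by norm_num)).rat_mul (1 / 48))).congr
    (fun n => ?_) ?_
  · have h : (2 * (n : ℂ) + 1) ≠ 0 := by exact_mod_cast Nat.succ_ne_zero (2 * n)
    have h' : (1 + 2 * (n : ℂ)) ≠ 0 := by rwa [add_comm]
    simp only [Finset.sum_range_succ, Finset.sum_range_zero, polyCoeff, bell, sCoeff,
      ExpSeries.logCoeff, p0, p1, p2]
    push_cast
    rw [add_comm (1 : ℂ) (2 * n)] at *
    field_simp
    ring
  · simp only [bell, valueCoeff, gammaHalfCoeff, gammaCoeff]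
    norm_num [riemannZeta_two]
    field_simp
    ring

/-- On both lines `s = 0` and the odd exponents vanish. The second-order exponent along (1, 2, 0) is
twice that along (0, 1, -1), so its square cancels with weights 1/16 and -1/64. -/
lemma coeffIdentity_four : CoeffIdentity 4
      (fun n : ℕ => A n *
        (1 / (1 + 2 * (n : ℂ))
          + 1 / 64 * (-7 * H 4 n + 128 * H 4 (2 * n)) * p0 n * p2 n))
      (61 * (Real.pi : ℂ) / 180) := by
  have hpi : (Real.pi : ℂ) ≠ 0 := by exact_mod_cast Real.pi_ne_zero
  refine (((coeffIdentity_bell 0 1 (-1) (N := 4) (by norm_num)).rat_mul (1 / 16)).add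
    ((coeffIdentity_bell 1 2 0 (N := 4) (by norm_num)).rat_mul (-1 / 64))).congr
    (fun n => ?_) ?_
  · have h : (2 * (n : ℂ) + 1) ≠ 0 := by exact_mod_cast Nat.succ_ne_zero (2 * n)
    have h' : (1 + 2 * (n : ℂ)) ≠ 0 := by rwa [add_comm]
    simp only [Finset.sum_range_succ, Finset.sum_range_zero, polyCoeff, bell, sCoeff,
      ExpSeries.logCoeff, p0, p2]
    push_cast
    rw [add_comm (1 : ℂ) (2 * n)] at *
    field_simp
    ring
  · simp only [bell, valueCoeff, gammaHalfCoeff, gammaCoeff]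
    norm_num [riemannZeta_four]
    field_simp
    ring

/-- The same two lines as for the other series of order four; halving the second weight leaves the
square of the second-order exponent in place. -/
lemma coeffIdentity_four_sq : CoeffIdentity 4
      (fun n : ℕ => A n *
        (1 / (1 + 2 * (n : ℂ))
          + (-5 * H 2 n + 16 * H 2 (2 * n)) / 4 * p2 n
          + (50 * H 2 n ^ 2 + 3 * H 4 n - 320 * H 2 n * H 2 (2 * n) + 512 * H 2 (2 * n) ^ 2)
            * p0 n / 128 * p2 n))
      (16 * (Real.pi : ℂ) / 45) := by
  have hpi : (Real.pi : ℂ) ≠ 0 := by exact_mod_cast Real.pi_ne_zero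
  refine (((coeffIdentity_bell 0 1 (-1) (N := 4) (by norm_num)).rat_mul (1 / 16)).add
    ((coeffIdentity_bell 1 2 0 (N := 4) (by norm_num)).rat_mul (-1 / 128))).congr
    (fun n => ?_) ?_
  · have h : (2 * (n : ℂ) + 1) ≠ 0 := by exact_mod_cast Nat.succ_ne_zero (2 * n)
    have h' : (1 + 2 * (n : ℂ)) ≠ 0 := by rwa [add_comm]
    simp only [Finset.sum_range_succ, Finset.sum_range_zero, polyCoeff, bell, sCoeff,
      ExpSeries.logCoeff, p0, p2]
    push_cast
    rw [add_comm (1 : ℂ) (2 * n)] at *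
    field_simp
    ring
  · simp only [bell, valueCoeff, gammaHalfCoeff, gammaCoeff]
    norm_num [riemannZeta_two, riemannZeta_four]
    field_simp
    ring

-- Four lines, with `s` equal to 1, 2, -2 and 3. The weights remove every product with `H^{(2)}` or
-- `H^{(3)}` and every higher power of `H^{(1)}`; for the fifth power this reads `5/16 + 5 · 2⁵/32 -
-- 2⁵/128 - 3⁵/48 = 0`.
set_option maxHeartbeats 2000000 in
lemma coeffIdentity_five : CoeffIdentity 5
      (fun n : ℕ => A n *
        (-((1 + 7 * (1 + 2 * (n : ℂ)) * (H 1 n - H 1 (2 * n))) / (1 + 2 * (n : ℂ)) ^ 2)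
          + 1 / 64 * (-7 * H 4 n + 128 * H 4 (2 * n)) * p1 n
          + 1 / 64 * (49 * H 1 n * H 4 n - 49 * H 1 (2 * n) * H 4 n + 14 * H 5 n
              - 896 * H 1 n * H 4 (2 * n) + 896 * H 1 (2 * n) * H 4 (2 * n)
              - 512 * H 5 (2 * n)) * p0 n * p2 n))
      (61 * (Real.pi : ℂ) * (Real.log 2 : ℂ) / 18
        - 249 * riemannZeta 5 / (Real.pi : ℂ) ^ 3) := by
  have hpi : (Real.pi : ℂ) ≠ 0 := by exact_mod_cast Real.pi_ne_zero
  refine (((((coeffIdentity_bell 0 1 0 (N := 5) (by norm_num)).rat_mul (5 / 16)).add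
    ((coeffIdentity_bell 0 1 1 (N := 5) (by norm_num)).rat_mul (5 / 32))).add
    ((coeffIdentity_bell 1 0 0 (N := 5) (by norm_num)).rat_mul (1 / 128))).add
    ((coeffIdentity_bell 0 1 2 (N := 5) (by norm_num)).rat_mul (-1 / 48))).congr
    (fun n => ?_) ?_
  · have h : (2 * (n : ℂ) + 1) ≠ 0 := by exact_mod_cast Nat.succ_ne_zero (2 * n)
    have h' : (1 + 2 * (n : ℂ)) ≠ 0 := by rwa [add_comm]
    simp only [Finset.sum_range_succ, Finset.sum_range_zero, polyCoeff, bell, sCoeff,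
      ExpSeries.logCoeff, p0, p1, p2]
    push_cast
    norm_num
    rw [add_comm (1 : ℂ) (2 * n)] at *
    field_simp
    ring
  · simp only [bell, valueCoeff, gammaHalfCoeff, gammaCoeff]
    norm_num [riemannZeta_two, riemannZeta_four]
    field_simp
    ring

/-! ### The specialization at the origin -/

lemma S_zero (n : ℕ) :
    S 0 0 0 n = A n * (168 * (n : ℂ) ^ 3 + 76 * (n : ℂ) ^ 2 + 14 * n + 1) := by
  have h : (2 * (n : ℂ) + 1) ≠ 0 := by exact_mod_cast Nat.succ_ne_zero (2 * n)
  rw [S_eq_core, core_origin, P]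
  simp only [mul_zero, add_zero, zero_add]
  rw [← mul_div_assoc, div_eq_iff h]
  ring

lemma hasSum_S_zero :
    HasSum (fun n : ℕ => A n * (168 * (n : ℂ) ^ 3 + 76 * (n : ℂ) ^ 2 + 14 * n + 1))
      (32 / (Real.pi : ℂ) ^ 3) := by
  have h : Admissible 0 0 0 := admissible_of_norm_le (by norm_num) (by norm_num) (by norm_num)
  rw [← value_zero]
  exact (hasSum_S h).congr_fun fun n => (S_zero n).symm

end GourevichExt

end

theorem mainTheorem5 :
    -- the three-parameter summation formula
    (∀ a b c : ℂ,
      (∀ m : ℕ, a ≠ m + 1 ∧ a - b ≠ m + 1 ∧ a - c ≠ m + 1 ∧ 2 * a - b - c ≠ m + 1 ∧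
        a - b - c ≠ m + 1) →
      HasSum (fun n : ℕ => GourevichExt.S a b c n)
        (Complex.Gamma (1 - a) * (2 : ℂ) ^ (-4 * a + 2 * b + 2 * c + 5)
            * Complex.Gamma (-a + b + 1) * Complex.Gamma (-a + c + 1)
            * Complex.Gamma (-2 * a + b + c + 1) ^ 2 * Complex.Gamma (-a + b + c + 1)
          / (Real.pi * Complex.Gamma (-2 * a + b + 1 / 2) * Complex.Gamma (-2 * a + c + 1 / 2)
            * Complex.Gamma (-2 * a + 2 * b + c + 1 / 2)
            * Complex.Gamma (-2 * a + b + 2 * c + 1 / 2)))) ∧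
    -- the specialization `a = b = c = 0`
    (∀ n : ℕ, GourevichExt.S 0 0 0 n
      = GourevichExt.A n * (168 * (n : ℂ) ^ 3 + 76 * (n : ℂ) ^ 2 + 14 * n + 1)) ∧
    HasSum (fun n : ℕ =>
        GourevichExt.A n * (168 * (n : ℂ) ^ 3 + 76 * (n : ℂ) ^ 2 + 14 * n + 1))
      (32 / (Real.pi : ℂ) ^ 3) ∧
    -- the harmonic-number series
    GourevichExt.CoeffIdentity 1
      (fun n : ℕ => GourevichExt.A n *
        (GourevichExt.p1 n / 7
          + (-GourevichExt.H 1 n + GourevichExt.H 1 (2 * n))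
            * GourevichExt.p0 n * GourevichExt.p2 n))
      (320 * (Real.log 2 : ℂ) / (7 * (Real.pi : ℂ) ^ 3)) ∧
    GourevichExt.CoeffIdentity 2
      (fun n : ℕ => GourevichExt.A n * GourevichExt.p2 n *
        (1 / 336
          + (-5 * GourevichExt.H 2 n + 16 * GourevichExt.H 2 (2 * n))
            * GourevichExt.p0 n / 2688))
      (5 / (504 * (Real.pi : ℂ))) ∧
    GourevichExt.CoeffIdentity 2
      (fun n : ℕ => GourevichExt.A n *
        ((-GourevichExt.H 1 n + GourevichExt.H 1 (2 * n)) * GourevichExt.p1 n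
          + 1 / 32 * (112 * GourevichExt.H 1 n ^ 2
              - 224 * GourevichExt.H 1 n * GourevichExt.H 1 (2 * n)
              + 112 * GourevichExt.H 1 (2 * n) ^ 2 + 3 * GourevichExt.H 2 n)
            * GourevichExt.p0 n * GourevichExt.p2 n
          + GourevichExt.p3 n / 28))
      (1600 * (Real.log 2 : ℂ) ^ 2 / (7 * (Real.pi : ℂ) ^ 3) - 23 / (14 * (Real.pi : ℂ))) ∧
    GourevichExt.CoeffIdentity 3
      (fun n : ℕ => GourevichExt.A n *
        (1 + 1 / 24 * (-5 * GourevichExt.H 2 n + 16 * GourevichExt.H 2 (2 * n))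
            * GourevichExt.p1 n
          + 7 / 3 * (-GourevichExt.H 1 n + GourevichExt.H 1 (2 * n)) * GourevichExt.p2 n
          + 1 / 24 * (35 * GourevichExt.H 1 n * GourevichExt.H 2 n
              - 35 * GourevichExt.H 1 (2 * n) * GourevichExt.H 2 n
              + 5 * GourevichExt.H 3 n
              - 112 * GourevichExt.H 1 n * GourevichExt.H 2 (2 * n)
              + 112 * GourevichExt.H 1 (2 * n) * GourevichExt.H 2 (2 * n)
              - 32 * GourevichExt.H 3 (2 * n))
            * GourevichExt.p0 n * GourevichExt.p2 n))
      (100 * (Real.log 2 : ℂ) / (9 * (Real.pi : ℂ))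
        - 36 * riemannZeta 3 / (Real.pi : ℂ) ^ 3) ∧
    GourevichExt.CoeffIdentity 4
      (fun n : ℕ => GourevichExt.A n *
        (1 / (1 + 2 * (n : ℂ))
          + 1 / 64 * (-7 * GourevichExt.H 4 n + 128 * GourevichExt.H 4 (2 * n))
            * GourevichExt.p0 n * GourevichExt.p2 n))
      (61 * (Real.pi : ℂ) / 180) ∧
    GourevichExt.CoeffIdentity 4
      (fun n : ℕ => GourevichExt.A n *
        (1 / (1 + 2 * (n : ℂ))
          + (-5 * GourevichExt.H 2 n + 16 * GourevichExt.H 2 (2 * n)) / 4 * GourevichExt.p2 n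
          + (50 * GourevichExt.H 2 n ^ 2 + 3 * GourevichExt.H 4 n
              - 320 * GourevichExt.H 2 n * GourevichExt.H 2 (2 * n)
              + 512 * GourevichExt.H 2 (2 * n) ^ 2)
            * GourevichExt.p0 n / 128 * GourevichExt.p2 n))
      (16 * (Real.pi : ℂ) / 45) ∧
    GourevichExt.CoeffIdentity 5
      (fun n : ℕ => GourevichExt.A n *
        (-((1 + 7 * (1 + 2 * (n : ℂ)) * (GourevichExt.H 1 n - GourevichExt.H 1 (2 * n)))
            / (1 + 2 * (n : ℂ)) ^ 2)
          + 1 / 64 * (-7 * GourevichExt.H 4 n + 128 * GourevichExt.H 4 (2 * n))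
            * GourevichExt.p1 n
          + 1 / 64 * (49 * GourevichExt.H 1 n * GourevichExt.H 4 n
              - 49 * GourevichExt.H 1 (2 * n) * GourevichExt.H 4 n
              + 14 * GourevichExt.H 5 n
              - 896 * GourevichExt.H 1 n * GourevichExt.H 4 (2 * n)
              + 896 * GourevichExt.H 1 (2 * n) * GourevichExt.H 4 (2 * n)
              - 512 * GourevichExt.H 5 (2 * n))
            * GourevichExt.p0 n * GourevichExt.p2 n))
      (61 * (Real.pi : ℂ) * (Real.log 2 : ℂ) / 18
        - 249 * riemannZeta 5 / (Real.pi : ℂ) ^ 3) := by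
  refine ⟨fun a b c h => GourevichExt.hasSum_S h, GourevichExt.S_zero, GourevichExt.hasSum_S_zero,
    GourevichExt.coeffIdentity_one, GourevichExt.coeffIdentity_two,
    GourevichExt.coeffIdentity_two_sq, GourevichExt.coeffIdentity_three,
    GourevichExt.coeffIdentity_four, GourevichExt.coeffIdentity_four_sq,
    GourevichExt.coeffIdentity_five⟩
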